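/- Let $\rho=|\psi\rangle\langle\psi|$ be a pure Gaussian state of $N$ bosonic modes on $L^2(\mathbb R^N)$, with quadratures $\hat R=(\hat q_1,\hat p_1,\dots,\hat q_N,\hat p_N)$, $[\hat q_k,\hat p_l]=i\delta_{kl}$, Hamiltonian $H=\tfrac12\sum_{k=1}^N(\hat q_k^2+\hat p_k^2)$, and covariance matrix $\Sigma_{st}=\langle \hat R_s\hat R_t+\hat R_t\hat R_s\rangle-2\langle\hat R_s\rangle\langle\hat R_t\rangle$. Let the set of modes be partitioned into $k$ disjoint non-empty sets $\mathcal A_1,\dots,\mathcal A_k$ with $|\mathcal A_j|=m_j$, $\sum_j m_j=N$, and let $\bar{\mathcal A}_j$ be the complement of $\mathcal A_j$. The global Gaussian ergotropy is $\mathcal E_G(\rho)=\operatorname{Tr}(\rho H)-\min_U\operatorname{Tr}(U\rho U^\dagger H)$, the minimum being over all Gaussian unitaries $U$ of the $N$ modes (unitaries acting on the quadratures by affine symplectic maps). For a family of disjoint sets of modes $\mathcal B_1,\dots,\mathcal B_l$ with union the set of all modes, the $l$-local Gaussian ergotropy $\mathcal E^{\mathcal B_1|\cdots|\mathcal B_l}_{l\text{-loc}}(\rho)$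 is defined in the same way with the minimum over all $U=\bigotimes_{j=1}^l U_{\mathcal B_j}$, where $U_{\mathcal B_j}$ is a Gaussian unitary of the modes in $\mathcal B_j$, and the $l$-local ergotropic gap is $\delta^{\mathcal B_1|\cdots|\mathcal B_l}_{l\text{-loc}}(\rho)=\mathcal E_G(\rho)-\mathcal E^{\mathcal B_1|\cdots|\mathcal B_l}_{l\text{-loc}}(\rho)$. Then $\operatorname{Tr}(\rho H)$ is finite, all minima entering the gaps below exist, and $$\delta^{\mathcal A_1|\cdots|\mathcal A_k}_{k\text{-loc}}(\rho)=\frac12\sum_{j=1}^k\sum_{i=1}^{m_j}\bigl(\nu_i^{\mathcal A_j}-1\bigr),$$ where $\nu^{\mathcal A_j}_1,\dots,\nu^{\mathcal A_j}_{m_j}$ are the symplectic eigenvalues of the reduced covariance matrix $\Sigma_{\mathcal A_j}$ of the modes in $\mathcal A_j$, that is, the positive eigenvalues, with multiplicity, of $i\Omega\Sigma_{\mathcal A_j}$, with $\Omega$ the symplectic form (there are exactly $m_j$ of them). Moreover, $$\delta^{\mathcal A_1|\cdots|\mathcal A_k}_{k\text{-loc}}(\rho)=\frac12\sum_{j=1}^k\delta^{\mathcal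 A_j|\bar{\mathcal A}_j}_{2\text{-loc}}(\rho),\qquad \delta^{\mathcal A_j|\bar{\mathcal A}_j}_{2\text{-loc}}(\rho)=\sum_{i=1}^{m_j}\bigl(\nu_i^{\mathcal A_j}-1\bigr)\quad(1\le j\le k).$$ -/

import Mathlib

noncomputable section

namespace ErgotropicGap

open MeasureTheory Matrix

variable {ι : Type*} [Fintype ι]

/-- The Hilbert space `L²(ℝ^ι)` of a system of bosonic modes labelled by `ι`. -/
abbrev Modes (ι : Type*) [Fintype ι] : Type _ :=
  Lp ℂ 2 (volume : Measure (ι → ℝ))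

/-- The function `x ↦ exp (i (b·x - a·b/2)) f (x - a)`, where `ξ = (a, b)`. -/
def weylFun (ξ : ι ⊕ ι → ℝ) (f : (ι → ℝ) → ℂ) (x : ι → ℝ) : ℂ :=
  Complex.exp (Complex.I *
      (((∑ i, ξ (Sum.inr i) * x i) - (∑ i, ξ (Sum.inl i) * ξ (Sum.inr i)) / 2 : ℝ) : ℂ)) *
    f (x - fun i => ξ (Sum.inl i))

theorem memLp_weylFun (ξ : ι ⊕ ι → ℝ) (f : Modes ι) :
    MemLp (weylFun ξ f) 2 (volume : Measure (ι → ℝ)) := by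
  have h1 : MemLp (fun x : ι → ℝ => f (x - fun i => ξ (Sum.inl i))) 2 volume :=
    (Lp.memLp f).comp_measurePreserving (measurePreserving_sub_right volume _)
  refine h1.of_le ?_ (Filter.Eventually.of_forall fun x => ?_)
  · refine AEStronglyMeasurable.mul (Continuous.aestronglyMeasurable ?_) h1.1
    fun_prop
  · rw [weylFun, norm_mul, mul_comm Complex.I, Complex.norm_exp_ofReal_mul_I, one_mul]

/-- The Weyl (displacement) operator `exp (i (b·q - a·p))`, `ξ = (a, b)`, on `L²(ℝ^ι)`. -/
def weyl (ξ : ι ⊕ ι → ℝ) (f : Modes ι) : Modes ι :=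
  (memLp_weylFun ξ f).toLp _

section Quadratures

variable [DecidableEq ι]

/-- The orbit of `ψ` under the one-parameter unitary group `exp (i t q_k)` (for `Sum.inl k`),
respectively `exp (-i t p_k)` (for `Sum.inr k`). -/
def orbit (ψ : Modes ι) : ι ⊕ ι → ℝ → Modes ι
  | Sum.inl k => fun t => weyl (t • Pi.single (Sum.inr k) 1) ψ
  | Sum.inr k => fun t => weyl (t • Pi.single (Sum.inl k) 1) ψ

/-- The quadrature operators `q_k` (index `Sum.inl k`) and `p_k` (index `Sum.inr k`), as the
self-adjoint generators of their unitary groups; the value is meaningful for `ψ` in the domain,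
that is, where the orbit is differentiable at `0`. -/
def quad (ψ : Modes ι) : ι ⊕ ι → Modes ι
  | Sum.inl k => (-Complex.I) • deriv (orbit ψ (Sum.inl k)) 0
  | Sum.inr k => Complex.I • deriv (orbit ψ (Sum.inr k)) 0

/-- `ψ` lies in the domain of every `q_k` and `p_k`, i.e. in the form domain of
`H = ½ ∑ₖ (q_k² + p_k²)`. -/
def FiniteEnergy (ψ : Modes ι) : Prop :=
  ∀ s, DifferentiableAt ℝ (orbit ψ s) 0

/-- `⟨ψ, H ψ⟩` for `H = ½ ∑ₖ (q_k² + p_k²)` (as a quadratic form, for `FiniteEnergy ψ`). -/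
def energy (ψ : Modes ι) : ℝ :=
  (1 / 2) * ∑ s, ‖quad ψ s‖ ^ 2

/-- First moments `⟨R_s⟩`. -/
def meanVec (ψ : Modes ι) (s : ι ⊕ ι) : ℝ :=
  (inner ℂ ψ (quad ψ s)).re

/-- Covariance matrix `Σ_{st} = ⟨R_s R_t + R_t R_s⟩ - 2 ⟨R_s⟩⟨R_t⟩`, the first term being
`2 Re ⟨R_s ψ, R_t ψ⟩`. -/
def covMatrix (ψ : Modes ι) : Matrix (ι ⊕ ι) (ι ⊕ ι) ℝ :=
  Matrix.of fun s t =>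
    2 * (inner ℂ (quad ψ s) (quad ψ t)).re - 2 * meanVec ψ s * meanVec ψ t

/-- Covariance matrix of the reduced state on the modes in `B`. -/
def reducedCov (B : Finset ι) (ψ : Modes ι) : Matrix (B ⊕ B) (B ⊕ B) ℝ :=
  (covMatrix ψ).submatrix (Sum.map Subtype.val Subtype.val) (Sum.map Subtype.val Subtype.val)

/-- The symplectic eigenvalues of a positive definite matrix `M`: the positive eigenvalues of
`i Ω M`, with multiplicity, where `Ω = -J` is the symplectic form in the ordering `(q, p)`. -/
def symplecticEigenvalues (M : Matrix (ι ⊕ ι) (ι ⊕ ι) ℝ) : Multiset ℝ :=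
  ((Complex.I • ((-(Matrix.J ι ℝ)) * M).map Complex.ofReal).charpoly.roots.map
    Complex.re).filter (fun x => 0 < x)

end Quadratures

/-- `ψ` is a unit vector and the characteristic function of the pure state `|ψ⟩⟨ψ|` is
Gaussian (first moments arbitrary). -/
def IsPureGaussian (ψ : Modes ι) : Prop :=
  ‖ψ‖ = 1 ∧ ∃ (d : ι ⊕ ι → ℝ) (M : Matrix (ι ⊕ ι) (ι ⊕ ι) ℝ), M.IsSymm ∧
    ∀ ξ, inner ℂ ψ (weyl ξ ψ) =
      Complex.exp (Complex.I * ((d ⬝ᵥ ξ : ℝ) : ℂ) - ((ξ ⬝ᵥ M *ᵥ ξ / 4 : ℝ) : ℂ))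

section Unitaries

variable [DecidableEq ι]

/-- Gaussian unitaries: unitaries that act on the phase space by an affine symplectic map,
expressed on Weyl operators, `U W(ξ) U† = exp (i d·ξ) W(S ξ)`. -/
def IsGaussianUnitary (U : Modes ι ≃ₗᵢ[ℂ] Modes ι) : Prop :=
  ∃ S ∈ Matrix.symplecticGroup ι ℝ, ∃ d : ι ⊕ ι → ℝ, ∀ (ξ : ι ⊕ ι → ℝ) (f : Modes ι),
    U (weyl ξ f) = Complex.exp (Complex.I * ((d ⬝ᵥ ξ : ℝ) : ℂ)) • weyl (S *ᵥ ξ) (U f)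

variable {κ : Type*} [Fintype κ]

/-- `F = ⨂_j f_j`, for `f_j ∈ L²(ℝ^{A_j})`. -/
def IsProductVector (A : κ → Finset ι) (f : ∀ j, Modes (A j)) (F : Modes ι) : Prop :=
  (F : (ι → ℝ) → ℂ) =ᵐ[volume] fun x => ∏ j, f j (fun i => x i)

/-- Local Gaussian unitaries `U = ⨂_j U_j`, each `U_j` a Gaussian unitary of the modes `A_j`. -/
def IsLocalGaussianUnitary (A : κ → Finset ι) (U : Modes ι ≃ₗᵢ[ℂ] Modes ι) : Prop :=
  ∃ V : ∀ j, Modes (A j) ≃ₗᵢ[ℂ] Modes (A j), (∀ j, IsGaussianUnitary (V j)) ∧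
    ∀ (f : ∀ j, Modes (A j)) (F : Modes ι),
      IsProductVector A f F → IsProductVector A (fun j => V j (f j)) (U F)

/-- The (finite) energies reachable from `ψ` by Gaussian unitaries. -/
def globalEnergies (ψ : Modes ι) : Set ℝ :=
  {e | ∃ U : Modes ι ≃ₗᵢ[ℂ] Modes ι,
    IsGaussianUnitary U ∧ FiniteEnergy (U ψ) ∧ e = energy (U ψ)}

/-- The (finite) energies reachable from `ψ` by local Gaussian unitaries. -/
def localEnergies (A : κ → Finset ι) (ψ : Modes ι) : Set ℝ :=
  {e | ∃ U : Modes ι ≃ₗᵢ[ℂ] Modes ι,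
    IsLocalGaussianUnitary A U ∧ FiniteEnergy (U ψ) ∧ e = energy (U ψ)}

/-- Global Gaussian ergotropy. -/
def globalErgotropy (ψ : Modes ι) : ℝ :=
  energy ψ - sInf (globalEnergies ψ)

/-- Local Gaussian ergotropy with respect to the partition `A`. -/
def localErgotropy (A : κ → Finset ι) (ψ : Modes ι) : ℝ :=
  energy ψ - sInf (localEnergies A ψ)

/-- Local ergotropic gap with respect to the partition `A`. -/
def ergotropicGap (A : κ → Finset ι) (ψ : Modes ι) : ℝ :=
  globalErgotropy ψ - localErgotropy A ψ

end Unitaries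

end ErgotropicGap

end

noncomputable section

namespace ErgotropicGap

open Matrix Polynomial
open scoped MatrixOrder ComplexOrder

/-! ### Square roots and absolute values of real matrices. -/

section LinearAlgebra

variable {n : Type*} [Fintype n]

/-! A state with characteristic function `exp(i d·ξ - ξ·Mξ/4)` has energy `tr M / 4 + |d|² / 2`, and
a Gaussian unitary replaces `M` by `Lᵀ M L` with `L` symplectic while shifting `d` freely. Both
ergotropies thus reduce to minimising a trace over symplectic congruences.

The trace minimum is `2 ∑ ν`. Write `M = R²`: the Hermitian matrix `H = i R Ω R` has the spectrum
`±ν` of `i Ω M`. Since `iΩ` is a Hermitian involution, `1 ± iΩ ≥ 0`, and compressing this by `R` in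
an eigenbasis of `H` bounds the sum of the `|eigenvalues|` by `tr M`. Equality is reached at `G =
R⁻¹ |R Ω R| R⁻¹`, which is positive definite and symplectic (`exists_hermitian_model`). Such a `G`
factors as `L Lᵀ` with `L` lower triangular (`exists_lowerSymplectic`), so a displacement, a chirp
and a dilation suffice to attain the minimum; no general metaplectic representation is needed.

Purity means `M J M = J`, hence all global `ν` are 1 and the global minimum is `N/2`. To prove it,
Fourier uniqueness identifies `conj ψ(x) ψ(x - a)` with an explicit Gaussian kernel, and the fact
that this kernel is a product of a function of `x` and a function of `x - a` forces the symplectic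
relations (`gaussKernel_factor`, `HasGaussianChar.symplectic`).

A local unitary is known only through product vectors. These are total, so it has the block diagonal
Weyl covariance of its factors (`weyl_covariance_of_local`). The energy sees only the diagonal
blocks of `M`, so the local minimum is the sum of the minima of the blocks, and subtracting `N/2 = ∑
m_j / 2` gives the first formula.

For a bipartition put `T = J M`, so `T² = -1`. The diagonal blocks of this identity say that
`(iΩM_A)² - 1` and its counterpart on the complement are `XY` and `YX` for the off-diagonal blocks
`X`, `Y` of `T`. Their nonzero spectra coincide, so both sides contribute the same `∑ (ν - 1)`
(`sum_sub_one_compl`), which cancels the factor `1/2`. -/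

theorem map_ofReal_mul (A B : Matrix n n ℝ) :
    (A * B).map Complex.ofReal = A.map Complex.ofReal * B.map Complex.ofReal :=
  Matrix.map_mul (f := Complex.ofRealHom)

theorem roots_prod_univ_X_sub_C (f : n → ℂ) :
    (∏ i, (X - C (f i))).roots = Finset.univ.val.map f := by
  have : (∏ i, (X - C (f i))) = (Multiset.map (fun a => X - C a) (Finset.univ.val.map f)).prod := by
    rw [Multiset.map_map]
    rfl
  rw [this, roots_multiset_prod_X_sub_C]

variable [DecidableEq n]

theorem exists_posDef_sqrt {M : Matrix n n ℝ} (hM : M.PosDef) :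
    ∃ R : Matrix n n ℝ, R.PosDef ∧ R * R = M := by
  have h : CFC.sqrt M * CFC.sqrt M = M := CFC.sqrt_mul_sqrt_self M hM.posSemidef.nonneg
  refine ⟨CFC.sqrt M, ?_, h⟩
  rw [(CFC.sqrt_nonneg M).posSemidef.posDef_iff_det_ne_zero]
  intro h0
  have := congrArg det h
  rw [det_mul, h0, zero_mul] at this
  exact hM.det_pos.ne this

theorem posSemidef_map_ofReal {P : Matrix n n ℝ} (hP : P.PosSemidef) :
    (P.map Complex.ofReal).PosSemidef := by
  have h : CFC.sqrt P * CFC.sqrt P = P := CFC.sqrt_mul_sqrt_self P hP.nonneg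
  have hs : (CFC.sqrt P)ᴴ = CFC.sqrt P := (CFC.sqrt_nonneg P).posSemidef.isHermitian
  have : P.map Complex.ofReal =
      ((CFC.sqrt P).map Complex.ofReal)ᴴ * (CFC.sqrt P).map Complex.ofReal := by
    rw [← Matrix.conjTranspose_map (f := Complex.ofReal) (fun x => by simp), hs]
    conv_lhs => rw [← h]
    exact map_ofReal_mul _ _
  rw [this]
  exact posSemidef_conjTranspose_mul_self _

/-- The absolute value of an invertible skew-symmetric real matrix `K`; its trace is the trace norm
of the Hermitian matrix `i K`. -/
theorem exists_abs_of_skew {K : Matrix n n ℝ} (hK : Kᵀ = -K) (hdet : K.det ≠ 0)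
    (hH : (Complex.I • K.map Complex.ofReal).IsHermitian) :
    ∃ P : Matrix n n ℝ, P.PosDef ∧ P * P = -(K * K) ∧ P * K = K * P ∧
      P.trace = ∑ i, |hH.eigenvalues i| := by
  have hstar : star K = -K := by
    rw [star_eq_conjTranspose, conjTranspose_eq_transpose_of_trivial, hK]
  have hsq : CFC.abs K * CFC.abs K = -(K * K) := by
    rw [CFC.abs_mul_abs, hstar, neg_mul]
  have hps : (CFC.abs K).PosSemidef := (CFC.abs_nonneg K).posSemidef
  refine ⟨CFC.abs K, ?_, hsq, ?_, ?_⟩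
  · rw [hps.posDef_iff_det_ne_zero]
    intro h0
    have := congrArg det hsq
    rw [det_mul, h0, zero_mul, ← neg_mul, det_mul, det_neg] at this
    simp [hdet] at this
  · refine (Commute.cfcAbs_left (Commute.refl K) ?_)
    rw [hstar]
    exact (Commute.refl K).neg_right
  · set H := Complex.I • K.map Complex.ofReal with hHdef
    have hab : CFC.abs H = (CFC.abs K).map Complex.ofReal := by
      -- The absolute value of `H` is the positive root of `H²`, and `(iK)² = -K² = |K|²`.
      refine CFC.sqrt_unique ?_ (posSemidef_map_ofReal hps).nonneg
      have h1 : star H = H := hH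
      rw [h1, hHdef, ← map_ofReal_mul, hsq, smul_mul_smul_comm, Complex.I_mul_I, ← map_ofReal_mul]
      ext i j
      simp
    have h2 : (CFC.abs H).trace = ∑ i, ((|hH.eigenvalues i| : ℝ) : ℂ) := by
      rw [trace_eq_sum_roots_charpoly, CFC.abs_eq_cfc_norm H hH, hH.charpoly_cfc_eq,
        roots_prod_univ_X_sub_C]
      simp
    rw [hab] at h2
    have h3 : ((CFC.abs K).map Complex.ofReal).trace = (((CFC.abs K).trace : ℝ) : ℂ) := by
      simp [trace]
    rw [h3] at h2
    exact_mod_cast h2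

end LinearAlgebra

/-! ### The Hermitian model of a positive definite matrix and the trace minimum. -/

section Symplectic

variable {ι : Type*}

theorem isHermitian_I_smul_map {K : Matrix (ι ⊕ ι) (ι ⊕ ι) ℝ} (hK : Kᵀ = -K) :
    (Complex.I • K.map Complex.ofReal).IsHermitian := by
  ext i j
  have := congrFun (congrFun hK i) j
  simp only [transpose_apply] at this
  simp [this]

variable [Fintype ι] [DecidableEq ι]

/-- The matrix `i Ω M` whose positive eigenvalues are the symplectic eigenvalues of `M`. -/
def sympOp (M : Matrix (ι ⊕ ι) (ι ⊕ ι) ℝ) : Matrix (ι ⊕ ι) (ι ⊕ ι) ℂ :=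
  Complex.I • ((-(J ι ℝ)) * M).map Complex.ofReal

theorem sympOp_eq (M : Matrix (ι ⊕ ι) (ι ⊕ ι) ℝ) :
    sympOp M = (Complex.I • (-(J ι ℝ)).map Complex.ofReal) * M.map Complex.ofReal := by
  rw [sympOp, smul_mul_assoc]
  rw [map_ofReal_mul]

/-- The data attached to a positive definite `M`, through the Hermitian matrix `i R Ω R` with
`R² = M`. -/
theorem exists_hermitian_model {M : Matrix (ι ⊕ ι) (ι ⊕ ι) ℝ} (hM : M.PosDef) :
    ∃ e : ι ⊕ ι → ℝ,
      (sympOp M).charpoly.roots = Finset.univ.val.map (fun i => ((e i : ℝ) : ℂ)) ∧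
      (sympOp M * sympOp M - 1).charpoly.roots =
        Finset.univ.val.map (fun i => ((e i ^ 2 - 1 : ℝ) : ℂ)) ∧
      Finset.univ.val.map (fun i => -e i) = Finset.univ.val.map e ∧
      (∀ i, e i ≠ 0) ∧
      ∑ i, |e i| ≤ M.trace ∧
      ∃ G : Matrix (ι ⊕ ι) (ι ⊕ ι) ℝ, G.PosDef ∧ G * J ι ℝ * G = J ι ℝ ∧
        (M * G).trace = ∑ i, |e i| := by
  obtain ⟨R, hR, rfl⟩ := exists_posDef_sqrt hM
  have hRt : Rᵀ = R := by
    have := hR.isHermitian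
    rwa [IsHermitian, conjTranspose_eq_transpose_of_trivial] at this
  set K : Matrix (ι ⊕ ι) (ι ⊕ ι) ℝ := R * (-(J ι ℝ)) * R with hKdef
  have hK : Kᵀ = -K := by
    simp only [hKdef, transpose_mul, hRt, transpose_neg, J_transpose]
    simp [mul_assoc]
  have hRdet : R.det ≠ 0 := hR.det_pos.ne'
  have hJdet : (J ι ℝ).det ≠ 0 := (isUnit_det_J ι ℝ).ne_zero
  have hKdet : K.det ≠ 0 := by
    simp [hKdef, det_mul, det_neg, hRdet, hJdet]
  have hH : (Complex.I • K.map Complex.ofReal).IsHermitian := isHermitian_I_smul_map hK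
  obtain ⟨P, hP, hPP, hPK, hPtr⟩ := exists_abs_of_skew hK hKdet hH
  set H := Complex.I • K.map Complex.ofReal with hHdef
  set Rc := R.map Complex.ofReal with hRc
  set Q : Matrix (ι ⊕ ι) (ι ⊕ ι) ℂ := Complex.I • (-(J ι ℝ)).map Complex.ofReal with hQ
  have hop : sympOp (R * R) = Q * Rc * Rc := by
    rw [sympOp_eq, map_ofReal_mul, ← mul_assoc]
  have hHQ : H = Rc * Q * Rc := by
    rw [hHdef, hKdef, map_ofReal_mul, map_ofReal_mul, hQ, mul_smul_comm, smul_mul_assoc]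
  have hchar : (sympOp (R * R)).charpoly = H.charpoly := by
    rw [hop, hHQ, charpoly_mul_comm, mul_assoc]
  have hQH : Q.IsHermitian := isHermitian_I_smul_map (by simp [J_transpose])
  have hQQ : Q * Q = 1 := by
    rw [hQ, smul_mul_smul_comm, ← map_ofReal_mul, neg_mul_neg, J_squared, Complex.I_mul_I]
    ext i j
    by_cases h : i = j <;> simp [h, one_apply]
  refine ⟨hH.eigenvalues, ?_, ?_, ?_, ?_, ?_, ?_⟩
  · rw [hchar, hH.roots_charpoly_eq_eigenvalues]
    rfl
  · have hu : IsUnit Rc := by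
      rw [isUnit_iff_isUnit_det, hRc]
      have : (R.map Complex.ofReal).det = ((R.det : ℝ) : ℂ) :=
        (RingHom.map_det Complex.ofRealHom R).symm
      rw [this]
      simpa using hRdet
    -- Conjugation by `Rc` carries `Q Rc Rc` to `Rc Q Rc = H`, so polynomials in the two are similar
    -- as well.
    have hsim : (sympOp (R * R) * sympOp (R * R) - 1).charpoly = (H * H - 1).charpoly := by
      obtain ⟨u, hu⟩ := hu
      rw [hop, hHQ, ← charpoly_units_conj u, ← hu]
      congr 1
      have : (u : Matrix (ι ⊕ ι) (ι ⊕ ι) ℂ) * (u : Matrix (ι ⊕ ι) (ι ⊕ ι) ℂ)⁻¹ = 1 :=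
        mul_nonsing_inv _ ((isUnit_iff_isUnit_det _).1 u.isUnit)
      rw [mul_sub, sub_mul, mul_one, this]
      congr 1
      simp only [mul_assoc]
      rw [this, mul_one]
    have hcfc : H * H - 1 = cfc (fun x : ℝ => x ^ 2 - 1) H := by
      have hsa : IsSelfAdjoint H := hH
      rw [cfc_sub (fun x : ℝ => x ^ 2) (fun _ => (1 : ℝ)) H, cfc_pow_id H 2 hsa, sq,
        cfc_const_one ℝ H]
    rw [hsim, hcfc, hH.charpoly_cfc_eq, roots_prod_univ_X_sub_C]
    rfl
  · have h1 : (-H).charpoly = H.charpoly := by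
      rw [← charpoly_transpose H]
      congr 1
      rw [hHdef, transpose_smul, ← transpose_map, hK]
      ext i j
      simp
    have h2 : -H = cfc (fun x : ℝ => -x) H := by
      have hsa : IsSelfAdjoint H := hH
      rw [cfc_neg (fun x : ℝ => x) H, cfc_id' ℝ H]
    have h3 := congrArg Polynomial.roots h1
    rw [h2, hH.charpoly_cfc_eq, roots_prod_univ_X_sub_C, hH.roots_charpoly_eq_eigenvalues] at h3
    have h4 := congrArg (Multiset.map Complex.re) h3
    simpa [Multiset.map_map, Function.comp_def] using h4
  · intro i h0
    have : H.det = 0 := by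
      rw [hH.det_eq_prod_eigenvalues]
      exact Finset.prod_eq_zero (Finset.mem_univ i) (by simp [h0])
    rw [hHdef, det_smul] at this
    have h5 : (K.map Complex.ofReal).det = ((K.det : ℝ) : ℂ) :=
      (RingHom.map_det Complex.ofRealHom K).symm
    rw [h5] at this
    simp [hKdet] at this
  · set U : Matrix (ι ⊕ ι) (ι ⊕ ι) ℂ := (hH.eigenvectorUnitary : Matrix (ι ⊕ ι) (ι ⊕ ι) ℂ) with hU
    have hUU : U * Uᴴ = 1 := Unitary.mul_star_self_of_mem hH.eigenvectorUnitary.2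
    have hUU' : Uᴴ * U = 1 := Unitary.star_mul_self_of_mem hH.eigenvectorUnitary.2
    have hspec : H = U * diagonal (RCLike.ofReal ∘ hH.eigenvalues) * Uᴴ := by
      conv_lhs => rw [hH.spectral_theorem, Unitary.conjStarAlgAut_apply]
      rfl
    have hD : Uᴴ * H * U = diagonal (RCLike.ofReal ∘ hH.eigenvalues) := by
      calc Uᴴ * H * U = Uᴴ * (U * diagonal (RCLike.ofReal ∘ hH.eigenvalues) * Uᴴ) * U := by
            rw [← hspec]
        _ = Uᴴ * U * diagonal (RCLike.ofReal ∘ hH.eigenvalues) * (Uᴴ * U) := by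
            simp only [mul_assoc]
        _ = _ := by rw [hUU', one_mul, mul_one]
    have hRcH : Rcᴴ = Rc := by
      rw [hRc, ← conjTranspose_map (f := Complex.ofReal) (fun x => by simp),
        conjTranspose_eq_transpose_of_trivial, hRt]
    -- For `c = ±1` the matrix `c Q` is a Hermitian involution, so `1 + c Q` is half of its own
    -- square.
    have hpsd : ∀ c : ℂ, star c = c → c * c = 1 → (1 + c • Q).PosSemidef := by
      intro c hc hcc
      have h6 : (1 + c • Q) = (1 / 2 : ℝ) • ((1 + c • Q)ᴴ * (1 + c • Q)) := by
        rw [conjTranspose_add, conjTranspose_smul, hQH, hc, conjTranspose_one, add_mul, mul_add, mul_add,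
          one_mul, mul_one, one_mul, smul_mul_smul_comm, hcc, hQQ]
        ext i j
        simp
        ring
      rw [h6]
      exact (posSemidef_conjTranspose_mul_self _).smul (by norm_num)
    -- Compressing `1 ± Q ≥ 0` by `Rc * U` leaves the diagonal entries of `Uᴴ M U` plus or minus the
    -- eigenvalues.
    have hb : ∀ i, |hH.eigenvalues i| ≤ ((Uᴴ * (Rc * Rc) * U) i i).re := by
      intro i
      have key : ∀ c : ℂ, star c = c → c * c = 1 →
          0 ≤ (Uᴴ * (Rc * Rc) * U) i i + c * (hH.eigenvalues i : ℂ) := by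
        intro c hc hcc
        have h7 := ((hpsd c hc hcc).conjTranspose_mul_mul_same (Rc * U)).diag_nonneg (i := i)
        have h8 : (Rc * U)ᴴ * (1 + c • Q) * (Rc * U) =
            Uᴴ * (Rc * Rc) * U + c • (Uᴴ * H * U) := by
          rw [conjTranspose_mul, hRcH, hHQ, mul_add, mul_one, add_mul, mul_smul_comm,
            smul_mul_assoc]
          simp only [mul_assoc]
        rw [h8, hD] at h7
        simpa using h7
      have k1 := key 1 (by simp) (by simp)
      have k2 := key (-1) (by simp) (by simp)
      rw [Complex.le_def] at k1 k2
      have k1 := k1.1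
      have k2 := k2.1
      simp at k1 k2
      rw [abs_le]
      constructor <;> linarith
    calc ∑ i, |hH.eigenvalues i| ≤ ∑ i, ((Uᴴ * (Rc * Rc) * U) i i).re :=
          Finset.sum_le_sum fun i _ => hb i
      _ = (Uᴴ * (Rc * Rc) * U).trace.re := by simp [trace]
      _ = (Rc * Rc).trace.re := by
          rw [trace_mul_comm, ← mul_assoc, hUU, one_mul]
      _ = (R * R).trace := by
          rw [hRc, ← map_ofReal_mul]
          simp [trace]
  · have hRu : IsUnit R.det := isUnit_iff_ne_zero.2 hRdet
    have hKu : IsUnit K.det := isUnit_iff_ne_zero.2 hKdet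
    have hRi : R * R⁻¹ = 1 := mul_nonsing_inv R hRu
    have hRi' : R⁻¹ * R = 1 := nonsing_inv_mul R hRu
    have hRit : (R⁻¹)ᴴ = R⁻¹ := by
      rw [conjTranspose_eq_transpose_of_trivial, transpose_nonsing_inv, hRt]
    -- The choice makes `R G R = |K|`. Since `R⁻¹ J R⁻¹ = K⁻¹` and `|K|` commutes with `K` and
    -- squares to `-K²`, the relation `G J G = J` follows.
    refine ⟨R⁻¹ * P * R⁻¹, ?_, ?_, ?_⟩
    · have := hP.conjTranspose_mul_mul_same (B := R⁻¹)
        (mulVec_injective_of_isUnit (by simpa using hR.isUnit))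
      rwa [hRit] at this
    · have hJ : R⁻¹ * J ι ℝ * R⁻¹ = K⁻¹ := by
        symm
        apply inv_eq_left_inv
        rw [hKdef]
        calc R⁻¹ * J ι ℝ * R⁻¹ * (R * -J ι ℝ * R) = R⁻¹ * J ι ℝ * (R⁻¹ * R) * -J ι ℝ * R := by
              simp only [mul_assoc]
          _ = R⁻¹ * (J ι ℝ * -J ι ℝ) * R := by rw [hRi', mul_one]; simp only [mul_assoc]
          _ = 1 := by rw [mul_neg, J_squared, neg_neg, mul_one, hRi']
      have hKi : K⁻¹ * K = 1 := nonsing_inv_mul K hKu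
      have hPKi : P * K⁻¹ = K⁻¹ * P := by
        calc P * K⁻¹ = K⁻¹ * K * (P * K⁻¹) := by rw [hKi, one_mul]
          _ = K⁻¹ * (K * P) * K⁻¹ := by simp only [mul_assoc]
          _ = K⁻¹ * P * (K * K⁻¹) := by rw [← hPK]; simp only [mul_assoc]
          _ = K⁻¹ * P := by rw [mul_nonsing_inv K hKu, mul_one]
      calc R⁻¹ * P * R⁻¹ * J ι ℝ * (R⁻¹ * P * R⁻¹)
          = R⁻¹ * (P * (R⁻¹ * J ι ℝ * R⁻¹) * P) * R⁻¹ := by simp only [mul_assoc]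
        _ = R⁻¹ * (K⁻¹ * (P * P)) * R⁻¹ := by rw [hJ, hPKi, mul_assoc K⁻¹]
        _ = R⁻¹ * -(K⁻¹ * K * K) * R⁻¹ := by rw [hPP, mul_neg, mul_assoc K⁻¹]
        _ = (R⁻¹ * R) * J ι ℝ * (R * R⁻¹) := by
            rw [hKi, one_mul, hKdef]
            simp [mul_assoc]
        _ = J ι ℝ := by rw [hRi, hRi', mul_one, one_mul]
    · rw [← hPtr]
      calc (R * R * (R⁻¹ * P * R⁻¹)).trace = (R * (R * R⁻¹) * P * R⁻¹).trace := by
            simp only [mul_assoc]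
        _ = (R⁻¹ * (R * P)).trace := by rw [hRi, mul_one, trace_mul_comm]
        _ = P.trace := by rw [← mul_assoc, hRi', one_mul]

end Symplectic

end ErgotropicGap

end

noncomputable section

namespace ErgotropicGap

open Matrix Polynomial

/-! ### Symplectic eigenvalues: count, trace bound, invariance, complementary blocks. -/

section Symplectic

/-- The index map of the phase space of the modes in `A`. -/
abbrev blockIncl {ι : Type*} (A : Finset ι) : A ⊕ A → ι ⊕ ι := Sum.map Subtype.val Subtype.val

theorem blockIncl_injective {ι : Type*} (A : Finset ι) : Function.Injective (blockIncl A) :=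
  Subtype.val_injective.sumMap Subtype.val_injective

/-- The negative part is the mirror image of the positive part and nothing sits at 0, so a sum over
absolute values counts every positive element twice. -/
theorem two_mul_sum_filter_pos {s : Multiset ℝ} (hs : s.map (fun x => -x) = s) (h0 : (0 : ℝ) ∉ s)
    (g : ℝ → ℝ) :
    2 * ((s.filter (fun x => 0 < x)).map g).sum = (s.map fun x => g |x|).sum := by
  have h1 : (s.filter (fun x => ¬ 0 < x)) = (s.filter (fun x => 0 < x)).map (fun x => -x) := by
    conv_lhs => rw [← hs]
    rw [Multiset.filter_map]
    congr 1
    refine Multiset.filter_congr fun x hx => ?_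
    have : x ≠ 0 := fun h => h0 (h ▸ hx)
    simp only [Function.comp, not_lt, Left.neg_nonpos_iff]
    exact ⟨fun h => lt_of_le_of_ne h this.symm, le_of_lt⟩
  have h2 := Multiset.filter_add_not (fun x : ℝ => 0 < x) s
  rw [h1] at h2
  conv_rhs => rw [← h2]
  rw [Multiset.map_add, Multiset.sum_add, Multiset.map_map, two_mul]
  congr 2
  · refine Multiset.map_congr rfl fun x hx => ?_
    rw [abs_of_pos (Multiset.mem_filter.1 hx).2]
  · refine Multiset.map_congr rfl fun x hx => ?_
    rw [Function.comp, abs_neg, abs_of_pos (Multiset.mem_filter.1 hx).2]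

variable {ι : Type*} [Fintype ι] [DecidableEq ι]

theorem symplecticEigenvalues_eq (M : Matrix (ι ⊕ ι) (ι ⊕ ι) ℝ) :
    symplecticEigenvalues M =
      ((sympOp M).charpoly.roots.map Complex.re).filter (fun x => 0 < x) := rfl

theorem two_mul_sum_symplecticEigenvalues {M : Matrix (ι ⊕ ι) (ι ⊕ ι) ℝ} {e : ι ⊕ ι → ℝ}
    (he : (sympOp M).charpoly.roots = Finset.univ.val.map (fun i => ((e i : ℝ) : ℂ)))
    (hneg : Finset.univ.val.map (fun i => -e i) = Finset.univ.val.map e)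
    (h0 : ∀ i, e i ≠ 0) (g : ℝ → ℝ) :
    2 * ((symplecticEigenvalues M).map g).sum = ∑ i, g |e i| := by
  rw [symplecticEigenvalues_eq, he, Multiset.map_map]
  simp only [Function.comp_def, Complex.ofReal_re]
  rw [two_mul_sum_filter_pos, Multiset.map_map]
  · rfl
  · rw [Multiset.map_map]
    exact hneg
  · simpa using h0

/-- There are as many symplectic eigenvalues as modes. -/
theorem card_symplecticEigenvalues {M : Matrix (ι ⊕ ι) (ι ⊕ ι) ℝ} (hM : M.PosDef) :
    (symplecticEigenvalues M).card = Fintype.card ι := by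
  obtain ⟨e, he, -, hneg, h0, -⟩ := exists_hermitian_model hM
  have h := two_mul_sum_symplecticEigenvalues he hneg h0 (fun _ => 1)
  have h2 : (2 : ℝ) * (symplecticEigenvalues M).card = 2 * Fintype.card ι := by
    simpa [two_mul] using h
  exact_mod_cast mul_left_cancel₀ two_ne_zero h2

theorem two_mul_sum_symplecticEigenvalues_le_trace {M : Matrix (ι ⊕ ι) (ι ⊕ ι) ℝ}
    (hM : M.PosDef) : 2 * (symplecticEigenvalues M).sum ≤ M.trace := by
  obtain ⟨e, he, -, hneg, h0, hle, -⟩ := exists_hermitian_model hM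
  have h := two_mul_sum_symplecticEigenvalues he hneg h0 id
  rw [Multiset.map_id] at h
  rw [h]
  exact hle

theorem mem_symplecticGroup_iff_of_isSymm {G : Matrix (ι ⊕ ι) (ι ⊕ ι) ℝ} (hG : Gᵀ = G) :
    G ∈ symplecticGroup ι ℝ ↔ G * J ι ℝ * G = J ι ℝ := by
  rw [SymplecticGroup.mem_iff, hG]

/-- The symplectic block lower triangular matrices `[[B, 0], [C B, B⁻ᵀ]]`. -/
def lowerSymplectic (B C : Matrix ι ι ℝ) : Matrix (ι ⊕ ι) (ι ⊕ ι) ℝ :=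
  fromBlocks B 0 (C * B) (B⁻¹)ᵀ

/-- A positive definite symplectic matrix is `L Lᵀ` for a lower triangular symplectic `L`. -/
theorem exists_lowerSymplectic {G : Matrix (ι ⊕ ι) (ι ⊕ ι) ℝ} (hG : G.PosDef)
    (hGJ : G * J ι ℝ * G = J ι ℝ) :
    ∃ B C : Matrix ι ι ℝ, IsUnit B.det ∧ Cᵀ = C ∧
      lowerSymplectic B C * (lowerSymplectic B C)ᵀ = G := by
  have hGt : Gᵀ = G := by
    have := hG.isHermitian
    rwa [IsHermitian, conjTranspose_eq_transpose_of_trivial] at this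
  obtain ⟨P, Q, Q', T, rfl⟩ : ∃ P Q Q' T, G = fromBlocks P Q Q' T :=
    ⟨_, _, _, _, (fromBlocks_toBlocks G).symm⟩
  rw [fromBlocks_transpose, fromBlocks_inj] at hGt
  obtain ⟨hP, hQ, hQ', hT⟩ := hGt
  have hPpd : P.PosDef := by
    have := hG.submatrix (e := Sum.inl) Sum.inl_injective
    exact this
  have hmem := (mem_symplecticGroup_iff_of_isSymm (by
    rw [fromBlocks_transpose, hP, hQ, hQ', hT])).2 hGJ
  rw [SymplecticGroup.fromBlocks_mem_iff, hP, hQ] at hmem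
  obtain ⟨h1, -, h3⟩ := hmem
  obtain ⟨B, hB, rfl⟩ := exists_posDef_sqrt hPpd
  have hBt : Bᵀ = B := by
    have := hB.isHermitian
    rwa [IsHermitian, conjTranspose_eq_transpose_of_trivial] at this
  have hBu : IsUnit B.det := isUnit_iff_ne_zero.2 hB.det_pos.ne'
  have hi : B * B⁻¹ = 1 := mul_nonsing_inv B hBu
  have hi' : B⁻¹ * B = 1 := nonsing_inv_mul B hBu
  have hBi : (B⁻¹)ᵀ = B⁻¹ := by rw [transpose_nonsing_inv, hBt]
  have e1 : Q' = B⁻¹ * B⁻¹ * (Q * (B * B)) := by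
    rw [← h1]
    calc Q' = B⁻¹ * (B⁻¹ * B) * B * Q' := by rw [hi', mul_one, hi', one_mul]
      _ = _ := by simp only [mul_assoc]
  have hC : Q' * (B⁻¹ * B⁻¹) = B⁻¹ * B⁻¹ * Q := by
    rw [e1]
    calc B⁻¹ * B⁻¹ * (Q * (B * B)) * (B⁻¹ * B⁻¹) = B⁻¹ * B⁻¹ * Q * B * (B * B⁻¹) * B⁻¹ := by
          simp only [mul_assoc]
      _ = _ := by rw [hi, mul_one, mul_assoc _ B, hi, mul_one]
  -- Comparing blocks of `L Lᵀ` with `G` asks for `B Bᵀ` in the upper left corner and `C B Bᵀ = Q'`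
  -- below it. The symplectic relation `h1` makes this `C` symmetric, and `h3` gives the last block.
  refine ⟨B, Q' * (B⁻¹ * B⁻¹), hBu, ?_, ?_⟩
  · rw [transpose_mul, transpose_mul, hBi, hQ, hC]
  · have hL : Q' * (B⁻¹ * B⁻¹) * B = Q' * B⁻¹ := by
      rw [mul_assoc, mul_assoc, hi', mul_one]
    have e2 : B⁻¹ * Q = B * (Q' * (B⁻¹ * B⁻¹)) := by
      rw [hC]
      simp only [← mul_assoc]
      rw [hi, one_mul]
    rw [lowerSymplectic, hL, hBi, fromBlocks_transpose, fromBlocks_multiply, fromBlocks_inj]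
    simp only [hBt, transpose_mul, hBi, hQ, mul_zero, zero_mul, add_zero, transpose_zero]
    refine ⟨trivial, ?_, ?_, ?_⟩
    · rw [← mul_assoc, hi, one_mul]
    · rw [mul_assoc, hi', mul_one]
    · have e3 : T = B⁻¹ * B⁻¹ + B⁻¹ * B⁻¹ * (Q * Q) := by
        have : B * B * T = 1 + Q * Q := by rw [← h3]; abel
        calc T = B⁻¹ * (B⁻¹ * B) * B * T := by rw [hi', mul_one, hi', one_mul]
          _ = B⁻¹ * B⁻¹ * (B * B * T) := by simp only [mul_assoc]
          _ = _ := by rw [this, mul_add, mul_one]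
      rw [e3, add_comm]
      congr 1
      rw [← mul_assoc (B⁻¹ * B⁻¹), ← hC]
      simp only [mul_assoc]

/-- By cyclicity the trace is `tr (M L Lᵀ)`, so any factor `L` of the minimiser `G` works; the lower
triangular one is implemented by a chirp and a dilation. -/
theorem exists_lowerSymplectic_trace {M : Matrix (ι ⊕ ι) (ι ⊕ ι) ℝ} (hM : M.PosDef) :
    ∃ B C : Matrix ι ι ℝ, IsUnit B.det ∧ Cᵀ = C ∧
      ((lowerSymplectic B C)ᵀ * M * lowerSymplectic B C).trace =
        2 * (symplecticEigenvalues M).sum := by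
  obtain ⟨e, he, -, hneg, h0, -, G, hG, hGJ, htr⟩ := exists_hermitian_model hM
  obtain ⟨B, C, hB, hC, hL⟩ := exists_lowerSymplectic hG hGJ
  refine ⟨B, C, hB, hC, ?_⟩
  have h := two_mul_sum_symplecticEigenvalues he hneg h0 id
  rw [Multiset.map_id] at h
  rw [h, mul_assoc, trace_mul_comm, mul_assoc, hL, htr]
  rfl

/-- Moving the right factor `S` to the front does not change the characteristic polynomial, and
there `S J Sᵀ = J` absorbs both copies of `S`. -/
theorem symplecticEigenvalues_congr {S : Matrix (ι ⊕ ι) (ι ⊕ ι) ℝ} (hS : S ∈ symplecticGroup ι ℝ)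
    (M : Matrix (ι ⊕ ι) (ι ⊕ ι) ℝ) :
    symplecticEigenvalues (Sᵀ * M * S) = symplecticEigenvalues M := by
  rw [symplecticEigenvalues_eq, symplecticEigenvalues_eq]
  congr 3
  have h1 : S * J ι ℝ * Sᵀ = J ι ℝ := SymplecticGroup.mem_iff.1 hS
  rw [sympOp, mul_assoc Sᵀ, ← mul_assoc, sympOp]
  have h2 : Complex.I • (-J ι ℝ * Sᵀ * (M * S)).map Complex.ofReal =
      (Complex.I • (-J ι ℝ * Sᵀ * M).map Complex.ofReal) * S.map Complex.ofReal := by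
    rw [smul_mul_assoc, ← map_ofReal_mul, mul_assoc _ M]
  have h3 : S * (-J ι ℝ * Sᵀ * M) = -J ι ℝ * M := by
    simp only [← mul_assoc]
    rw [mul_neg, neg_mul, h1]
  rw [h2, charpoly_mul_comm, mul_smul_comm, ← map_ofReal_mul, h3]

theorem isRoot_of_sq_eq_one {A : Matrix (ι ⊕ ι) (ι ⊕ ι) ℂ} (hA : A * A = 1) {z : ℂ}
    (hz : z ∈ A.charpoly.roots) : z * z = 1 := by
  have h1 : A.charpoly.eval z = 0 := (mem_roots'.1 hz).2
  rw [eval_charpoly] at h1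
  have h2 : (scalar (ι ⊕ ι) z - A) * (scalar (ι ⊕ ι) z + A) = scalar (ι ⊕ ι) (z * z - 1) := by
    have hc : A * scalar (ι ⊕ ι) z = scalar (ι ⊕ ι) z * A :=
      (scalar_commute z (fun r => mul_comm _ _) A).symm
    rw [sub_mul, mul_add, mul_add, hA, hc, map_sub, map_mul, map_one]
    abel
  have h3 := congrArg det h2
  rw [det_mul, h1, zero_mul] at h3
  rcases isEmpty_or_nonempty ι with h | h
  · simp at hz
  · rw [scalar_apply, det_diagonal, Finset.prod_const, eq_comm] at h3
    exact sub_eq_zero.1 (eq_zero_of_pow_eq_zero h3)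

theorem sympOp_mul_self {M : Matrix (ι ⊕ ι) (ι ⊕ ι) ℝ} :
    sympOp M * sympOp M = -(J ι ℝ * M * (J ι ℝ * M)).map Complex.ofReal := by
  rw [sympOp, smul_mul_smul_comm, Complex.I_mul_I, ← map_ofReal_mul]
  simp

/-- The symplectic eigenvalues of a pure covariance matrix are equal to one. -/
theorem sum_symplecticEigenvalues_of_symplectic {M : Matrix (ι ⊕ ι) (ι ⊕ ι) ℝ} (hM : M.PosDef)
    (hMJ : M * J ι ℝ * M = J ι ℝ) : (symplecticEigenvalues M).sum = Fintype.card ι := by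
  have hsq : sympOp M * sympOp M = 1 := by
    rw [sympOp_mul_self, mul_assoc, ← mul_assoc M, hMJ, J_squared]
    ext i j
    by_cases h : i = j <;> simp [h, one_apply]
  have h1 : ∀ x ∈ symplecticEigenvalues M, x = 1 := by
    intro x hx
    rw [symplecticEigenvalues_eq, Multiset.mem_filter, Multiset.mem_map] at hx
    obtain ⟨⟨z, hz, rfl⟩, hpos⟩ := hx
    have h2 := isRoot_of_sq_eq_one hsq hz
    rcases mul_self_eq_one_iff.1 h2 with h | h
    · simp [h]
    · simp [h] at hpos
      linarith
  rw [Multiset.eq_replicate.2 ⟨card_symplecticEigenvalues hM, h1⟩]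
  simp

theorem sum_phaseSpace_split {R : Type*} [AddCommMonoid R] (A : Finset ι) (f : ι ⊕ ι → R) :
    ∑ k, f k = ∑ a, f (blockIncl A a) + ∑ b, f (blockIncl Aᶜ b) := by
  simp only [Fintype.sum_sum_type, blockIncl, Sum.map_inl, Sum.map_inr]
  have h : ∀ g : ι → R, ∑ i, g i = ∑ i : A, g i + ∑ i : (Aᶜ : Finset ι), g i := by
    intro g
    rw [Finset.sum_coe_sort A g, Finset.sum_coe_sort Aᶜ g, Finset.sum_add_sum_compl]
  rw [h (fun i => f (Sum.inl i)), h (fun i => f (Sum.inr i))]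
  abel

/-- `J` couples only the position and the momentum of the same mode. -/
theorem J_mul_submatrix (A : Finset ι) (M : Matrix (ι ⊕ ι) (ι ⊕ ι) ℝ) {α : Type*}
    (e : α → ι ⊕ ι) :
    (J ι ℝ * M).submatrix (blockIncl A) e = J A ℝ * M.submatrix (blockIncl A) e := by
  ext s t
  rcases s with s | s <;>
    simp [J, mul_apply, Fintype.sum_sum_type, one_apply]

theorem submatrix_mul_split (A : Finset ι) (T : Matrix (ι ⊕ ι) (ι ⊕ ι) ℝ) {α β : Type*}
    (e : α → ι ⊕ ι) (e' : β → ι ⊕ ι) :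
    (T * T).submatrix e e' =
      T.submatrix e (blockIncl A) * T.submatrix (blockIncl A) e' +
        T.submatrix e (blockIncl Aᶜ) * T.submatrix (blockIncl Aᶜ) e' := by
  ext s t
  simp only [submatrix_apply, mul_apply, Matrix.add_apply]
  exact sum_phaseSpace_split A _

/-- Expresses the excess through the roots of `(iΩM)² - 1`, by a function vanishing at 0.
Eigenvalues `ν = 1`, whose number may differ between complementary blocks, then contribute nothing.
-/
theorem two_mul_sum_sub_one {M : Matrix (ι ⊕ ι) (ι ⊕ ι) ℝ} (hM : M.PosDef) :
    2 * ((symplecticEigenvalues M).map fun ν => ν - 1).sum =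
      ((sympOp M * sympOp M - 1).charpoly.roots.map fun z => √(z.re + 1) - 1).sum := by
  obtain ⟨e, he, hsq, hneg, h0, -⟩ := exists_hermitian_model hM
  rw [two_mul_sum_symplecticEigenvalues he hneg h0, hsq, Multiset.map_map]
  refine Finset.sum_congr rfl fun i _ => ?_
  rw [Function.comp, Complex.ofReal_re, sub_add_cancel, Real.sqrt_sq_eq_abs]

/-- `P Q` and `Q P` differ in spectrum only by zeros, which `g 0 = 0` makes invisible. -/
theorem sum_roots_mul_comm {α β : Type*} [Fintype α] [Fintype β] [DecidableEq α] [DecidableEq β]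
    (P : Matrix α β ℂ) (Q : Matrix β α ℂ) {g : ℂ → ℝ} (hg : g 0 = 0) :
    ((P * Q).charpoly.roots.map g).sum = ((Q * P).charpoly.roots.map g).sum := by
  have h := congrArg Polynomial.roots (charpoly_mul_comm' P Q)
  rw [roots_mul (mul_ne_zero (pow_ne_zero _ X_ne_zero) (charpoly_monic _).ne_zero),
    roots_mul (mul_ne_zero (pow_ne_zero _ X_ne_zero) (charpoly_monic _).ne_zero),
    roots_X_pow, roots_X_pow] at h
  have h2 := congrArg (fun s : Multiset ℂ => (s.map g).sum) h
  simpa [hg, Multiset.map_nsmul, Multiset.sum_nsmul] using h2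

/-- The hypothesis is a diagonal block of `(J M)² = -1`, with `P` and `Q` in the role of the
off-diagonal blocks; the sign changes because `(iΩM)² = -(J M)²`. -/
theorem sympOp_submatrix_sq_sub_one (A : Finset ι) (M : Matrix (ι ⊕ ι) (ι ⊕ ι) ℝ) {β : Type*}
    [Fintype β] (P : Matrix (A ⊕ A) β ℝ) (Q : Matrix β (A ⊕ A) ℝ)
    (h : (-1 : Matrix (ι ⊕ ι) (ι ⊕ ι) ℝ).submatrix (blockIncl A) (blockIncl A) =
      (J ι ℝ * M).submatrix (blockIncl A) (blockIncl A) *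
        (J ι ℝ * M).submatrix (blockIncl A) (blockIncl A) + P * Q) :
    sympOp (M.submatrix (blockIncl A) (blockIncl A)) *
      sympOp (M.submatrix (blockIncl A) (blockIncl A)) - 1 =
      P.map Complex.ofReal * Q.map Complex.ofReal := by
  have hPQ : P.map Complex.ofReal * Q.map Complex.ofReal = (P * Q).map Complex.ofReal :=
    (Matrix.map_mul (f := Complex.ofRealHom)).symm
  rw [sympOp_mul_self, ← J_mul_submatrix, hPQ, sub_eq_iff_eq_add, neg_eq_iff_eq_neg]
  ext s t
  have h4 := congrFun (congrFun h s) t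
  simp only [submatrix_apply, Matrix.add_apply, Matrix.neg_apply, map_apply] at h4 ⊢
  have h5 : (1 : Matrix (ι ⊕ ι) (ι ⊕ ι) ℝ) (blockIncl A s) (blockIncl A t) =
      (1 : Matrix (A ⊕ A) (A ⊕ A) ℝ) s t := by
    simp [one_apply, (blockIncl_injective A).eq_iff]
  have h6 : (1 : Matrix (A ⊕ A) (A ⊕ A) ℂ) s t =
      (((1 : Matrix (A ⊕ A) (A ⊕ A) ℝ) s t : ℝ) : ℂ) := by
    by_cases h : s = t <;> simp [one_apply, h]
  rw [h6, ← h5, ← Complex.ofReal_add, ← Complex.ofReal_neg]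
  congr 1
  linarith

/-- For a pure covariance matrix, the symplectic spectra of complementary blocks agree up to
eigenvalues equal to one. -/
theorem sum_sub_one_compl {M : Matrix (ι ⊕ ι) (ι ⊕ ι) ℝ} (hM : M.PosDef)
    (hMJ : M * J ι ℝ * M = J ι ℝ) (A : Finset ι) :
    ((symplecticEigenvalues (M.submatrix (blockIncl Aᶜ) (blockIncl Aᶜ))).map
        fun ν => ν - 1).sum =
      ((symplecticEigenvalues (M.submatrix (blockIncl A) (blockIncl A))).map
        fun ν => ν - 1).sum := by
  refine mul_left_cancel₀ (two_ne_zero (α := ℝ)) ?_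
  rw [two_mul_sum_sub_one (hM.submatrix (blockIncl_injective A)),
    two_mul_sum_sub_one (hM.submatrix (blockIncl_injective Aᶜ))]
  have hTT : J ι ℝ * M * (J ι ℝ * M) = -1 := by
    rw [mul_assoc, ← mul_assoc M, hMJ, J_squared]
  have h1 := submatrix_mul_split A (J ι ℝ * M) (blockIncl A) (blockIncl A)
  have h2 := submatrix_mul_split A (J ι ℝ * M) (blockIncl Aᶜ) (blockIncl Aᶜ)
  rw [hTT] at h1 h2
  rw [add_comm] at h2
  rw [sympOp_submatrix_sq_sub_one A M _ _ h1, sympOp_submatrix_sq_sub_one Aᶜ M _ _ h2]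
  exact sum_roots_mul_comm _ _ (by simp)

end Symplectic

end ErgotropicGap

end

noncomputable section

namespace ErgotropicGap

open MeasureTheory Matrix

/-! ### Weighted composition operators on `L²`. -/

section WeightedComposition

variable {ι : Type*} [Fintype ι]

/-- The weighted composition operator `f ↦ u · (f ∘ T)` is well defined and isometric on `L²`. -/
structure IsIsometricPair (u : (ι → ℝ) → ℂ) (T : (ι → ℝ) → (ι → ℝ)) : Prop where
  measurable : Measurable u
  quasi : Measure.QuasiMeasurePreserving T volume volume
  lintegral : ∀ f : (ι → ℝ) → ℂ, AEStronglyMeasurable f volume →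
    ∫⁻ x, ‖u x * f (T x)‖ₑ ^ (2 : ℝ) = ∫⁻ x, ‖f x‖ₑ ^ (2 : ℝ)

namespace IsIsometricPair

variable {u u' : (ι → ℝ) → ℂ} {T T' : (ι → ℝ) → (ι → ℝ)}

theorem eLpNorm_eq (h : IsIsometricPair u T) {f : (ι → ℝ) → ℂ} (hf : AEStronglyMeasurable f volume) :
    eLpNorm (fun x => u x * f (T x)) 2 volume = eLpNorm f 2 volume := by
  simp only [eLpNorm_eq_lintegral_rpow_enorm_toReal (p := 2) (by norm_num) (by norm_num),
    ENNReal.toReal_ofNat]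
  rw [h.lintegral f hf]

theorem aestronglyMeasurable (h : IsIsometricPair u T) {f : (ι → ℝ) → ℂ}
    (hf : AEStronglyMeasurable f volume) :
    AEStronglyMeasurable (fun x => u x * f (T x)) volume :=
  h.measurable.aestronglyMeasurable.mul (hf.comp_quasiMeasurePreserving h.quasi)

theorem memLp (h : IsIsometricPair u T) (f : Modes ι) :
    MemLp (fun x => u x * f (T x)) 2 volume :=
  ⟨h.aestronglyMeasurable (Lp.memLp f).1, by
    rw [h.eLpNorm_eq (Lp.memLp f).1]; exact (Lp.memLp f).2⟩

theorem ae_congr (h : IsIsometricPair u T) {f g : (ι → ℝ) → ℂ} (hfg : f =ᵐ[volume] g) :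
    (fun x => u x * f (T x)) =ᵐ[volume] fun x => u x * g (T x) := by
  filter_upwards [h.quasi.ae_eq_comp hfg] with x hx
  simp only [Function.comp] at hx
  rw [hx]

/-- The isometry `f ↦ u · (f ∘ T)`. -/
def op (h : IsIsometricPair u T) : Modes ι →ₗᵢ[ℂ] Modes ι where
  toFun f := (h.memLp f).toLp _
  map_add' f g := by
    rw [← MemLp.toLp_add (h.memLp f) (h.memLp g)]
    refine MemLp.toLp_congr _ _ ?_
    refine (h.ae_congr (Lp.coeFn_add f g)).trans (Filter.Eventually.of_forall fun x => ?_)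
    simp [mul_add]
  map_smul' c f := by
    rw [RingHom.id_apply, ← MemLp.toLp_const_smul c (h.memLp f)]
    refine MemLp.toLp_congr _ _ ?_
    refine (h.ae_congr (Lp.coeFn_smul c f)).trans (Filter.Eventually.of_forall fun x => ?_)
    simp only [Pi.smul_apply, smul_eq_mul]
    ring
  norm_map' f := by
    simp only [LinearMap.coe_mk, AddHom.coe_mk]
    rw [Lp.norm_toLp, h.eLpNorm_eq (Lp.memLp f).1, Lp.norm_def]

theorem coeFn_op (h : IsIsometricPair u T) (f : Modes ι) :
    h.op f =ᵐ[volume] fun x => u x * f (T x) :=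
  (h.memLp f).coeFn_toLp

theorem coeFn_op_congr (h : IsIsometricPair u T) {f : Modes ι} {g : (ι → ℝ) → ℂ}
    (hg : f =ᵐ[volume] g) : h.op f =ᵐ[volume] fun x => u x * g (T x) :=
  (h.coeFn_op f).trans (h.ae_congr hg)

theorem op_op_eq_self (h : IsIsometricPair u T) (h' : IsIsometricPair u' T')
    (hu : ∀ x, u x * u' (T x) = 1) (hT : ∀ x, T' (T x) = x) (f : Modes ι) :
    h.op (h'.op f) = f := by
  refine Lp.ext ((h.coeFn_op_congr (h'.coeFn_op f)).trans (Filter.Eventually.of_forall fun x => ?_))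
  simp only [hT]
  rw [← mul_assoc, hu, one_mul]

/-- The unitary `f ↦ u · (f ∘ T)`. -/
def opEquiv (h : IsIsometricPair u T) (h' : IsIsometricPair u' T')
    (hu : ∀ x, u x * u' (T x) = 1) (hT : ∀ x, T' (T x) = x) : Modes ι ≃ₗᵢ[ℂ] Modes ι :=
  LinearIsometryEquiv.ofSurjective h.op fun f => ⟨h'.op f, h.op_op_eq_self h' hu hT f⟩

theorem of_measurePreserving (hu : Measurable u) (hu1 : ∀ x, ‖u x‖ = 1)
    (hT : MeasurePreserving T volume volume) : IsIsometricPair u T where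
  measurable := hu
  quasi := hT.quasiMeasurePreserving
  lintegral f hf := by
    have : ∀ x, ‖u x * f (T x)‖ₑ ^ (2 : ℝ) = (fun y => ‖f y‖ₑ ^ (2 : ℝ)) (T x) := by
      intro x
      have : ‖u x‖ₑ = 1 := by rw [← ofReal_norm, hu1]; simp
      rw [enorm_mul, this, one_mul]
    simp_rw [this]
    rw [← lintegral_map' (μ := volume) (g := T) (f := fun y => ‖f y‖ₑ ^ (2 : ℝ)) ?_
      hT.aemeasurable, hT.map_eq]
    rw [hT.map_eq]
    exact hf.enorm.pow_const _

/-- The change of variables scales Lebesgue measure by `|det A|⁻¹`, which the squared weight `|det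
A|` compensates. -/
theorem of_matrix [DecidableEq ι] {A : Matrix ι ι ℝ} (hA : A.det ≠ 0) :
    IsIsometricPair (fun _ => ((√|A.det| : ℝ) : ℂ)) (fun x => A *ᵥ x) where
  measurable := measurable_const
  quasi := by
    refine ⟨(LinearMap.continuous_of_finiteDimensional (toLin' A)).measurable, ?_⟩
    have := Real.map_matrix_volume_pi_eq_smul_volume_pi hA
    have h2 : Measure.map (fun x => A *ᵥ x) volume =
      ENNReal.ofReal |A.det⁻¹| • (volume : Measure (ι → ℝ)) := this
    rw [h2]
    exact Measure.smul_absolutelyContinuous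
  lintegral f hf := by
    have hm : Measurable (fun x : ι → ℝ => A *ᵥ x) :=
      (LinearMap.continuous_of_finiteDimensional (toLin' A)).measurable
    have h2 : Measure.map (fun x => A *ᵥ x) volume =
      ENNReal.ofReal |A.det⁻¹| • (volume : Measure (ι → ℝ)) :=
      Real.map_matrix_volume_pi_eq_smul_volume_pi hA
    have h3 : ∀ x, ‖((√|A.det| : ℝ) : ℂ) * f (A *ᵥ x)‖ₑ ^ (2 : ℝ) =
        ENNReal.ofReal |A.det| * (fun y => ‖f y‖ₑ ^ (2 : ℝ)) (A *ᵥ x) := by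
      intro x
      rw [enorm_mul, ENNReal.mul_rpow_of_nonneg _ _ (by norm_num)]
      congr 1
      rw [← ofReal_norm, Complex.norm_real, Real.norm_of_nonneg (Real.sqrt_nonneg _),
        ENNReal.ofReal_rpow_of_nonneg (Real.sqrt_nonneg _) (by norm_num), Real.rpow_two,
        Real.sq_sqrt (abs_nonneg _)]
    simp_rw [h3]
    have h4 : AEMeasurable (fun y => ‖f y‖ₑ ^ (2 : ℝ)) (volume : Measure (ι → ℝ)) :=
      hf.enorm.pow_const _
    rw [lintegral_const_mul' _ _ ENNReal.ofReal_ne_top,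
      ← lintegral_map' (μ := volume) (g := fun x => A *ᵥ x) (f := fun y => ‖f y‖ₑ ^ (2 : ℝ)) ?_
      hm.aemeasurable, h2, lintegral_smul_measure, smul_eq_mul, ← mul_assoc,
      ← ENNReal.ofReal_mul (abs_nonneg _), ← abs_mul, mul_inv_cancel₀ hA]
    · simp
    · rw [h2]
      exact h4.smul_measure _

end IsIsometricPair

end WeightedComposition

/-! ### Weyl operators and their commutation relations. -/

section Weyl

variable {ι : Type*} [Fintype ι]

/-- The multiplier of the Weyl operator. -/
def weylPhase (ξ : ι ⊕ ι → ℝ) (x : ι → ℝ) : ℂ :=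
  Complex.exp (Complex.I *
      (((∑ i, ξ (Sum.inr i) * x i) - (∑ i, ξ (Sum.inl i) * ξ (Sum.inr i)) / 2 : ℝ) : ℂ))

theorem weylPair (ξ : ι ⊕ ι → ℝ) :
    IsIsometricPair (weylPhase ξ) (fun x => x - fun i => ξ (Sum.inl i)) := by
  refine IsIsometricPair.of_measurePreserving ?_ (fun x => ?_)
    (measurePreserving_sub_right volume _)
  · refine Continuous.measurable ?_
    unfold weylPhase
    fun_prop
  · rw [weylPhase, mul_comm Complex.I, Complex.norm_exp_ofReal_mul_I]

theorem weyl_eq_op (ξ : ι ⊕ ι → ℝ) (f : Modes ι) : weyl ξ f = (weylPair ξ).op f := rfl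

theorem coeFn_weyl (ξ : ι ⊕ ι → ℝ) (f : Modes ι) :
    weyl ξ f =ᵐ[volume] fun x => weylPhase ξ x * f (x - fun i => ξ (Sum.inl i)) :=
  (weylPair ξ).coeFn_op f

theorem coeFn_weyl_congr (ξ : ι ⊕ ι → ℝ) {f : Modes ι} {g : (ι → ℝ) → ℂ} (hg : f =ᵐ[volume] g) :
    weyl ξ f =ᵐ[volume] fun x => weylPhase ξ x * g (x - fun i => ξ (Sum.inl i)) :=
  (weylPair ξ).coeFn_op_congr hg

theorem inner_weyl_weyl_self (ξ : ι ⊕ ι → ℝ) (f g : Modes ι) :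
    inner ℂ (weyl ξ f) (weyl ξ g) = inner ℂ f g := by
  rw [weyl_eq_op, weyl_eq_op, LinearIsometry.inner_map_map]

theorem norm_weyl (ξ : ι ⊕ ι → ℝ) (f : Modes ι) : ‖weyl ξ f‖ = ‖f‖ := by
  rw [weyl_eq_op, LinearIsometry.norm_map]

theorem weyl_zero (f : Modes ι) : weyl 0 f = f := by
  refine Lp.ext ((coeFn_weyl 0 f).trans (Filter.Eventually.of_forall fun x => ?_))
  have : (x - fun i => (0 : ι ⊕ ι → ℝ) (Sum.inl i)) = x := by ext; simp
  simp only [this]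
  simp [weylPhase]

/-- The symplectic form on phase space. -/
def sympForm (ξ η : ι ⊕ ι → ℝ) : ℝ :=
  ∑ i, (ξ (Sum.inr i) * η (Sum.inl i) - ξ (Sum.inl i) * η (Sum.inr i))

theorem sympForm_eq [DecidableEq ι] (ξ η : ι ⊕ ι → ℝ) : sympForm ξ η = ξ ⬝ᵥ J ι ℝ *ᵥ η := by
  rw [dotProduct, Fintype.sum_sum_type, sympForm, Finset.sum_sub_distrib]
  simp [J, mulVec, dotProduct, Fintype.sum_sum_type, one_apply]
  ring

/-- The Weyl relations. -/
theorem weyl_weyl (ξ η : ι ⊕ ι → ℝ) (f : Modes ι) :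
    weyl ξ (weyl η f) = Complex.exp (Complex.I * ((sympForm ξ η / 2 : ℝ) : ℂ)) •
      weyl (ξ + η) f := by
  refine Lp.ext ?_
  refine (coeFn_weyl_congr ξ (coeFn_weyl η f)).trans ?_
  refine Filter.EventuallyEq.trans ?_ (Lp.coeFn_smul _ _).symm
  filter_upwards [coeFn_weyl (ξ + η) f] with x hx
  rw [Pi.smul_apply, hx, smul_eq_mul, ← mul_assoc, ← mul_assoc]
  have hpt : (x - fun i => ξ (Sum.inl i)) - (fun i => η (Sum.inl i)) =
      x - fun i => (ξ + η) (Sum.inl i) := by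
    ext i; simp; ring
  rw [hpt]
  congr 1
  simp only [weylPhase]
  rw [← Complex.exp_add, ← Complex.exp_add, ← mul_add, ← mul_add, ← Complex.ofReal_add,
    ← Complex.ofReal_add]
  congr 3
  simp only [sympForm, Pi.add_apply, Pi.sub_apply, add_mul, mul_sub, mul_add,
    Finset.sum_add_distrib, Finset.sum_sub_distrib]
  have : ∑ i, ξ (Sum.inr i) * η (Sum.inl i) = ∑ i, η (Sum.inl i) * ξ (Sum.inr i) :=
    Finset.sum_congr rfl fun i _ => mul_comm _ _
  have h2 : ∑ i, ξ (Sum.inl i) * η (Sum.inr i) = ∑ i, η (Sum.inr i) * ξ (Sum.inl i) :=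
    Finset.sum_congr rfl fun i _ => mul_comm _ _
  rw [this, h2]
  ring

theorem sympForm_neg_left (ξ η : ι ⊕ ι → ℝ) : sympForm (-ξ) η = -sympForm ξ η := by
  simp only [sympForm, Pi.neg_apply, ← Finset.sum_neg_distrib]
  exact Finset.sum_congr rfl fun i _ => by ring

theorem sympForm_self (ξ : ι ⊕ ι → ℝ) : sympForm ξ ξ = 0 :=
  Finset.sum_eq_zero fun i _ => by ring

theorem sympForm_comm (ξ η : ι ⊕ ι → ℝ) : sympForm ξ η = -sympForm η ξ := by
  simp only [sympForm, ← Finset.sum_neg_distrib]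
  exact Finset.sum_congr rfl fun i _ => by ring

theorem weyl_neg_weyl (ξ : ι ⊕ ι → ℝ) (f : Modes ι) : weyl (-ξ) (weyl ξ f) = f := by
  rw [weyl_weyl, sympForm_neg_left, sympForm_self, neg_add_cancel, weyl_zero]
  simp

/-- With `f = g` this reads the Gram matrix of the displaced copies of a vector off its
characteristic function. -/
theorem inner_weyl_weyl (ξ η : ι ⊕ ι → ℝ) (f g : Modes ι) :
    inner ℂ (weyl ξ f) (weyl η g) =
      Complex.exp (-(Complex.I * ((sympForm ξ η / 2 : ℝ) : ℂ))) * inner ℂ f (weyl (η - ξ) g) := by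
  rw [← inner_weyl_weyl_self (-ξ), weyl_neg_weyl, weyl_weyl, inner_smul_right, sympForm_neg_left]
  congr 2
  · rw [neg_div, Complex.ofReal_neg, mul_neg]
  · rw [neg_add_eq_sub]

/-- The Weyl operator as a unitary. -/
def weylEquiv (ξ : ι ⊕ ι → ℝ) : Modes ι ≃ₗᵢ[ℂ] Modes ι :=
  LinearIsometryEquiv.ofSurjective (weylPair ξ).op fun f => ⟨weyl (-ξ) f, by
    have := weyl_neg_weyl (-ξ) f
    rwa [neg_neg] at this⟩

theorem weylEquiv_apply (ξ : ι ⊕ ι → ℝ) (f : Modes ι) : weylEquiv ξ f = weyl ξ f := rfl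

end Weyl

/-! ### Multiplication by phases; chirps. -/

section Phases

variable {ι : Type*} [Fintype ι]

/-- The multiplier `exp (i x·C x / 2)`. -/
def chirpPhase (C : Matrix ι ι ℝ) (x : ι → ℝ) : ℂ :=
  Complex.exp (Complex.I * ((x ⬝ᵥ C *ᵥ x / 2 : ℝ) : ℂ))

theorem isIsometricPair_phase {θ : (ι → ℝ) → ℂ} (hθ : Continuous θ) (h1 : ∀ x, ‖θ x‖ = 1) :
    IsIsometricPair θ id :=
  IsIsometricPair.of_measurePreserving hθ.measurable h1 (MeasurePreserving.id _)

/-- Multiplication by a continuous phase. -/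
def phaseOp {θ : (ι → ℝ) → ℂ} (hθ : Continuous θ) (h1 : ∀ x, ‖θ x‖ = 1) :
    Modes ι ≃ₗᵢ[ℂ] Modes ι :=
  (isIsometricPair_phase hθ h1).opEquiv
    (isIsometricPair_phase (θ := fun x => star (θ x)) hθ.star (by simpa using h1))
    (fun x => by
      simp only [id]
      rw [Complex.star_def, Complex.mul_conj, Complex.normSq_eq_norm_sq, h1]
      simp) (fun x => rfl)

theorem coeFn_phaseOp_congr {θ : (ι → ℝ) → ℂ} (hθ : Continuous θ) (h1 : ∀ x, ‖θ x‖ = 1)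
    {f : Modes ι} {g : (ι → ℝ) → ℂ} (hg : f =ᵐ[volume] g) :
    phaseOp hθ h1 f =ᵐ[volume] fun x => θ x * g x :=
  (isIsometricPair_phase hθ h1).coeFn_op_congr hg

theorem continuous_chirpPhase (C : Matrix ι ι ℝ) : Continuous (chirpPhase C) := by
  unfold chirpPhase dotProduct mulVec dotProduct
  fun_prop

theorem norm_chirpPhase (C : Matrix ι ι ℝ) (x : ι → ℝ) : ‖chirpPhase C x‖ = 1 := by
  rw [chirpPhase, mul_comm Complex.I, Complex.norm_exp_ofReal_mul_I]

/-- The chirp `f ↦ exp (i x·C x / 2) f`. -/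
def chirp (C : Matrix ι ι ℝ) : Modes ι ≃ₗᵢ[ℂ] Modes ι :=
  phaseOp (continuous_chirpPhase C) (norm_chirpPhase C)

end Phases

/-! ### Displacements, dilations and chirps as Gaussian unitaries. -/

section GaussianUnitaries

variable {ι : Type*} [Fintype ι] [DecidableEq ι]

theorem IsGaussianUnitary.trans {U V : Modes ι ≃ₗᵢ[ℂ] Modes ι} (hU : IsGaussianUnitary U)
    (hV : IsGaussianUnitary V) : IsGaussianUnitary (U.trans V) := by
  obtain ⟨S, hS, d, hd⟩ := hU
  obtain ⟨S', hS', d', hd'⟩ := hV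
  refine ⟨S' * S, mul_mem hS' hS, d + Sᵀ *ᵥ d', fun ξ f => ?_⟩
  rw [LinearIsometryEquiv.trans_apply, hd, map_smul, hd', smul_smul, ← Complex.exp_add,
    mulVec_mulVec, LinearIsometryEquiv.trans_apply, ← mul_add, ← Complex.ofReal_add]
  congr 5
  rw [add_dotProduct]
  congr 1
  rw [dotProduct_mulVec, mulVec_transpose]

theorem isGaussianUnitary_weylEquiv (η : ι ⊕ ι → ℝ) : IsGaussianUnitary (weylEquiv η) := by
  refine ⟨1, one_mem _, -(J ι ℝ *ᵥ η), fun ξ f => ?_⟩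
  have h1 : (-(J ι ℝ *ᵥ η)) ⬝ᵥ ξ = sympForm η ξ := by
    rw [neg_dotProduct, dotProduct_comm, ← sympForm_eq, sympForm_comm η]
  rw [h1, weylEquiv_apply, weylEquiv_apply, one_mulVec, weyl_weyl, weyl_weyl, smul_smul,
    ← Complex.exp_add, add_comm η, sympForm_comm ξ η, ← mul_add, ← Complex.ofReal_add]
  congr 4
  ring

/-- The unitary dilation `f ↦ |det A|^{1/2} f (A x)`. -/
def dilation (A : Matrix ι ι ℝ) (hA : A.det ≠ 0) : Modes ι ≃ₗᵢ[ℂ] Modes ι :=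
  (IsIsometricPair.of_matrix hA).opEquiv
    (IsIsometricPair.of_matrix (A := A⁻¹) (by
      rw [det_nonsing_inv]; simpa using hA))
    (fun x => by
      rw [← Complex.ofReal_mul, ← Real.sqrt_mul (abs_nonneg _), ← abs_mul, det_nonsing_inv,
        Ring.mul_inverse_cancel _ (isUnit_iff_ne_zero.2 hA)]
      simp)
    (fun x => by
      rw [mulVec_mulVec, nonsing_inv_mul _ (isUnit_iff_ne_zero.2 hA), one_mulVec])

theorem coeFn_dilation_congr (A : Matrix ι ι ℝ) (hA : A.det ≠ 0) {f : Modes ι}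
    {g : (ι → ℝ) → ℂ} (hg : f =ᵐ[volume] g) :
    dilation A hA f =ᵐ[volume] fun x => ((√|A.det| : ℝ) : ℂ) * g (A *ᵥ x) :=
  (IsIsometricPair.of_matrix hA).coeFn_op_congr hg

/-- Positions transform by `A⁻¹` and momenta by `Aᵀ`, so the pairing of the two, and with it the
phase of the Weyl operator, is preserved. -/
theorem dilation_weyl (A : Matrix ι ι ℝ) (hA : A.det ≠ 0) (ξ : ι ⊕ ι → ℝ) (f : Modes ι) :
    dilation A hA (weyl ξ f) = weyl (fromBlocks A⁻¹ 0 0 Aᵀ *ᵥ ξ) (dilation A hA f) := by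
  refine Lp.ext ?_
  refine (coeFn_dilation_congr A hA (coeFn_weyl ξ f)).trans ?_
  refine Filter.EventuallyEq.trans (Filter.Eventually.of_forall fun x => ?_)
    (coeFn_weyl_congr _ (coeFn_dilation_congr A hA Filter.EventuallyEq.rfl)).symm
  have hl : (fun i => (fromBlocks A⁻¹ 0 0 Aᵀ *ᵥ ξ) (Sum.inl i)) = A⁻¹ *ᵥ (ξ ∘ Sum.inl) := by
    ext i; simp [fromBlocks_mulVec]
  have hr : (fun i => (fromBlocks A⁻¹ 0 0 Aᵀ *ᵥ ξ) (Sum.inr i)) = Aᵀ *ᵥ (ξ ∘ Sum.inr) := by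
    ext i; simp [fromBlocks_mulVec]
  have hpt : A *ᵥ (x - A⁻¹ *ᵥ (ξ ∘ Sum.inl)) = A *ᵥ x - fun i => ξ (Sum.inl i) := by
    rw [mulVec_sub, mulVec_mulVec, mul_nonsing_inv _ (isUnit_iff_ne_zero.2 hA), one_mulVec]
    rfl
  have hph : weylPhase (fromBlocks A⁻¹ 0 0 Aᵀ *ᵥ ξ) x = weylPhase ξ (A *ᵥ x) := by
    simp only [weylPhase]
    have e1 : ∑ i, (fromBlocks A⁻¹ 0 0 Aᵀ *ᵥ ξ) (Sum.inr i) * x i =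
        ∑ i, ξ (Sum.inr i) * (A *ᵥ x) i := by
      change (fun i => (fromBlocks A⁻¹ 0 0 Aᵀ *ᵥ ξ) (Sum.inr i)) ⬝ᵥ x = (ξ ∘ Sum.inr) ⬝ᵥ A *ᵥ x
      rw [hr, mulVec_transpose, dotProduct_mulVec]
    have e2 : ∑ i, (fromBlocks A⁻¹ 0 0 Aᵀ *ᵥ ξ) (Sum.inl i) *
        (fromBlocks A⁻¹ 0 0 Aᵀ *ᵥ ξ) (Sum.inr i) = ∑ i, ξ (Sum.inl i) * ξ (Sum.inr i) := by
      change (fun i => (fromBlocks A⁻¹ 0 0 Aᵀ *ᵥ ξ) (Sum.inl i)) ⬝ᵥ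
        (fun i => (fromBlocks A⁻¹ 0 0 Aᵀ *ᵥ ξ) (Sum.inr i)) = (ξ ∘ Sum.inl) ⬝ᵥ (ξ ∘ Sum.inr)
      rw [hl, hr, mulVec_transpose, dotProduct_comm, ← dotProduct_mulVec, mulVec_mulVec,
        mul_nonsing_inv _ (isUnit_iff_ne_zero.2 hA), one_mulVec, dotProduct_comm]
    rw [e1, e2]
  rw [hl, hpt, hph]
  ring

/-- The symplectic action `(a, b) ↦ (a, b + C a)` of the chirp. -/
def chirpMatrix (C : Matrix ι ι ℝ) : Matrix (ι ⊕ ι) (ι ⊕ ι) ℝ := fromBlocks 1 0 C 1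

/-- Shifting `x·Cx/2` by `a` changes it by an affine function of `x` with slope `C a`, which is a
momentum kick. Symmetry of `C` is what merges the two cross terms. -/
theorem chirp_weyl {C : Matrix ι ι ℝ} (hC : Cᵀ = C) (ξ : ι ⊕ ι → ℝ) (f : Modes ι) :
    chirp C (weyl ξ f) = weyl (chirpMatrix C *ᵥ ξ) (chirp C f) := by
  refine Lp.ext ?_
  refine (coeFn_phaseOp_congr _ _ (coeFn_weyl ξ f)).trans ?_
  refine Filter.EventuallyEq.trans (Filter.Eventually.of_forall fun x => ?_)
    (coeFn_weyl_congr _ (coeFn_phaseOp_congr _ _ Filter.EventuallyEq.rfl)).symm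
  have hl : (fun i => (chirpMatrix C *ᵥ ξ) (Sum.inl i)) = ξ ∘ Sum.inl := by
    ext i; simp [chirpMatrix, fromBlocks_mulVec]
  have hr : (fun i => (chirpMatrix C *ᵥ ξ) (Sum.inr i)) =
      C *ᵥ (ξ ∘ Sum.inl) + ξ ∘ Sum.inr := by
    ext i; simp [chirpMatrix, fromBlocks_mulVec]
  beta_reduce
  rw [hl, ← mul_assoc, ← mul_assoc]
  have hpt : (x - fun i => ξ (Sum.inl i)) = x - ξ ∘ Sum.inl := rfl
  rw [hpt]
  congr 1
  simp only [weylPhase, chirpPhase]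
  rw [← Complex.exp_add, ← Complex.exp_add, ← mul_add, ← mul_add, ← Complex.ofReal_add,
    ← Complex.ofReal_add]
  congr 3
  change x ⬝ᵥ C *ᵥ x / 2 + ((ξ ∘ Sum.inr) ⬝ᵥ x - ((ξ ∘ Sum.inl) ⬝ᵥ (ξ ∘ Sum.inr)) / 2) =
    (fun i => (chirpMatrix C *ᵥ ξ) (Sum.inr i)) ⬝ᵥ x -
    ((fun i => (chirpMatrix C *ᵥ ξ) (Sum.inl i)) ⬝ᵥ
      (fun i => (chirpMatrix C *ᵥ ξ) (Sum.inr i))) / 2 +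
      (x - ξ ∘ Sum.inl) ⬝ᵥ C *ᵥ (x - ξ ∘ Sum.inl) / 2
  rw [hl, hr]
  generalize ξ ∘ Sum.inl = a
  generalize ξ ∘ Sum.inr = b
  have h1 : (C *ᵥ a) ⬝ᵥ x = a ⬝ᵥ C *ᵥ x := by
    rw [dotProduct_mulVec, ← mulVec_transpose, hC]
  have h2 : x ⬝ᵥ C *ᵥ a = a ⬝ᵥ C *ᵥ x := by rw [dotProduct_comm, h1]
  simp only [mulVec_sub, sub_dotProduct, dotProduct_sub, add_dotProduct, dotProduct_add, h1, h2]
  ring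

/-- Every `L = [[B, 0], [C B, B⁻ᵀ]]` is the inverse symplectic action of a Gaussian unitary. -/
theorem chirp_trans_dilation_weyl {B C : Matrix ι ι ℝ} (hB : B.det ≠ 0) (hC : Cᵀ = C)
    (ξ : ι ⊕ ι → ℝ) (f : Modes ι) :
    ((chirp (-C)).trans (dilation B hB)) (weyl (lowerSymplectic B C *ᵥ ξ) f) =
      weyl ξ (((chirp (-C)).trans (dilation B hB)) f) := by
  rw [LinearIsometryEquiv.trans_apply, chirp_weyl (by rw [transpose_neg, hC]), dilation_weyl,
    mulVec_mulVec, mulVec_mulVec, lowerSymplectic, chirpMatrix, fromBlocks_multiply, fromBlocks_multiply,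
    LinearIsometryEquiv.trans_apply]
  have hu := isUnit_iff_ne_zero.2 hB
  have h1 : Bᵀ * (B⁻¹)ᵀ = 1 := by rw [← transpose_mul, nonsing_inv_mul _ hu, transpose_one]
  simp [nonsing_inv_mul _ hu, h1, mul_assoc]

theorem isUnit_lowerSymplectic {B C : Matrix ι ι ℝ} (hB : B.det ≠ 0) :
    IsUnit (lowerSymplectic B C).det := by
  rw [lowerSymplectic, det_fromBlocks_zero₁₂, det_transpose, det_nonsing_inv]
  exact (isUnit_iff_ne_zero.2 hB).mul ((isUnit_iff_ne_zero.2 hB).ringInverse)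

theorem lowerSymplectic_mem {B C : Matrix ι ι ℝ} (hB : B.det ≠ 0) (hC : Cᵀ = C) :
    lowerSymplectic B C ∈ symplecticGroup ι ℝ := by
  have hu := isUnit_iff_ne_zero.2 hB
  rw [lowerSymplectic, SymplecticGroup.fromBlocks_mem_iff]
  refine ⟨?_, by simp, ?_⟩
  · rw [transpose_mul, hC, mul_assoc]
  · rw [← transpose_mul, nonsing_inv_mul _ hu]
    simp

theorem isGaussianUnitary_lower {B C : Matrix ι ι ℝ} (hB : B.det ≠ 0) (hC : Cᵀ = C) :
    IsGaussianUnitary ((chirp (-C)).trans (dilation B hB)) := by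
  have hu := isUnit_lowerSymplectic (C := C) hB
  have hmem := lowerSymplectic_mem hB hC
  refine ⟨(lowerSymplectic B C)⁻¹, ?_, 0, fun ξ f => ?_⟩
  · rw [← SymplecticGroup.coe_inv' ⟨_, hmem⟩]
    exact SetLike.coe_mem _
  · have := chirp_trans_dilation_weyl hB hC ((lowerSymplectic B C)⁻¹ *ᵥ ξ) f
    rw [mulVec_mulVec, mul_nonsing_inv _ hu, one_mulVec] at this
    rw [this]
    simp

end GaussianUnitaries

end ErgotropicGap

end

noncomputable section

namespace ErgotropicGap

open MeasureTheory Matrix Filter Topology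

/-! ### Differentiability of Weyl orbits and the moments of a Gaussian state. -/

section Orbits

/-- For fixed `s`, the derivative in `t` is `k1 (t - s) - k1 t + k2 s`, of size at most `ε |s|`; the
mean value inequality from `0` to `t` supplies the factor `|t|`. Strict differentiability is needed
because both arguments of `k1` move. -/
theorem second_difference_le {k k1 : ℝ → ℂ} {k2 : ℂ} (hk : ∀ t, HasDerivAt k (k1 t) t)
    (hk1 : HasStrictDerivAt k1 k2 0) {ε : ℝ} (hε : 0 < ε) :
    ∃ r > 0, ∀ s t : ℝ, |s| < r → |t| < r →
      ‖k (t - s) - k t - k (-s) + k 0 + k2 * s * t‖ ≤ ε * |s| * |t| := by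
  have h1 := hk1.isLittleO.def hε
  obtain ⟨r, hr, hball⟩ := Metric.eventually_nhds_iff.1 h1
  refine ⟨r / 2, by positivity, fun s t hs ht => ?_⟩
  have hg : ∀ x ∈ Metric.ball (0 : ℝ) (r / 2),
      HasDerivWithinAt (fun x => k (x - s) - k x + k2 * s * x)
        (k1 (x - s) - k1 x + k2 * s) (Metric.ball (0 : ℝ) (r / 2)) x := by
    intro x _
    have e1 : HasDerivAt (fun x : ℝ => k (x - s)) (k1 (x - s)) x := by
      simpa using (hk (x - s)).comp_sub_const x s
    have e2 : HasDerivAt (fun x : ℝ => k2 * s * (x : ℂ)) (k2 * s) x := by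
      simpa using (Complex.ofRealCLM.hasDerivAt (x := x)).const_mul (k2 * s)
    exact ((e1.sub (hk x)).add e2).hasDerivWithinAt
  have hb : ∀ x ∈ Metric.ball (0 : ℝ) (r / 2), ‖k1 (x - s) - k1 x + k2 * s‖ ≤ ε * |s| := by
    intro x hx
    rw [Metric.mem_ball, dist_zero_right, Real.norm_eq_abs] at hx
    have := @hball (x - s, x) (by
      rw [Prod.dist_eq, max_lt_iff]
      simp only [Real.dist_eq, sub_zero]
      exact ⟨by have := abs_sub x s; linarith, by linarith⟩)
    have e : x - s - x = -s := by ring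
    have h3 : ‖k1 (x - s) - k1 x - (x - s - x) • k2‖ ≤ ε * ‖x - s - x‖ := this
    rw [e, norm_neg, Real.norm_eq_abs] at h3
    convert h3 using 2
    rw [neg_smul, sub_neg_eq_add, Complex.real_smul, mul_comm]
  have := (convex_ball (0 : ℝ) (r / 2)).norm_image_sub_le_of_norm_hasDerivWithin_le hg hb
    (Metric.mem_ball_self (by positivity)) (y := t) (by simpa using ht)
  simp only [sub_zero, Real.norm_eq_abs, zero_sub, Complex.ofReal_zero, mul_zero, add_zero] at this
  refine le_trans (le_of_eq ?_) this
  congr 1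
  ring

/-- A curve in a Hilbert space whose Gram kernel is `k (t - s)` with `k` twice differentiable is
differentiable. -/
theorem exists_hasDerivAt_of_gram {E : Type*} [NormedAddCommGroup E] [InnerProductSpace ℂ E]
    [CompleteSpace E] {w : ℝ → E} {k k1 : ℝ → ℂ} {c : ℝ}
    (hw : ∀ s t, inner ℂ (w s) (w t) = k (t - s)) (hk : ∀ t, HasDerivAt k (k1 t) t)
    (hk1 : HasStrictDerivAt k1 (-(c : ℂ)) 0) :
    ∃ v, HasDerivAt w v 0 ∧ ‖v‖ ^ 2 = c := by
  -- The Gram matrix of the difference quotients is a second difference quotient of `k`, so it tends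
  -- to `-k''(0) = c` as `s` and `t` tend to 0 independently. This yields both the Cauchy property
  -- and the norm of the limit.
  set D : ℝ → E := fun t => t⁻¹ • (w t - w 0) with hD
  have hDD : ∀ s t, inner ℂ (D s) (D t) =
      ((s⁻¹ * t⁻¹ : ℝ) : ℂ) * (k (t - s) - k t - k (-s) + k 0) := by
    intro s t
    simp only [hD]
    rw [← Complex.coe_smul, ← Complex.coe_smul, inner_smul_left, inner_smul_right, inner_sub_left,
      inner_sub_right, inner_sub_right, hw, hw, hw, hw]
    simp only [Complex.conj_ofReal, sub_zero, zero_sub]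
    push_cast
    ring
  have hlim : ∀ ε > 0, ∃ r > 0, ∀ s t : ℝ, s ≠ 0 → t ≠ 0 → |s| < r → |t| < r →
      ‖inner ℂ (D s) (D t) - c‖ ≤ ε := by
    intro ε hε
    obtain ⟨r, hr, h⟩ := second_difference_le hk hk1 hε
    refine ⟨r, hr, fun s t hs ht hsr htr => ?_⟩
    have h1 := h s t hsr htr
    have h2 : inner ℂ (D s) (D t) - c = ((s⁻¹ * t⁻¹ : ℝ) : ℂ) *
        (k (t - s) - k t - k (-s) + k 0 + -(c : ℂ) * s * t) := by
      have hs' : (s : ℂ) ≠ 0 := by exact_mod_cast hs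
      have ht' : (t : ℂ) ≠ 0 := by exact_mod_cast ht
      rw [hDD]
      push_cast
      field_simp
      ring
    rw [h2, norm_mul, Complex.norm_real, Real.norm_eq_abs, abs_mul, abs_inv, abs_inv]
    have hs0 := abs_pos.2 hs
    have ht0 := abs_pos.2 ht
    calc |s|⁻¹ * |t|⁻¹ * ‖k (t - s) - k t - k (-s) + k 0 + -(c : ℂ) * s * t‖
        ≤ |s|⁻¹ * |t|⁻¹ * (ε * |s| * |t|) := by gcongr
      _ = ε := by field_simp
  have hre : ∀ x : E, ‖x‖ ^ 2 = (inner ℂ x x).re := fun x => by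
    rw [← inner_self_eq_norm_sq (𝕜 := ℂ) x]; rfl
  have hcauchy : Cauchy (Filter.map D (𝓝[≠] (0 : ℝ))) := by
    rw [Metric.cauchy_iff]
    refine ⟨inferInstance, fun ε hε => ?_⟩
    -- Expanding `‖D s - D t‖²` meets four inner products, each within `ε² / 8` of `c`, whose main
    -- terms cancel: the total is at most `ε² / 2`.
    obtain ⟨r, hr, h⟩ := hlim (ε ^ 2 / 8) (by positivity)
    refine ⟨D '' (Metric.ball 0 r ∩ {0}ᶜ), ?_, ?_⟩
    · refine Filter.image_mem_map ?_
      rw [Set.inter_comm]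
      exact inter_mem_nhdsWithin _ (Metric.ball_mem_nhds _ hr)
    · rintro _ ⟨s, ⟨hs, hs0⟩, rfl⟩ _ ⟨t, ⟨ht, ht0⟩, rfl⟩
      simp only [Metric.mem_ball, dist_zero_right, Real.norm_eq_abs, Set.mem_compl_iff,
        Set.mem_singleton_iff] at hs hs0 ht ht0
      have a1 := (Complex.abs_re_le_norm _).trans (h s s hs0 hs0 hs hs)
      have a2 := (Complex.abs_re_le_norm _).trans (h t t ht0 ht0 ht ht)
      have a3 := (Complex.abs_re_le_norm _).trans (h s t hs0 ht0 hs ht)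
      simp only [Complex.sub_re, Complex.ofReal_re] at a1 a2 a3
      have h4 := norm_sub_sq (𝕜 := ℂ) (D s) (D t)
      rw [hre (D s), hre (D t)] at h4
      have h5 : RCLike.re (inner ℂ (D s) (D t)) = (inner ℂ (D s) (D t)).re := rfl
      rw [h5] at h4
      rw [dist_eq_norm]
      have h6 : ‖D s - D t‖ ^ 2 < ε ^ 2 := by
        rw [h4]
        have := abs_le.1 a1
        have := abs_le.1 a2
        have := abs_le.1 a3
        have : 0 < ε ^ 2 := by positivity
        linarith
      exact lt_of_pow_lt_pow_left₀ 2 hε.le h6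
  obtain ⟨v, hv⟩ := CompleteSpace.complete hcauchy
  have hv : Tendsto D (𝓝[≠] 0) (𝓝 v) := hv
  refine ⟨v, ?_, ?_⟩
  · rw [hasDerivAt_iff_tendsto_slope_zero]
    simpa [hD] using hv
  · have h1 : Tendsto (fun t => ‖D t‖ ^ 2) (𝓝[≠] 0) (𝓝 (‖v‖ ^ 2)) := hv.norm.pow 2
    refine tendsto_nhds_unique h1 ?_
    rw [Metric.tendsto_nhds]
    intro ε hε
    obtain ⟨r, hr, h⟩ := hlim (ε / 2) (by positivity)
    have hmem : Metric.ball (0 : ℝ) r ∈ 𝓝[≠] (0 : ℝ) :=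
      mem_nhdsWithin_of_mem_nhds (Metric.ball_mem_nhds _ hr)
    filter_upwards [hmem, self_mem_nhdsWithin] with t ht ht0
    simp only [Metric.mem_ball, dist_zero_right, Real.norm_eq_abs, Set.mem_compl_iff,
      Set.mem_singleton_iff] at ht ht0
    have a1 := (Complex.abs_re_le_norm _).trans (h t t ht0 ht0 ht ht)
    simp only [Complex.sub_re, Complex.ofReal_re] at a1
    rw [Real.dist_eq, hre]
    linarith

theorem hasDerivAt_gaussian (δ m t : ℝ) :
    HasDerivAt (fun t : ℝ => Complex.exp (Complex.I * ((δ * t : ℝ) : ℂ) - ((m * t ^ 2 / 4 : ℝ) : ℂ)))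
      ((Complex.I * δ - ((m * t / 2 : ℝ) : ℂ)) *
        Complex.exp (Complex.I * ((δ * t : ℝ) : ℂ) - ((m * t ^ 2 / 4 : ℝ) : ℂ))) t := by
  have h1 : HasDerivAt (fun t : ℝ => ((δ * t : ℝ) : ℂ)) (δ : ℂ) t := by
    have : HasDerivAt (fun t : ℝ => δ * t) δ t := by simpa using (hasDerivAt_id t).const_mul δ
    exact this.ofReal_comp
  have h2 : HasDerivAt (fun t : ℝ => ((m * t ^ 2 / 4 : ℝ) : ℂ)) ((m * t / 2 : ℝ) : ℂ) t := by
    have : HasDerivAt (fun t : ℝ => m * t ^ 2 / 4) (m * t / 2) t := by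
      have := (((hasDerivAt_id t).pow 2).const_mul m).div_const 4
      refine this.congr_deriv ?_
      simp
      ring
    exact this.ofReal_comp
  have := ((h1.const_mul Complex.I).sub h2).cexp
  rw [mul_comm] at this
  exact this

/-- The factor by which a quadrature differs from the derivative of its orbit. -/
def quadCoeff {ι : Type*} : ι ⊕ ι → ℂ := Sum.elim (fun _ => -Complex.I) (fun _ => Complex.I)

theorem norm_quadCoeff {ι : Type*} (s : ι ⊕ ι) : ‖quadCoeff s‖ = 1 := by
  cases s <;> simp [quadCoeff]

variable {ι : Type*} [Fintype ι]

theorem sympForm_smul_smul (s t : ℝ) (ξ η : ι ⊕ ι → ℝ) :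
    sympForm (s • ξ) (t • η) = s * t * sympForm ξ η := by
  simp only [sympForm, Pi.smul_apply, smul_eq_mul, Finset.mul_sum]
  exact Finset.sum_congr rfl fun i _ => by ring

/-- The symplectic form vanishes along a line, so the Gram kernel depends on `t - s` only and is the
given Gaussian; minus its second derivative at 0 is `m / 2 + δ²`. -/
theorem exists_hasDerivAt_weyl {φ : Modes ι} {ξ : ι ⊕ ι → ℝ} {δ m : ℝ}
    (h : ∀ t : ℝ, inner ℂ φ (weyl (t • ξ) φ) =
      Complex.exp (Complex.I * ((δ * t : ℝ) : ℂ) - ((m * t ^ 2 / 4 : ℝ) : ℂ))) :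
    ∃ v, HasDerivAt (fun t : ℝ => weyl (t • ξ) φ) v 0 ∧ ‖v‖ ^ 2 = m / 2 + δ ^ 2 := by
  refine exists_hasDerivAt_of_gram (k := fun t =>
    Complex.exp (Complex.I * ((δ * t : ℝ) : ℂ) - ((m * t ^ 2 / 4 : ℝ) : ℂ)))
    (k1 := fun t => (Complex.I * δ - ((m * t / 2 : ℝ) : ℂ)) *
        Complex.exp (Complex.I * ((δ * t : ℝ) : ℂ) - ((m * t ^ 2 / 4 : ℝ) : ℂ)))
    (fun s t => ?_) (hasDerivAt_gaussian δ m) ?_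
  · rw [inner_weyl_weyl, sympForm_smul_smul, sympForm_self, ← sub_smul, h]
    simp
  · have hd : ContDiff ℝ 1 (fun t : ℝ => (Complex.I * δ - ((m * t / 2 : ℝ) : ℂ)) *
        Complex.exp (Complex.I * ((δ * t : ℝ) : ℂ) - ((m * t ^ 2 / 4 : ℝ) : ℂ))) := by
      have e : ∀ f : ℝ → ℝ, ContDiff ℝ 1 f → ContDiff ℝ 1 (fun t => ((f t : ℝ) : ℂ)) :=
        fun f hf => Complex.ofRealCLM.contDiff.comp hf
      have e1 := e (fun t => m * t / 2) (by fun_prop)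
      have e2 := e (fun t => δ * t) (by fun_prop)
      have e3 := e (fun t => m * t ^ 2 / 4) (by fun_prop)
      exact (contDiff_const.sub e1).mul ((contDiff_const.mul e2).sub e3).cexp
    refine (hd.contDiffAt.hasStrictDerivAt' ?_ one_ne_zero)
    have h1 := hasDerivAt_gaussian δ m 0
    have h2 : HasDerivAt (fun t : ℝ => Complex.I * δ - ((m * t / 2 : ℝ) : ℂ))
        (-((m / 2 : ℝ) : ℂ)) 0 := by
      have : HasDerivAt (fun t : ℝ => m * t / 2) (m / 2) 0 := by
        simpa using ((hasDerivAt_id (0 : ℝ)).const_mul m).div_const 2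
      simpa using (this.ofReal_comp.const_sub (Complex.I * δ))
    refine (h2.mul h1).congr_deriv ?_
    simp
    ring_nf
    simp
    ring

variable [DecidableEq ι]

theorem orbit_eq (φ : Modes ι) (s : ι ⊕ ι) :
    orbit φ s = fun t => weyl (t • Pi.single s.swap 1) φ := by
  cases s <;> rfl

theorem quad_eq (φ : Modes ι) (s : ι ⊕ ι) :
    quad φ s = quadCoeff s • deriv (orbit φ s) 0 := by
  cases s <;> rfl

theorem differentiableAt_orbit {φ : Modes ι} {s : ι ⊕ ι} {δ m : ℝ}
    (h : ∀ t : ℝ, inner ℂ φ (weyl (t • Pi.single s.swap 1) φ) =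
      Complex.exp (Complex.I * ((δ * t : ℝ) : ℂ) - ((m * t ^ 2 / 4 : ℝ) : ℂ))) :
    DifferentiableAt ℝ (orbit φ s) 0 ∧ ‖quad φ s‖ ^ 2 = m / 2 + δ ^ 2 := by
  obtain ⟨v, hv, hn⟩ := exists_hasDerivAt_weyl h
  rw [← orbit_eq] at hv
  refine ⟨hv.differentiableAt, ?_⟩
  rw [quad_eq, hv.deriv, norm_smul, norm_quadCoeff, one_mul, hn]

/-- The characteristic function of `φ` is the Gaussian with parameters `d`, `M`. -/
def HasGaussianChar (φ : Modes ι) (d : ι ⊕ ι → ℝ) (M : Matrix (ι ⊕ ι) (ι ⊕ ι) ℝ) : Prop :=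
  ∀ ξ, inner ℂ φ (weyl ξ φ) =
      Complex.exp (Complex.I * ((d ⬝ᵥ ξ : ℝ) : ℂ) - ((ξ ⬝ᵥ M *ᵥ ξ / 4 : ℝ) : ℂ))

theorem HasGaussianChar.along {φ : Modes ι} {d : ι ⊕ ι → ℝ} {M : Matrix (ι ⊕ ι) (ι ⊕ ι) ℝ}
    (h : HasGaussianChar φ d M) (s : ι ⊕ ι) (t : ℝ) :
    inner ℂ φ (weyl (t • Pi.single s 1) φ) =
      Complex.exp (Complex.I * ((d s * t : ℝ) : ℂ) - ((M s s * t ^ 2 / 4 : ℝ) : ℂ)) := by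
  rw [h]
  congr 3
  · simp [mul_comm]
  · simp [mulVec_smul]
    ring

theorem HasGaussianChar.finiteEnergy {φ : Modes ι} {d : ι ⊕ ι → ℝ}
    {M : Matrix (ι ⊕ ι) (ι ⊕ ι) ℝ} (h : HasGaussianChar φ d M) : FiniteEnergy φ :=
  fun s => (differentiableAt_orbit (h.along s.swap)).1

/-- The exponent is sorted by powers of `σ`, the part free of `σ` last, to fit
`hasDerivAt_exp_quadratic`. -/
theorem HasGaussianChar.inner_weyl_weyl {φ : Modes ι} {d : ι ⊕ ι → ℝ}
    {M : Matrix (ι ⊕ ι) (ι ⊕ ι) ℝ} (h : HasGaussianChar φ d M) (hM : M.IsSymm) (s t : ι ⊕ ι)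
    (σ τ : ℝ) :
    inner ℂ (weyl (σ • Pi.single s 1) φ) (weyl (τ • Pi.single t 1) φ) =
      Complex.exp (((σ * (M s t * τ / 2) - M s s * σ ^ 2 / 4 : ℝ) : ℂ) +
        Complex.I * ((-(d s + sympForm (Pi.single s 1) (Pi.single t 1) * τ / 2) * σ : ℝ) : ℂ) +
        (Complex.I * ((d t * τ : ℝ) : ℂ) - ((M t t * τ ^ 2 / 4 : ℝ) : ℂ))) := by
  have hst : M t s = M s t := hM.apply s t
  rw [ErgotropicGap.inner_weyl_weyl, h, ← Complex.exp_add, sympForm_smul_smul]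
  congr 1
  have e1 : d ⬝ᵥ (τ • Pi.single t 1 - σ • Pi.single s 1) = d t * τ - d s * σ := by
    simp [dotProduct_sub, mul_comm]
  have e2 : (τ • Pi.single t 1 - σ • Pi.single s 1) ⬝ᵥ
      M *ᵥ (τ • Pi.single t 1 - σ • Pi.single s 1) =
      M t t * τ ^ 2 - 2 * M s t * σ * τ + M s s * σ ^ 2 := by
    simp [dotProduct_sub, sub_dotProduct, mulVec_sub, mulVec_smul, hst]
    ring
  rw [e1, e2]
  push_cast
  ring

theorem hasDerivAt_exp_quadratic (a b c : ℝ) (z : ℂ) :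
    HasDerivAt (fun σ : ℝ => Complex.exp (((σ * a - b * σ ^ 2 / 4 : ℝ) : ℂ) +
      Complex.I * ((c * σ : ℝ) : ℂ) + z)) ((a + Complex.I * c) * Complex.exp z) 0 := by
  have h1 : HasDerivAt (fun σ : ℝ => σ * a - b * σ ^ 2 / 4) a 0 := by
    have := ((hasDerivAt_id (0 : ℝ)).mul_const a).sub
      ((((hasDerivAt_id (0 : ℝ)).pow 2).const_mul b).div_const 4)
    refine this.congr_deriv ?_
    simp
  have h2 : HasDerivAt (fun σ : ℝ => c * σ) c 0 := by
    simpa using (hasDerivAt_id (0 : ℝ)).const_mul c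
  have h3 := ((h1.ofReal_comp.add (h2.ofReal_comp.const_mul Complex.I)).add_const z).cexp
  refine h3.congr_deriv ?_
  simp
  ring

/-- The moments are derivatives of the Gram kernel at 0, taken first in `σ` for every `τ` and then
in `τ`. Taking the real part discards the symplectic form, that is, the commutator. -/
theorem HasGaussianChar.inner_deriv {φ : Modes ι} {d : ι ⊕ ι → ℝ}
    {M : Matrix (ι ⊕ ι) (ι ⊕ ι) ℝ} (h : HasGaussianChar φ d M) (hM : M.IsSymm) (s t : ι ⊕ ι) :
    (inner ℂ φ (deriv (orbit φ s) 0)) = Complex.I * d s.swap ∧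
    (inner ℂ (deriv (orbit φ s) 0) (deriv (orbit φ t) 0)).re =
      M s.swap t.swap / 2 + d s.swap * d t.swap := by
  have hs := (h.finiteEnergy s).hasDerivAt
  have ht := (h.finiteEnergy t).hasDerivAt
  constructor
  · have h1 : HasDerivAt (fun τ => inner ℂ φ (orbit φ s τ))
        (inner ℂ φ (deriv (orbit φ s) 0)) 0 := by
      simpa using (hasDerivAt_const (0 : ℝ) φ).inner ℂ hs
    have h2 : (fun τ => inner ℂ φ (orbit φ s τ)) = fun τ : ℝ =>
        Complex.exp (Complex.I * ((d s.swap * τ : ℝ) : ℂ) -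
          ((M s.swap s.swap * τ ^ 2 / 4 : ℝ) : ℂ)) := by
      ext τ
      rw [orbit_eq]
      exact h.along _ τ
    rw [h2] at h1
    rw [h1.unique (hasDerivAt_gaussian _ _ 0)]
    simp
  · have key : ∀ τ : ℝ, inner ℂ (deriv (orbit φ s) 0) (orbit φ t τ) =
        (((M s.swap t.swap * τ / 2 : ℝ) : ℂ) +
          Complex.I * ((-(d s.swap + sympForm (Pi.single s.swap 1) (Pi.single t.swap 1) * τ / 2) :
            ℝ) : ℂ)) * Complex.exp (Complex.I * ((d t.swap * τ : ℝ) : ℂ) -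
          ((M t.swap t.swap * τ ^ 2 / 4 : ℝ) : ℂ)) := by
      intro τ
      have h1 : HasDerivAt (fun σ => inner ℂ (orbit φ s σ) (orbit φ t τ))
          (inner ℂ (deriv (orbit φ s) 0) (orbit φ t τ)) 0 := by
        simpa using hs.inner ℂ (hasDerivAt_const (0 : ℝ) (orbit φ t τ))
      rw [orbit_eq φ t] at h1 ⊢
      have h2 : ∀ σ, inner ℂ (orbit φ s σ) (weyl (τ • Pi.single t.swap 1) φ) =
          inner ℂ (weyl (σ • Pi.single s.swap 1) φ) (weyl (τ • Pi.single t.swap 1) φ) :=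
        fun σ => by rw [orbit_eq φ s]
      simp only [h2, h.inner_weyl_weyl hM] at h1
      exact h1.unique (hasDerivAt_exp_quadratic _ _ _ _)
    have h1 : HasDerivAt (fun τ => inner ℂ (deriv (orbit φ s) 0) (orbit φ t τ))
        (inner ℂ (deriv (orbit φ s) 0) (deriv (orbit φ t) 0)) 0 := by
      simpa using (hasDerivAt_const (0 : ℝ) (deriv (orbit φ s) 0)).inner ℂ ht
    rw [funext key] at h1
    have e1 : HasDerivAt (fun τ : ℝ => M s.swap t.swap * τ / 2) (M s.swap t.swap / 2) 0 := by
      simpa using ((hasDerivAt_id (0 : ℝ)).const_mul (M s.swap t.swap)).div_const 2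
    have e2 : HasDerivAt (fun τ : ℝ =>
        -(d s.swap + sympForm (Pi.single s.swap 1) (Pi.single t.swap 1) * τ / 2))
        (-(sympForm (Pi.single s.swap 1) (Pi.single t.swap 1) / 2)) 0 := by
      have := ((((hasDerivAt_id (0 : ℝ)).const_mul
        (sympForm (Pi.single s.swap 1) (Pi.single t.swap 1))).div_const 2).const_add
          (d s.swap)).neg
      rw [mul_one] at this
      exact this
    have e3 := (e1.ofReal_comp.add (e2.ofReal_comp.const_mul Complex.I)).mul
      (hasDerivAt_gaussian (d t.swap) (M t.swap t.swap) 0)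
    rw [h1.unique e3]
    simp

/-- Each quadrature generates the displacements along the conjugate axis, up to the sign in
`quadCoeff`; hence the rotation by `-J`. -/
theorem HasGaussianChar.covMatrix_eq {φ : Modes ι} {d : ι ⊕ ι → ℝ}
    {M : Matrix (ι ⊕ ι) (ι ⊕ ι) ℝ} (h : HasGaussianChar φ d M) (hM : M.IsSymm) :
    covMatrix φ = (-J ι ℝ)ᵀ * M * (-J ι ℝ) := by
  ext s t
  have hs := (h.inner_deriv hM s t).1
  have ht := (h.inner_deriv hM t s).1
  have hst := (h.inner_deriv hM s t).2
  simp only [covMatrix, of_apply, meanVec, quad_eq, inner_smul_left, inner_smul_right, hs, ht]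
  set z := inner ℂ (deriv (orbit φ s) 0) (deriv (orbit φ t) 0)
  rcases s with s | s <;> rcases t with t | t <;>
    simp only [Sum.swap_inl, Sum.swap_inr] at hst <;>
    simp [quadCoeff, hst, J, mul_apply, Fintype.sum_sum_type, one_apply] <;> ring

/-- The rotation by `-J` acts inside each block as a symplectic congruence, so the spectra may be
computed from `M` itself. -/
theorem HasGaussianChar.symplecticEigenvalues_reducedCov {φ : Modes ι} {d : ι ⊕ ι → ℝ}
    {M : Matrix (ι ⊕ ι) (ι ⊕ ι) ℝ} (h : HasGaussianChar φ d M) (hM : M.IsSymm) (B : Finset ι) :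
    symplecticEigenvalues (reducedCov B φ) =
      symplecticEigenvalues (M.submatrix (blockIncl B) (blockIncl B)) := by
  have h1 : reducedCov B φ =
      (-J B ℝ)ᵀ * M.submatrix (blockIncl B) (blockIncl B) * (-J B ℝ) := by
    rw [reducedCov, h.covMatrix_eq hM]
    ext s t
    rcases s with s | s <;> rcases t with t | t <;>
      simp [J, mul_apply, Fintype.sum_sum_type, one_apply]
  rw [h1, symplecticEigenvalues_congr (SymplecticGroup.neg_mem (SymplecticGroup.J_mem ..))]

end Orbits

end ErgotropicGap

end

noncomputable section

namespace ErgotropicGap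

open MeasureTheory Matrix Filter Topology

/-! ### Uniqueness of the Fourier transform on integrable functions. -/

section Fourier

variable {ι : Type*} [Fintype ι]

theorem norm_exp_I_mul (r : ℝ) : ‖Complex.exp (Complex.I * (r : ℂ))‖ = 1 := by
  rw [mul_comm, Complex.norm_exp_ofReal_mul_I]

theorem integrable_exp_mul {g : (ι → ℝ) → ℂ} (hg : Integrable g) (b : ι → ℝ) :
    Integrable fun x => Complex.exp (Complex.I * ((b ⬝ᵥ x : ℝ) : ℂ)) * g x := by
  refine hg.bdd_mul (c := 1) ?_ (Eventually.of_forall fun x => (norm_exp_I_mul _).le)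
  refine Continuous.aestronglyMeasurable ?_
  unfold dotProduct
  fun_prop

theorem dual_apply_eq_dotProduct [DecidableEq ι] (L : StrongDual ℝ (ι → ℝ)) (x : ι → ℝ) :
    L x = (fun i => L (Pi.single i 1)) ⬝ᵥ x := by
  conv_lhs => rw [pi_eq_sum_univ' x]
  simp [dotProduct, map_sum, mul_comm]

/-- The positive and negative parts of `g` are densities of finite measures with equal
characteristic functions. The measures agree, so the two parts agree almost everywhere, which is
possible only where `g` vanishes. -/
theorem ae_eq_zero_of_fourier_eq_zero_real {g : (ι → ℝ) → ℝ} (hg : Integrable g)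
    (h : ∀ b : ι → ℝ, ∫ x, Complex.exp (Complex.I * ((b ⬝ᵥ x : ℝ) : ℂ)) * (g x : ℂ) = 0) :
    g =ᵐ[volume] 0 := by
  classical
  wlog hm : Measurable g generalizing g
  · have hmk := hg.aestronglyMeasurable.ae_eq_mk
    have h1 := this (hg.congr hmk) (fun b => by
      rw [← h b]
      refine integral_congr_ae ?_
      filter_upwards [hmk] with x hx
      rw [hx]) hg.aestronglyMeasurable.stronglyMeasurable_mk.measurable
    exact hmk.trans h1
  have hpos : Integrable fun x => max (g x) 0 := hg.pos_part
  have hneg : Integrable fun x => max (-g x) 0 := hg.neg_part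
  have := isFiniteMeasure_withDensity_ofReal hg.2
  have := isFiniteMeasure_withDensity_ofReal hg.neg.2
  have hchar : ∀ (f : (ι → ℝ) → ℝ), Measurable f → ∀ L : StrongDual ℝ (ι → ℝ),
      charFunDual (volume.withDensity fun x => ENNReal.ofReal (f x)) L =
      ∫ x, Complex.exp (Complex.I * (((fun i => L (Pi.single i 1)) ⬝ᵥ x : ℝ) : ℂ)) *
        ((max (f x) 0 : ℝ) : ℂ) := by
    intro f hf L
    rw [charFunDual_apply, integral_withDensity_eq_integral_toReal_smul hf.ennreal_ofReal
      (Eventually.of_forall fun x => ENNReal.ofReal_lt_top)]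
    refine integral_congr_ae (Eventually.of_forall fun x => ?_)
    simp only
    rw [ENNReal.toReal_ofReal', Complex.real_smul, mul_comm, mul_comm _ Complex.I,
      ← dual_apply_eq_dotProduct]
  have heq : (volume.withDensity fun x => ENNReal.ofReal (g x)) =
      volume.withDensity fun x => ENNReal.ofReal (-g x) := by
    refine Measure.ext_of_charFunDual ?_
    ext L
    have e2 := hchar (fun x => -g x) hm.neg L
    rw [hchar g hm, e2, ← sub_eq_zero, ← integral_sub]
    · rw [← h fun i => L (Pi.single i 1)]
      refine integral_congr_ae (Eventually.of_forall fun x => ?_)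
      simp only
      rw [← mul_sub, ← Complex.ofReal_sub]
      congr 2
      rcases le_total (g x) 0 with hx | hx
      · rw [max_eq_right hx, max_eq_left (by linarith)]; ring
      · rw [max_eq_left hx, max_eq_right (by linarith)]; ring
    · exact integrable_exp_mul hpos.ofReal _
    · exact integrable_exp_mul hneg.ofReal _
  have hfin : ∫⁻ x, ENNReal.ofReal (g x) ≠ ⊤ := by
    refine ne_top_of_le_ne_top hg.2.ne (lintegral_mono fun x => ?_)
    exact Real.ofReal_le_enorm _
  have heq := (withDensity_eq_iff hm.ennreal_ofReal.aemeasurable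
    hm.neg.ennreal_ofReal.aemeasurable hfin).1 heq
  filter_upwards [heq] with x hx
  simp only [Pi.neg_apply] at hx
  rw [Pi.zero_apply]
  rcases lt_trichotomy (g x) 0 with h1 | h1 | h1
  · rw [ENNReal.ofReal_of_nonpos h1.le, eq_comm, ENNReal.ofReal_eq_zero] at hx
    linarith
  · exact h1
  · have h2 : ENNReal.ofReal (-g x) = 0 := ENNReal.ofReal_of_nonpos (by linarith)
    rw [h2, ENNReal.ofReal_eq_zero] at hx
    linarith

/-- An integrable function with vanishing Fourier transform vanishes almost everywhere. -/
theorem ae_eq_zero_of_fourier_eq_zero {g : (ι → ℝ) → ℂ} (hg : Integrable g)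
    (h : ∀ b : ι → ℝ, ∫ x, Complex.exp (Complex.I * ((b ⬝ᵥ x : ℝ) : ℂ)) * g x = 0) :
    g =ᵐ[volume] 0 := by
  have hconj : ∀ b : ι → ℝ,
      ∫ x, Complex.exp (Complex.I * ((b ⬝ᵥ x : ℝ) : ℂ)) * (starRingEnd ℂ) (g x) = 0 := by
    intro b
    have h1 := congrArg (starRingEnd ℂ) (h (-b))
    rw [← integral_conj, map_zero] at h1
    rw [← h1]
    refine integral_congr_ae (Eventually.of_forall fun x => ?_)
    simp [← Complex.exp_conj]
  have hgc : Integrable fun x => (starRingEnd ℂ) (g x) := by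
    exact (Complex.conjCLE.toContinuousLinearMap.integrable_comp hg)
  have hre := ae_eq_zero_of_fourier_eq_zero_real (g := fun x => (g x).re) hg.re fun b => by
    have : ∀ x, Complex.exp (Complex.I * ((b ⬝ᵥ x : ℝ) : ℂ)) * ((g x).re : ℂ) =
        (1 / 2 : ℂ) * (Complex.exp (Complex.I * ((b ⬝ᵥ x : ℝ) : ℂ)) * g x +
          Complex.exp (Complex.I * ((b ⬝ᵥ x : ℝ) : ℂ)) * (starRingEnd ℂ) (g x)) := by
      intro x
      rw [Complex.re_eq_add_conj]
      ring
    simp_rw [this]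
    rw [integral_const_mul, integral_add (integrable_exp_mul hg b) (integrable_exp_mul hgc b), h,
      hconj]
    simp
  have him := ae_eq_zero_of_fourier_eq_zero_real (g := fun x => (g x).im) hg.im fun b => by
    have : ∀ x, Complex.exp (Complex.I * ((b ⬝ᵥ x : ℝ) : ℂ)) * ((g x).im : ℂ) =
        (1 / (2 * Complex.I) : ℂ) * (Complex.exp (Complex.I * ((b ⬝ᵥ x : ℝ) : ℂ)) * g x -
          Complex.exp (Complex.I * ((b ⬝ᵥ x : ℝ) : ℂ)) * (starRingEnd ℂ) (g x)) := by
      intro x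
      rw [Complex.im_eq_sub_conj]
      ring
    simp_rw [this]
    rw [integral_const_mul, integral_sub (integrable_exp_mul hg b) (integrable_exp_mul hgc b), h,
      hconj]
    simp
  filter_upwards [hre, him] with x h1 h2
  exact Complex.ext h1 h2

end Fourier

/-! ### The characteristic function as a Fourier transform. -/

section Characteristic

variable {ι : Type*} [Fintype ι]

/-- At fixed position displacement this is, up to a phase, a Fourier transform in the momentum
displacement, which makes Fourier uniqueness applicable. -/
theorem inner_weyl_eq_integral (φ ψ : Modes ι) (ξ : ι ⊕ ι → ℝ) :
    inner ℂ φ (weyl ξ ψ) =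
      Complex.exp (-(Complex.I * (((∑ i, ξ (Sum.inl i) * ξ (Sum.inr i)) / 2 : ℝ) : ℂ))) *
      ∫ x, Complex.exp (Complex.I * (((ξ ∘ Sum.inr) ⬝ᵥ x : ℝ) : ℂ)) *
        ((starRingEnd ℂ) (φ x) * ψ (x - ξ ∘ Sum.inl)) := by
  rw [L2.inner_def, ← integral_const_mul]
  refine integral_congr_ae ?_
  filter_upwards [coeFn_weyl ξ ψ] with x hx
  rw [hx, RCLike.inner_apply]
  have h1 : weylPhase ξ x =
      Complex.exp (-(Complex.I * (((∑ i, ξ (Sum.inl i) * ξ (Sum.inr i)) / 2 : ℝ) : ℂ))) *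
        Complex.exp (Complex.I * (((ξ ∘ Sum.inr) ⬝ᵥ x : ℝ) : ℂ)) := by
    rw [weylPhase, ← Complex.exp_add]
    congr 1
    simp only [dotProduct, Function.comp]
    push_cast
    ring
  have h2 : (x - fun i => ξ (Sum.inl i)) = x - ξ ∘ Sum.inl := rfl
  rw [h1, h2]
  ring

theorem integrable_conj_mul_shift (φ ψ : Modes ι) (a : ι → ℝ) :
    Integrable fun x => (starRingEnd ℂ) (φ x) * ψ (x - a) := by
  have h1 : MemLp (fun x => ψ (x - a)) 2 volume :=
    (Lp.memLp ψ).comp_measurePreserving (measurePreserving_sub_right volume a)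
  have h2 : MemLp (fun x => (starRingEnd ℂ) (φ x)) 2 volume := (Lp.memLp φ).star
  exact h2.integrable_mul h1

/-- The momentum block of the covariance form of a state is positive definite. -/
theorem HasGaussianChar.posDef_toBlocks₂₂ {ψ : Modes ι} {d : ι ⊕ ι → ℝ}
    {M : Matrix (ι ⊕ ι) (ι ⊕ ι) ℝ} (h : HasGaussianChar ψ d M) (hM : M.IsSymm) :
    M.toBlocks₂₂.PosDef := by
  refine PosDef.of_dotProduct_mulVec_pos ?_ ?_
  · rw [IsHermitian, conjTranspose_eq_transpose_of_trivial]
    ext i j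
    exact hM.apply (Sum.inr i) (Sum.inr j)
  intro b hb
  rw [star_trivial]
  set q := b ⬝ᵥ M.toBlocks₂₂ *ᵥ b with hq
  have hnorm : ∀ t : ℝ, ‖inner ℂ ψ (weyl (Sum.elim 0 (t • b)) ψ)‖ = Real.exp (-(t ^ 2 * q / 4)) := by
    intro t
    rw [h, Complex.norm_exp]
    congr 1
    have e : Sum.elim 0 (t • b) ⬝ᵥ M *ᵥ Sum.elim 0 (t • b) = t ^ 2 * q := by
      conv_lhs => rw [← fromBlocks_toBlocks M, fromBlocks_mulVec]
      rw [dotProduct, Fintype.sum_sum_type]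
      simp only [Sum.elim_inl, Sum.elim_inr, Pi.zero_apply, zero_mul, Finset.sum_const_zero,
        zero_add, hq]
      rw [Sum.elim_comp_inl, Sum.elim_comp_inr, mulVec_zero, zero_add, mulVec_smul]
      change (t • b) ⬝ᵥ (t • M.toBlocks₂₂ *ᵥ b) = _
      rw [smul_dotProduct, dotProduct_smul, smul_eq_mul, smul_eq_mul]
      ring
    rw [e, Complex.sub_re, Complex.ofReal_re]
    simp
  -- Momentum displacements act by multiplication, so this is a Fourier transform of `|ψ|²` along a
  -- ray and decays by Riemann–Lebesgue, whereas `exp(-t² q / 4)` would stay at least 1 if `q ≤ 0`.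
  -- The factor `-(2π)⁻¹` below adapts to the normalisation of `Real.fourierChar`.
  have hlim : Tendsto (fun t : ℝ => ‖inner ℂ ψ (weyl (Sum.elim 0 (t • b)) ψ)‖) atTop (𝓝 0) := by
    have hRL := tendsto_integral_exp_smul_cocompact
      (fun x => (starRingEnd ℂ) (ψ x) * ψ x) (volume : Measure (ι → ℝ))
    let Lb : StrongDual ℝ (ι → ℝ) :=
      LinearMap.toContinuousLinearMap (-(2 * Real.pi)⁻¹ • dotProductBilin ℝ ℝ b)
    have hLb : Lb ≠ 0 := by
      intro h0
      have h2 : -(2 * Real.pi)⁻¹ * (b ⬝ᵥ b) = 0 := by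
        have := congrArg (fun L : StrongDual ℝ (ι → ℝ) => L b) h0
        simpa [Lb] using this
      have h3 : b ⬝ᵥ b = 0 := by
        rcases mul_eq_zero.1 h2 with h4 | h4
        · have := Real.pi_pos
          simp at h4
        · exact h4
      exact hb (dotProduct_self_eq_zero.1 h3)
    have hc : Tendsto (fun t : ℝ => t • Lb) atTop (cocompact _) :=
      (isClosedEmbedding_smul_left hLb).tendsto_cocompact.mono_left atTop_le_cocompact
    have h4 := (hRL.comp hc).norm
    rw [norm_zero] at h4
    refine h4.congr fun t => ?_
    rw [inner_weyl_eq_integral, norm_mul]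
    have e1 : ‖Complex.exp (-(Complex.I * (((∑ i, (Sum.elim 0 (t • b) : ι ⊕ ι → ℝ) (Sum.inl i) *
        (Sum.elim 0 (t • b) : ι ⊕ ι → ℝ) (Sum.inr i)) / 2 : ℝ) : ℂ)))‖ = 1 := by
      simp
    rw [e1, one_mul, Function.comp]
    congr 2
    ext x
    rw [Sum.elim_comp_inl, Sum.elim_comp_inr, sub_zero, Circle.smul_def, Real.fourierChar_apply,
      smul_eq_mul]
    congr 2
    have : -(t • Lb) x = (2 * Real.pi)⁻¹ * ((t • b) ⬝ᵥ x) := by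
      simp [Lb]
      ring
    rw [this, mul_comm Complex.I]
    congr 2
    field_simp
  simp_rw [hnorm] at hlim
  by_contra hle
  rw [not_lt] at hle
  have hge : ∀ t : ℝ, 1 ≤ Real.exp (-(t ^ 2 * q / 4)) := fun t => by
    rw [Real.one_le_exp_iff]
    nlinarith [sq_nonneg t]
  have := ge_of_tendsto' hlim hge
  linarith

end Characteristic

end ErgotropicGap

end

noncomputable section

namespace ErgotropicGap

open MeasureTheory Matrix Filter Topology

/-! ### The kernel of a pure Gaussian state and the constraints imposed by its factorisation. -/

section Purity

variable {ι : Type*} [Fintype ι]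

/-- The kernel `conj ψ(x) ψ(x - a)` of a pure state with Gaussian characteristic function of
covariance form `[[P, Qᵀ], [Q, 1]]`. -/
def gaussKernel (P Q : Matrix ι ι ℝ) (a x : ι → ℝ) : ℂ :=
  (∏ _i : ι, ((Real.pi : ℂ) ^ (1 / 2 : ℂ)))⁻¹ *
    Complex.exp (-((a ⬝ᵥ P *ᵥ a / 4 : ℝ) : ℂ) -
      ∑ i, ((x i : ℂ) - ((a i : ℂ) / 2 + Complex.I * ((Q *ᵥ a) i : ℝ) / 2)) ^ 2)

theorem gaussKernel_eq (P Q : Matrix ι ι ℝ) (a x : ι → ℝ) :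
    gaussKernel P Q a x = (∏ _i : ι, ((Real.pi : ℂ) ^ (1 / 2 : ℂ)))⁻¹ *
      Complex.exp (-((a ⬝ᵥ P *ᵥ a / 4 : ℝ) : ℂ) -
        ∑ i, ((a i : ℂ) / 2 + Complex.I * ((Q *ᵥ a) i : ℝ) / 2) ^ 2) *
      Complex.exp (-∑ i, (1 : ℂ) * (x i : ℂ) ^ 2 +
        ∑ i, (2 * ((a i : ℂ) / 2 + Complex.I * ((Q *ᵥ a) i : ℝ) / 2)) * (x i : ℂ)) := by
  rw [gaussKernel, mul_assoc, ← Complex.exp_add]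
  congr 2
  rw [sub_add, sub_right_inj, ← sub_eq_zero]
  simp only [← Finset.sum_neg_distrib, ← Finset.sum_add_distrib, ← Finset.sum_sub_distrib]
  exact Finset.sum_eq_zero fun i _ => by ring

theorem integrable_gaussKernel (P Q : Matrix ι ι ℝ) (a : ι → ℝ) :
    Integrable (gaussKernel P Q a) := by
  have : gaussKernel P Q a = fun x => _ := funext fun x => gaussKernel_eq P Q a x
  rw [this]
  exact (GaussianFourier.integrable_cexp_neg_sum_mul_add (by simp) _).const_mul _

theorem integral_exp_mul_gaussKernel (P Q : Matrix ι ι ℝ) (a b : ι → ℝ) :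
    ∫ x, Complex.exp (Complex.I * ((b ⬝ᵥ x : ℝ) : ℂ)) * gaussKernel P Q a x =
      Complex.exp (Complex.I * ((a ⬝ᵥ b / 2 : ℝ) : ℂ) -
        (((a ⬝ᵥ P *ᵥ a + 2 * (b ⬝ᵥ Q *ᵥ a) + b ⬝ᵥ b) / 4 : ℝ) : ℂ)) := by
  have h1 : ∀ x, Complex.exp (Complex.I * ((b ⬝ᵥ x : ℝ) : ℂ)) * gaussKernel P Q a x =
      (∏ _i : ι, ((Real.pi : ℂ) ^ (1 / 2 : ℂ)))⁻¹ *
      Complex.exp (-((a ⬝ᵥ P *ᵥ a / 4 : ℝ) : ℂ) -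
        ∑ i, ((a i : ℂ) / 2 + Complex.I * ((Q *ᵥ a) i : ℝ) / 2) ^ 2) *
      Complex.exp (-∑ i, (1 : ℂ) * (x i : ℂ) ^ 2 +
        ∑ i, (2 * ((a i : ℂ) / 2 + Complex.I * ((Q *ᵥ a) i : ℝ) / 2) + Complex.I * b i) *
          (x i : ℂ)) := by
    intro x
    rw [gaussKernel_eq, mul_left_comm, ← Complex.exp_add]
    congr 2
    have : Complex.I * ((b ⬝ᵥ x : ℝ) : ℂ) = ∑ i, Complex.I * b i * x i := by
      rw [dotProduct, Complex.ofReal_sum, Finset.mul_sum]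
      exact Finset.sum_congr rfl fun i _ => by push_cast; ring
    rw [this, add_left_comm, ← Finset.sum_add_distrib]
    congr 1
    exact Finset.sum_congr rfl fun i _ => by ring
  simp_rw [h1]
  rw [integral_const_mul, GaussianFourier.integral_cexp_neg_sum_mul_add (by simp),
    Finset.prod_mul_distrib]
  have hne : (∏ _i : ι, ((Real.pi : ℂ) ^ (1 / 2 : ℂ))) ≠ 0 := by
    refine Finset.prod_ne_zero_iff.2 fun i _ => ?_
    rw [Ne, Complex.cpow_eq_zero_iff]
    simp [Real.pi_ne_zero]
  simp only [div_one, mul_one]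
  rw [mul_mul_mul_comm, inv_mul_cancel₀ hne, one_mul, ← Complex.exp_sum, ← Complex.exp_add]
  congr 1
  simp only [dotProduct]
  push_cast
  simp only [Finset.sum_div, Finset.mul_sum, add_div, ← Finset.sum_neg_distrib,
    ← Finset.sum_add_distrib, sub_eq_add_neg]
  refine Finset.sum_congr rfl fun i _ => ?_
  ring_nf
  simp only [Complex.I_sq]
  ring

theorem continuous_gaussKernel (P Q : Matrix ι ι ℝ) :
    Continuous fun p : (ι → ℝ) × (ι → ℝ) => gaussKernel P Q p.1 p.2 := by
  unfold gaussKernel dotProduct mulVec dotProduct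
  fun_prop

theorem gaussKernel_ne_zero (P Q : Matrix ι ι ℝ) (a x : ι → ℝ) : gaussKernel P Q a x ≠ 0 := by
  refine mul_ne_zero (inv_ne_zero ?_) (Complex.exp_ne_zero _)
  refine Finset.prod_ne_zero_iff.2 fun i _ => ?_
  rw [Ne, Complex.cpow_eq_zero_iff]
  simp [Real.pi_ne_zero]

/-- For each `a` both sides are integrable in `x` with the same Fourier transform in `b`; the phase
`exp(i a·b/2)` is that of the Weyl operator. -/
theorem conj_mul_shift_ae_eq {ψ : Modes ι} {P Q : Matrix ι ι ℝ}
    (h : ∀ a b : ι → ℝ, inner ℂ ψ (weyl (Sum.elim a b) ψ) =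
      Complex.exp (-(((a ⬝ᵥ P *ᵥ a + 2 * (b ⬝ᵥ Q *ᵥ a) + b ⬝ᵥ b) / 4 : ℝ) : ℂ))) (a : ι → ℝ) :
    (fun x => (starRingEnd ℂ) (ψ x) * ψ (x - a)) =ᵐ[volume] gaussKernel P Q a := by
  rw [← sub_ae_eq_zero]
  refine ae_eq_zero_of_fourier_eq_zero
    ((integrable_conj_mul_shift ψ ψ a).sub (integrable_gaussKernel P Q a)) fun b => ?_
  simp only [Pi.sub_apply, mul_sub]
  rw [integral_sub (integrable_exp_mul (integrable_conj_mul_shift ψ ψ a) b)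
    (integrable_exp_mul (integrable_gaussKernel P Q a) b), integral_exp_mul_gaussKernel, sub_eq_zero]
  have h1 := inner_weyl_eq_integral ψ ψ (Sum.elim a b)
  rw [h, Sum.elim_comp_inl, Sum.elim_comp_inr] at h1
  have h2 : ∑ i, (Sum.elim a b : ι ⊕ ι → ℝ) (Sum.inl i) * (Sum.elim a b : ι ⊕ ι → ℝ) (Sum.inr i) =
    a ⬝ᵥ b := rfl
  rw [h2] at h1
  rw [sub_eq_add_neg, Complex.exp_add, h1, ← mul_assoc, ← Complex.exp_add]
  simp

/-- If `conj ψ(x) ψ(x - a)` is almost everywhere a continuous nonvanishing kernel, then the kernel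
factors everywhere. -/
theorem exists_kernel_factor {ψ : Modes ι} {G : (ι → ℝ) → (ι → ℝ) → ℂ}
    (hG : Continuous fun p : (ι → ℝ) × (ι → ℝ) => G p.1 p.2) (hG0 : ∀ a x, G a x ≠ 0)
    (h : ∀ a, (fun x => (starRingEnd ℂ) (ψ x) * ψ (x - a)) =ᵐ[volume] G a) :
    ∃ φ : (ι → ℝ) → ℂ, ∀ x y, (starRingEnd ℂ) (φ x) * φ y = G (x - y) x := by
  have hsm : Measurable (ψ : (ι → ℝ) → ℂ) := (Lp.stronglyMeasurable ψ).measurable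
  have hmeas : MeasurableSet {p : (ι → ℝ) × (ι → ℝ) |
      (starRingEnd ℂ) (ψ p.2) * ψ (p.2 - p.1) = G p.1 p.2} := by
    refine measurableSet_eq_fun ?_ hG.measurable
    exact ((Complex.continuous_conj.measurable.comp hsm).comp measurable_snd).mul
      (hsm.comp (measurable_snd.sub measurable_fst))
  -- Fubini swaps the quantifiers, so one `x₀` serves almost every `a`. The row of the kernel at
  -- `x₀` then exhibits `ψ` as a continuous function almost everywhere, and continuity upgrades the
  -- factorisation to all points.
  have h1 : ∀ᵐ x : ι → ℝ, ∀ᵐ a : ι → ℝ,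
      (starRingEnd ℂ) (ψ x) * ψ (x - a) = G a x :=
    (Measure.ae_ae_comm hmeas).1 (Eventually.of_forall fun a => h a)
  obtain ⟨x₀, hx₀⟩ := h1.exists
  have hne : (starRingEnd ℂ) (ψ x₀) ≠ 0 := by
    intro h0
    obtain ⟨a, ha⟩ := hx₀.exists
    rw [h0, zero_mul] at ha
    exact hG0 a x₀ ha.symm
  set φ : (ι → ℝ) → ℂ := fun y => ((starRingEnd ℂ) (ψ x₀))⁻¹ * G (x₀ - y) x₀
    with hφ
  have hφc : Continuous φ :=
    continuous_const.mul (hG.comp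
      ((continuous_const.sub continuous_id).prodMk continuous_const))
  have hae : (ψ : (ι → ℝ) → ℂ) =ᵐ[volume] φ := by
    have hmp : MeasurePreserving (fun y : ι → ℝ => x₀ - y) volume volume :=
      Measure.measurePreserving_sub_left volume x₀
    filter_upwards [hmp.quasiMeasurePreserving.ae hx₀] with y hy
    rw [sub_sub_cancel] at hy
    change ψ y = ((starRingEnd ℂ) (ψ x₀))⁻¹ * G (x₀ - y) x₀
    rw [← hy, ← mul_assoc, inv_mul_cancel₀ hne, one_mul]
  refine ⟨φ, fun x y => ?_⟩
  have key : ∀ a, (fun x => (starRingEnd ℂ) (φ x) * φ (x - a)) = G a := by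
    intro a
    have hc1 : Continuous fun x => (starRingEnd ℂ) (φ x) * φ (x - a) :=
      (Complex.continuous_conj.comp hφc).mul (hφc.comp (continuous_id.sub continuous_const))
    have hc2 : Continuous (fun x => G a x) :=
      hG.comp (continuous_const.prodMk continuous_id)
    rw [← Continuous.ae_eq_iff_eq volume hc1 hc2]
    filter_upwards [h a, hae, (measurePreserving_sub_right volume a).quasiMeasurePreserving.ae hae]
      with x h1 h2 h3
    rw [← h1, h2, h3]
  have := congrFun (key (x - y)) x
  simpa using this

/-- A single `t` would determine `z` only modulo `2πi`; differentiating at `t = 0` removes this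
ambiguity. -/
theorem eq_zero_of_exp_smul_eq_one {z : ℂ} (h : ∀ t : ℝ, Complex.exp (t * z) = 1) : z = 0 := by
  have h1 : HasDerivAt (fun t : ℝ => Complex.exp (t * z)) z 0 := by
    have h2 : HasDerivAt (fun t : ℝ => (t : ℂ) * z) z 0 := by
      simpa using (Complex.ofRealCLM.hasDerivAt (x := (0 : ℝ))).mul_const z
    simpa using h2.cexp
  rw [funext h] at h1
  exact h1.unique (hasDerivAt_const _ _)

theorem gaussKernel_sub_self (P Q : Matrix ι ι ℝ) (x y : ι → ℝ) :
    gaussKernel P Q (x - y) x = (∏ _i : ι, ((Real.pi : ℂ) ^ (1 / 2 : ℂ)))⁻¹ *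
      Complex.exp (-(((x - y) ⬝ᵥ P *ᵥ (x - y) / 4 : ℝ) : ℂ) -
        ∑ i, (((x i : ℂ) - Complex.I * ((Q *ᵥ x) i : ℝ)) / 2 +
          ((y i : ℂ) + Complex.I * ((Q *ᵥ y) i : ℝ)) / 2) ^ 2) := by
  rw [gaussKernel]
  congr 3
  refine Finset.sum_congr rfl fun i _ => ?_
  rw [mulVec_sub, Pi.sub_apply, Pi.sub_apply]
  push_cast
  ring

/-- A factored kernel has trivial cross ratios: `k(x,y) k(0,0) = k(x,0) k(0,y)`. For a Gaussian this
kills the part of the exponent bilinear in `x` and `y`, once `x` is scaled by an arbitrary real `t`.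
The real and imaginary parts of that bilinear term are the two identities. -/
theorem gaussKernel_factor {P Q : Matrix ι ι ℝ} (hP : Pᵀ = P) {φ : (ι → ℝ) → ℂ}
    (h : ∀ x y, (starRingEnd ℂ) (φ x) * φ y = gaussKernel P Q (x - y) x) (x y : ι → ℝ) :
    x ⬝ᵥ P *ᵥ y = x ⬝ᵥ y + (Q *ᵥ x) ⬝ᵥ (Q *ᵥ y) ∧ x ⬝ᵥ Q *ᵥ y = (Q *ᵥ x) ⬝ᵥ y := by
  set z : ℂ := ((x ⬝ᵥ P *ᵥ y - x ⬝ᵥ y - (Q *ᵥ x) ⬝ᵥ (Q *ᵥ y) : ℝ) : ℂ) / 2 +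
    Complex.I * (((Q *ᵥ x) ⬝ᵥ y - x ⬝ᵥ Q *ᵥ y : ℝ) : ℂ) / 2 with hz
  have hz0 : z = 0 := by
    refine eq_zero_of_exp_smul_eq_one fun t => ?_
    have h1 : gaussKernel P Q (t • x - y) (t • x) * gaussKernel P Q (0 - 0) 0 =
        gaussKernel P Q (t • x - 0) (t • x) * gaussKernel P Q (0 - y) 0 := by
      rw [← h, ← h, ← h, ← h]
      ring
    have hne := gaussKernel_ne_zero P Q (0 - 0) 0
    simp only [gaussKernel_sub_self] at h1 hne
    have hc := left_ne_zero_of_mul hne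
    rw [mul_mul_mul_comm _ (Complex.exp _), mul_mul_mul_comm _ (Complex.exp _),
      ← Complex.exp_add, ← Complex.exp_add] at h1
    have h2 := mul_left_cancel₀ (mul_ne_zero hc hc) h1
    rw [← div_eq_one_iff_eq (Complex.exp_ne_zero _), ← Complex.exp_sub] at h2
    rw [← h2]
    congr 1
    have hPxy : y ⬝ᵥ P *ᵥ x = x ⬝ᵥ P *ᵥ y := by
      rw [dotProduct_mulVec, ← mulVec_transpose, hP, dotProduct_comm]
    have e1 : (t • x - y) ⬝ᵥ P *ᵥ (t • x - y) =
        (t • x) ⬝ᵥ P *ᵥ (t • x) + y ⬝ᵥ P *ᵥ y - 2 * t * (x ⬝ᵥ P *ᵥ y) := by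
      simp only [mulVec_sub, mulVec_smul, dotProduct_sub, sub_dotProduct, smul_dotProduct,
        dotProduct_smul, smul_eq_mul, hPxy]
      ring
    have e2 : (0 - y) ⬝ᵥ P *ᵥ (0 - y) = y ⬝ᵥ P *ᵥ y := by simp [mulVec_neg]
    rw [e1, e2, hz]
    simp only [sub_zero, mulVec_smul, mulVec_zero, Pi.smul_apply, Pi.zero_apply, smul_eq_mul,
      zero_dotProduct, zero_div, Complex.ofReal_zero, mul_zero, add_zero, zero_add, neg_zero]
    have e3 : (((x ⬝ᵥ y : ℝ) : ℂ) + (((Q *ᵥ x) ⬝ᵥ (Q *ᵥ y) : ℝ) : ℂ)) +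
        Complex.I * (((x ⬝ᵥ Q *ᵥ y : ℝ) : ℂ) - (((Q *ᵥ x) ⬝ᵥ y : ℝ) : ℂ)) =
        ∑ i, ((x i : ℂ) - Complex.I * ((Q *ᵥ x) i : ℝ)) *
          ((y i : ℂ) + Complex.I * ((Q *ᵥ y) i : ℝ)) := by
      simp only [dotProduct]
      push_cast
      rw [← Finset.sum_add_distrib, ← Finset.sum_sub_distrib, Finset.mul_sum,
        ← Finset.sum_add_distrib]
      refine Finset.sum_congr rfl fun i _ => ?_
      ring_nf
      simp only [Complex.I_sq]
      ring
    have e4 : ∑ i, ((((t * x i : ℝ) : ℂ) - Complex.I * ((t * (Q *ᵥ x) i : ℝ) : ℂ)) / 2 +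
          ((y i : ℂ) + Complex.I * ((Q *ᵥ y) i : ℝ)) / 2) ^ 2 =
        ∑ i, ((((t * x i : ℝ) : ℂ) - Complex.I * ((t * (Q *ᵥ x) i : ℝ) : ℂ)) / 2) ^ 2 +
        ∑ i, (((y i : ℂ) + Complex.I * ((Q *ᵥ y) i : ℝ)) / 2) ^ 2 +
        t / 2 * ∑ i, ((x i : ℂ) - Complex.I * ((Q *ᵥ x) i : ℝ)) *
          ((y i : ℂ) + Complex.I * ((Q *ᵥ y) i : ℝ)) := by
      rw [Finset.mul_sum, ← Finset.sum_add_distrib, ← Finset.sum_add_distrib]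
      refine Finset.sum_congr rfl fun i _ => ?_
      push_cast
      ring
    rw [e4, ← e3]
    push_cast
    simp
    ring
  have hre := congrArg Complex.re hz0
  have him := congrArg Complex.im hz0
  simp [hz] at hre him
  constructor <;> linarith

end Purity

end ErgotropicGap

end

noncomputable section

namespace ErgotropicGap

open MeasureTheory Matrix Filter Topology

/-! ### Transport of characteristic functions and symplecticity of the covariance form. -/

section Transport

variable {ι : Type*} [Fintype ι]

theorem inner_weyl_map {U : Modes ι ≃ₗᵢ[ℂ] Modes ι} {ψ : Modes ι} {ξ ζ : ι ⊕ ι → ℝ} {r : ℝ}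
    (hU : U (weyl ξ ψ) = Complex.exp (Complex.I * (r : ℂ)) • weyl ζ (U ψ)) :
    inner ℂ (U ψ) (weyl ζ (U ψ)) =
      Complex.exp (-(Complex.I * (r : ℂ))) * inner ℂ ψ (weyl ξ ψ) := by
  rw [← U.inner_map_map ψ, hU, inner_smul_right, ← mul_assoc, ← Complex.exp_add]
  simp

/-- Here `L` is the inverse of the phase space action of `U`, so that no inverse matrix enters the
new parameters. -/
theorem HasGaussianChar.map {ψ : Modes ι} {d : ι ⊕ ι → ℝ} {M : Matrix (ι ⊕ ι) (ι ⊕ ι) ℝ}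
    (h : HasGaussianChar ψ d M) {U : Modes ι ≃ₗᵢ[ℂ] Modes ι} {L : Matrix (ι ⊕ ι) (ι ⊕ ι) ℝ}
    {e : ι ⊕ ι → ℝ} (hU : ∀ ζ, U (weyl (L *ᵥ ζ) ψ) =
      Complex.exp (Complex.I * ((e ⬝ᵥ ζ : ℝ) : ℂ)) • weyl ζ (U ψ)) :
    HasGaussianChar (U ψ) (Lᵀ *ᵥ d - e) (Lᵀ * M * L) := by
  intro ζ
  rw [inner_weyl_map (hU ζ), h, ← Complex.exp_add]
  congr 1
  have h1 : (Lᵀ *ᵥ d - e) ⬝ᵥ ζ = d ⬝ᵥ L *ᵥ ζ - e ⬝ᵥ ζ := by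
    rw [sub_dotProduct, mulVec_transpose, dotProduct_mulVec]
  have h2 : ζ ⬝ᵥ (Lᵀ * M * L) *ᵥ ζ = (L *ᵥ ζ) ⬝ᵥ M *ᵥ L *ᵥ ζ := by
    rw [← mulVec_mulVec, ← mulVec_mulVec, dotProduct_mulVec, vecMul_transpose]
  rw [h1, h2]
  push_cast
  ring

variable [DecidableEq ι]

/-- A displacement removes the first moments. -/
theorem HasGaussianChar.center {ψ : Modes ι} {d : ι ⊕ ι → ℝ} {M : Matrix (ι ⊕ ι) (ι ⊕ ι) ℝ}
    (h : HasGaussianChar ψ d M) : HasGaussianChar (weylEquiv (J ι ℝ *ᵥ d) ψ) 0 M := by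
  have h1 := h.map (U := weylEquiv (J ι ℝ *ᵥ d)) (L := 1) (e := d) fun ζ => by
    have e1 : d ⬝ᵥ ζ = sympForm (J ι ℝ *ᵥ d) ζ := by
      rw [sympForm_comm, sympForm_eq, mulVec_mulVec, J_squared, neg_mulVec, one_mulVec,
        dotProduct_neg, neg_neg, dotProduct_comm]
    rw [e1, weylEquiv_apply, weylEquiv_apply, one_mulVec, weyl_weyl, weyl_weyl, smul_smul,
      ← Complex.exp_add, add_comm ζ, sympForm_comm ζ, ← mul_add, ← Complex.ofReal_add]
    congr 4
    ring
  simpa using h1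

theorem HasGaussianChar.lower {ψ : Modes ι} {d : ι ⊕ ι → ℝ} {M : Matrix (ι ⊕ ι) (ι ⊕ ι) ℝ}
    (h : HasGaussianChar ψ d M) {B C : Matrix ι ι ℝ} (hB : B.det ≠ 0) (hC : Cᵀ = C) :
    HasGaussianChar (((chirp (-C)).trans (dilation B hB)) ψ) ((lowerSymplectic B C)ᵀ *ᵥ d)
      ((lowerSymplectic B C)ᵀ * M * lowerSymplectic B C) := by
  have := h.map (U := (chirp (-C)).trans (dilation B hB)) (L := lowerSymplectic B C) (e := 0)
    fun ζ => by rw [chirp_trans_dilation_weyl hB hC]; simp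
  simpa using this

/-- With lower right block 1, the symplectic relations reduce to `Q = Qᵀ` and `P = 1 + Q²`, which
`gaussKernel_factor` provides on basis vectors. -/
theorem symplectic_of_normalized {ψ : Modes ι} {M : Matrix (ι ⊕ ι) (ι ⊕ ι) ℝ}
    (h : HasGaussianChar ψ 0 M) (hM : M.IsSymm) (h22 : M.toBlocks₂₂ = 1) :
    M * J ι ℝ * M = J ι ℝ := by
  obtain ⟨P, Q', Q, T, rfl⟩ : ∃ P Q' Q T, M = fromBlocks P Q' Q T :=
    ⟨_, _, _, _, (fromBlocks_toBlocks M).symm⟩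
  rw [toBlocks_fromBlocks₂₂] at h22
  rw [isSymm_fromBlocks_iff] at hM
  obtain ⟨hP, hQ', hQ, -⟩ := hM
  subst h22
  have h1 : ∀ a b : ι → ℝ, inner ℂ ψ (weyl (Sum.elim a b) ψ) =
      Complex.exp (-(((a ⬝ᵥ P *ᵥ a + 2 * (b ⬝ᵥ Q *ᵥ a) + b ⬝ᵥ b) / 4 : ℝ) : ℂ)) := by
    intro a b
    rw [h]
    have e1 : (Sum.elim a b) ⬝ᵥ fromBlocks P Q' Q 1 *ᵥ (Sum.elim a b) =
        a ⬝ᵥ P *ᵥ a + 2 * (b ⬝ᵥ Q *ᵥ a) + b ⬝ᵥ b := by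
      rw [fromBlocks_mulVec, Sum.elim_comp_inl, Sum.elim_comp_inr, sumElim_dotProduct_sumElim,
        dotProduct_add, dotProduct_add, one_mulVec]
      have e2 : a ⬝ᵥ Q' *ᵥ b = b ⬝ᵥ Q *ᵥ a := by
        rw [← hQ', dotProduct_comm, dotProduct_mulVec, ← mulVec_transpose, transpose_transpose]
      rw [e2]
      ring
    rw [e1]
    simp
  obtain ⟨φ, hφ⟩ := exists_kernel_factor (continuous_gaussKernel P Q) (gaussKernel_ne_zero P Q)
    (conj_mul_shift_ae_eq h1)
  have hfac := gaussKernel_factor hP hφ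
  have hentry : ∀ (X : Matrix ι ι ℝ) i j, (Pi.single i (1 : ℝ)) ⬝ᵥ X *ᵥ (Pi.single j 1) = X i j := by
    intro X i j
    simp
  have hQs : Qᵀ = Q := by
    ext i j
    have := (hfac (Pi.single i 1) (Pi.single j 1)).2
    rw [hentry] at this
    rw [transpose_apply, this]
    simp
  have hPQ : P = 1 + Q * Q := by
    ext i j
    have := (hfac (Pi.single i 1) (Pi.single j 1)).1
    rw [hentry] at this
    have e3 : (Q *ᵥ Pi.single i 1) ⬝ᵥ (Q *ᵥ Pi.single j 1) = (Q * Q) i j := by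
      rw [← (hfac _ _).2, mulVec_mulVec, hentry]
    have e4 : (Pi.single i (1 : ℝ)) ⬝ᵥ (Pi.single j (1 : ℝ)) = (1 : Matrix ι ι ℝ) i j := by
      rw [← hentry 1, one_mulVec]
    rw [this, e3, e4, Matrix.add_apply]
  have hQ'' : Q' = Q := by rw [← hQ, hQs]
  rw [hQ'', ← mem_symplecticGroup_iff_of_isSymm, SymplecticGroup.fromBlocks_mem_iff]
  · rw [hP, hQs, hPQ]
    refine ⟨?_, ?_, ?_⟩
    · rw [add_mul, mul_add, one_mul, mul_one, mul_assoc]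
    · simp
    · simp
  · rw [fromBlocks_transpose, hP, hQs, transpose_one]

/-- Purity: the covariance form of a pure Gaussian state is symplectic. -/
theorem HasGaussianChar.symplectic {ψ : Modes ι} {d : ι ⊕ ι → ℝ}
    {M : Matrix (ι ⊕ ι) (ι ⊕ ι) ℝ} (h : HasGaussianChar ψ d M) (hM : M.IsSymm) :
    M * J ι ℝ * M = J ι ℝ := by
  obtain ⟨B, hB, hBB⟩ := exists_posDef_sqrt (h.posDef_toBlocks₂₂ hM)
  have hBdet : B.det ≠ 0 := hB.det_pos.ne'
  have hBu := isUnit_iff_ne_zero.2 hBdet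
  have hBt : Bᵀ = B := by
    have := hB.isHermitian
    rwa [IsHermitian, conjTranspose_eq_transpose_of_trivial] at this
  have hBi : (B⁻¹)ᵀ = B⁻¹ := by rw [transpose_nonsing_inv, hBt]
  -- This dilation turns the momentum block `B²` into `B⁻¹ B² B⁻¹ = 1`; after centring, the
  -- normalised case applies and the relation is carried back through the symplectic `L`.
  set L := lowerSymplectic B 0 with hL
  have hLmem : L ∈ symplecticGroup ι ℝ := lowerSymplectic_mem hBdet transpose_zero
  have h1 := h.center.lower (C := 0) hBdet transpose_zero
  rw [mulVec_zero, ← hL] at h1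
  have hsymm : (Lᵀ * M * L).IsSymm := by
    rw [Matrix.IsSymm, transpose_mul, transpose_mul, transpose_transpose, hM.eq, mul_assoc]
  have h22 : (Lᵀ * M * L).toBlocks₂₂ = 1 := by
    have e : Lᵀ * M * L = fromBlocks B 0 0 B⁻¹ *
        fromBlocks M.toBlocks₁₁ M.toBlocks₁₂ M.toBlocks₂₁ M.toBlocks₂₂ * fromBlocks B 0 0 B⁻¹ := by
      rw [fromBlocks_toBlocks, hL, lowerSymplectic, fromBlocks_transpose]
      simp [hBt, hBi]
    rw [e, fromBlocks_multiply, fromBlocks_multiply, toBlocks_fromBlocks₂₂, ← hBB]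
    simp only [zero_mul, mul_zero, zero_add]
    rw [← mul_assoc, nonsing_inv_mul _ hBu, one_mul, mul_nonsing_inv _ hBu]
  have h2 := symplectic_of_normalized h1 hsymm h22
  have hLJ : L * J ι ℝ * Lᵀ = J ι ℝ := SymplecticGroup.mem_iff.1 hLmem
  have hLJ' : Lᵀ * J ι ℝ * L = J ι ℝ := SymplecticGroup.mem_iff'.1 hLmem
  have hLu : IsUnit L.det := SymplecticGroup.symplectic_det hLmem
  have h3 : Lᵀ * (M * J ι ℝ * M) * L = Lᵀ * J ι ℝ * L := by
    calc Lᵀ * (M * J ι ℝ * M) * L = Lᵀ * (M * (L * J ι ℝ * Lᵀ) * M) * L := by rw [hLJ]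
      _ = Lᵀ * M * L * J ι ℝ * (Lᵀ * M * L) := by simp only [mul_assoc]
      _ = Lᵀ * J ι ℝ * L := by rw [h2, hLJ']
  have h4 := congrArg (fun X => (Lᵀ)⁻¹ * X * L⁻¹) h3
  simp only [mul_assoc] at h4
  rw [mul_nonsing_inv _ hLu, mul_one, mul_one] at h4
  have hLtu : IsUnit Lᵀ.det := by rwa [det_transpose]
  rw [nonsing_inv_mul_cancel_left _ _ hLtu, nonsing_inv_mul_cancel_left _ _ hLtu] at h4
  rw [mul_assoc, h4]

/-- Cauchy–Schwarz gives `exp(-ξ·Mξ/4) ≤ 1`, hence semidefiniteness, and `M J M = J` rules out a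
kernel. -/
theorem HasGaussianChar.posDef {ψ : Modes ι} {d : ι ⊕ ι → ℝ} {M : Matrix (ι ⊕ ι) (ι ⊕ ι) ℝ}
    (h : HasGaussianChar ψ d M) (hM : M.IsSymm) (h1 : ‖ψ‖ = 1) : M.PosDef := by
  have hps : M.PosSemidef := by
    refine PosSemidef.of_dotProduct_mulVec_nonneg ?_ fun ξ => ?_
    · rw [IsHermitian, conjTranspose_eq_transpose_of_trivial, hM.eq]
    · rw [star_trivial]
      have h2 := norm_inner_le_norm (𝕜 := ℂ) ψ (weyl ξ ψ)
      rw [h, norm_weyl, h1, mul_one, Complex.norm_exp, Complex.sub_re, Complex.ofReal_re,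
        Real.exp_le_one_iff] at h2
      simp at h2
      linarith
  rw [hps.posDef_iff_det_ne_zero]
  intro h0
  have h2 := congrArg det (h.symplectic hM)
  rw [det_mul, h0, mul_zero] at h2
  exact (isUnit_det_J ι ℝ).ne_zero h2.symm

end Transport

end ErgotropicGap

end

noncomputable section

namespace ErgotropicGap

open MeasureTheory Matrix Filter Topology

/-! ### Phase space vectors and matrices relative to a partition of the modes. -/

section Partition

variable {ι : Type*} {κ : Type*}

/-- The sets `A j` are disjoint and cover all modes. -/
structure IsPartition (A : κ → Finset ι) : Prop where
  disjoint : Pairwise fun i j => Disjoint (A i) (A j)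
  cover : ∀ m, ∃ j, m ∈ A j

variable {A : κ → Finset ι}

/-- The identification of the disjoint union of the blocks with the set of modes. -/
def IsPartition.equiv (hA : IsPartition A) : (Σ j, A j) ≃ ι :=
  Equiv.ofBijective (fun p => (p.2 : ι)) ⟨by
    rintro ⟨j, a, ha⟩ ⟨l, b, hb⟩ hab
    simp only at hab
    subst hab
    obtain rfl : j = l := by
      by_contra hjl
      exact Finset.disjoint_left.1 (hA.disjoint hjl) ha hb
    rfl, fun m => by
    obtain ⟨j, hj⟩ := hA.cover m
    exact ⟨⟨j, m, hj⟩, rfl⟩⟩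

theorem IsPartition.equiv_apply (hA : IsPartition A) (p : Σ j, A j) : hA.equiv p = (p.2 : ι) := rfl

theorem IsPartition.equiv_symm_apply (hA : IsPartition A) {j : κ} (a : A j) :
    hA.equiv.symm (a : ι) = ⟨j, a⟩ := by
  rw [Equiv.symm_apply_eq, hA.equiv_apply]

theorem IsPartition.sum_eq [Fintype ι] [Fintype κ] (hA : IsPartition A) {R : Type*}
    [AddCommMonoid R] (f : ι → R) : ∑ i, f i = ∑ j, ∑ a : A j, f a := by
  rw [← hA.equiv.sum_comp f, Fintype.sum_sigma]
  rfl

theorem IsPartition.sum_phaseSpace_eq [Fintype ι] [Fintype κ] (hA : IsPartition A) {R : Type*}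
    [AddCommMonoid R] (f : ι ⊕ ι → R) : ∑ s, f s = ∑ j, ∑ a, f (blockIncl (A j) a) := by
  simp only [Fintype.sum_sum_type, blockIncl, Sum.map_inl, Sum.map_inr, Finset.sum_add_distrib]
  rw [hA.sum_eq fun i => f (Sum.inl i), hA.sum_eq fun i => f (Sum.inr i)]

/-- The phase space vector with given components in the blocks. -/
def IsPartition.glue (hA : IsPartition A) (η : ∀ j, A j ⊕ A j → ℝ) : ι ⊕ ι → ℝ :=
  Sum.elim (fun i => (fun p : Σ j, A j => η p.1 (Sum.inl p.2)) (hA.equiv.symm i))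
    (fun i => (fun p : Σ j, A j => η p.1 (Sum.inr p.2)) (hA.equiv.symm i))

theorem IsPartition.glue_blockIncl (hA : IsPartition A) (η : ∀ j, A j ⊕ A j → ℝ) (j : κ)
    (a : A j ⊕ A j) : hA.glue η (blockIncl (A j) a) = η j a := by
  rcases a with a | a
  · exact congrArg (fun p : Σ j, A j => η p.1 (Sum.inl p.2)) (hA.equiv_symm_apply a)
  · exact congrArg (fun p : Σ j, A j => η p.1 (Sum.inr p.2)) (hA.equiv_symm_apply a)

theorem IsPartition.exists_blockIncl (hA : IsPartition A) (s : ι ⊕ ι) :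
    ∃ j a, s = blockIncl (A j) a := by
  rcases s with i | i <;> obtain ⟨j, hj⟩ := hA.cover i
  · exact ⟨j, Sum.inl ⟨i, hj⟩, rfl⟩
  · exact ⟨j, Sum.inr ⟨i, hj⟩, rfl⟩

/-- Extension by zero of a phase space vector of the modes in `B`. -/
def blockExt (B : Finset ι) (η : B ⊕ B → ℝ) : ι ⊕ ι → ℝ := Function.extend (blockIncl B) η 0

theorem blockExt_blockIncl (B : Finset ι) (η : B ⊕ B → ℝ) (a : B ⊕ B) :
    blockExt B η (blockIncl B a) = η a :=
  (blockIncl_injective B).extend_apply _ _ _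

theorem IsPartition.blockExt_of_ne (hA : IsPartition A) {j l : κ} (h : l ≠ j)
    (η : A j ⊕ A j → ℝ) (a : A l ⊕ A l) : blockExt (A j) η (blockIncl (A l) a) = 0 := by
  refine Function.extend_apply' _ _ _ ?_
  rintro ⟨b, hb⟩
  have hd := Finset.disjoint_left.1 (hA.disjoint h)
  rcases a with ⟨a, ha⟩ | ⟨a, ha⟩ <;> rcases b with ⟨b, hb'⟩ | ⟨b, hb'⟩ <;>
    simp [blockIncl] at hb <;> subst hb <;> exact hd ha hb'

theorem IsPartition.glue_mulVec_blockExt (hA : IsPartition A)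
    (L : ∀ j, Matrix (A j ⊕ A j) (A j ⊕ A j) ℝ) (j : κ) (η : A j ⊕ A j → ℝ) :
    hA.glue (fun l => L l *ᵥ fun a => blockExt (A j) η (blockIncl (A l) a)) =
      blockExt (A j) (L j *ᵥ η) := by
  ext s
  obtain ⟨l, a, rfl⟩ := hA.exists_blockIncl s
  rw [hA.glue_blockIncl]
  by_cases h : l = j
  · subst h
    simp only [blockExt_blockIncl]
  · simp only [hA.blockExt_of_ne h]
    have : (fun _ => 0 : A l ⊕ A l → ℝ) = 0 := rfl
    rw [this, mulVec_zero, Pi.zero_apply]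

theorem dotProduct_blockExt [Fintype ι] [DecidableEq ι] (B : Finset ι) (d : ι ⊕ ι → ℝ)
    (η : B ⊕ B → ℝ) : d ⬝ᵥ blockExt B η = (fun a => d (blockIncl B a)) ⬝ᵥ η := by
  have hz : ∀ b, blockExt B η (blockIncl Bᶜ b) = 0 := by
    intro b
    refine Function.extend_apply' _ _ _ ?_
    rintro ⟨a, ha⟩
    rcases a with ⟨a, ha'⟩ | ⟨a, ha'⟩ <;> rcases b with ⟨b, hb⟩ | ⟨b, hb⟩ <;>
      simp [blockIncl] at ha <;> subst ha <;> simp [ha'] at hb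
  rw [dotProduct, sum_phaseSpace_split B]
  simp only [hz, mul_zero, Finset.sum_const_zero, add_zero, blockExt_blockIncl]
  rfl

theorem blockExt_dotProduct_mulVec [Fintype ι] [DecidableEq ι] (B : Finset ι)
    (M : Matrix (ι ⊕ ι) (ι ⊕ ι) ℝ) (η : B ⊕ B → ℝ) :
    blockExt B η ⬝ᵥ M *ᵥ blockExt B η = η ⬝ᵥ M.submatrix (blockIncl B) (blockIncl B) *ᵥ η := by
  rw [dotProduct_comm, dotProduct_blockExt, dotProduct_comm]
  congr 1
  ext a
  exact dotProduct_blockExt B (M (blockIncl B a)) η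

theorem blockExt_single [DecidableEq ι] (B : Finset ι) (a : B ⊕ B) (t : ℝ) :
    blockExt B (t • Pi.single a 1) = t • Pi.single (blockIncl B a) 1 := by
  ext s
  by_cases hs : ∃ b, blockIncl B b = s
  · obtain ⟨b, rfl⟩ := hs
    rw [blockExt_blockIncl]
    simp only [Pi.smul_apply, Pi.single_apply, (blockIncl_injective B).eq_iff]
  · rw [blockExt, Function.extend_apply' _ _ _ hs]
    have : s ≠ blockIncl B a := fun h => hs ⟨a, h.symm⟩
    simp [this]

end Partition

/-! ### Energy from the characteristic functions of the blocks. -/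

section BlockGaussian

variable {ι : Type*} [Fintype ι]

/-- The characteristic function of `φ` on the phase space of the modes in `B` is Gaussian. -/
def BlockGaussian (φ : Modes ι) (B : Finset ι) (d : B ⊕ B → ℝ)
    (M : Matrix (B ⊕ B) (B ⊕ B) ℝ) : Prop :=
  ∀ ζ, inner ℂ φ (weyl (blockExt B ζ) φ) =
    Complex.exp (Complex.I * ((d ⬝ᵥ ζ : ℝ) : ℂ) - ((ζ ⬝ᵥ M *ᵥ ζ / 4 : ℝ) : ℂ))

variable [DecidableEq ι]

/-- One axis of one block determines the norm of the corresponding quadrature, so correlations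
between blocks never enter the energy. -/
theorem BlockGaussian.along {φ : Modes ι} {B : Finset ι} {d : B ⊕ B → ℝ}
    {M : Matrix (B ⊕ B) (B ⊕ B) ℝ} (h : BlockGaussian φ B d M) (a : B ⊕ B) :
    DifferentiableAt ℝ (orbit φ (blockIncl B a)) 0 ∧
      ‖quad φ (blockIncl B a)‖ ^ 2 = M a.swap a.swap / 2 + d a.swap ^ 2 := by
  refine differentiableAt_orbit fun t => ?_
  have hsw : (blockIncl B a).swap = blockIncl B a.swap := by cases a <;> rfl
  rw [hsw, ← blockExt_single, h]
  congr 3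
  · simp [mul_comm]
  · simp [mulVec_smul]
    ring

theorem sum_swap {α R : Type*} [Fintype α] [AddCommMonoid R] (f : α ⊕ α → R) :
    ∑ a, f (Sum.swap a) = ∑ a, f a :=
  (Equiv.sumComm α α).sum_comp f

/-- The energy of a state with Gaussian reduced states. -/
theorem energy_of_blockGaussian {κ : Type*} [Fintype κ] {A : κ → Finset ι} (hA : IsPartition A)
    {φ : Modes ι} {d : ∀ j, A j ⊕ A j → ℝ} {M : ∀ j, Matrix (A j ⊕ A j) (A j ⊕ A j) ℝ}
    (h : ∀ j, BlockGaussian φ (A j) (d j) (M j)) :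
    FiniteEnergy φ ∧
      energy φ = ∑ j, ((M j).trace / 4 + (∑ a, d j a ^ 2) / 2) := by
  constructor
  · intro s
    obtain ⟨j, a, rfl⟩ := hA.exists_blockIncl s
    exact ((h j).along a).1
  · rw [energy, hA.sum_phaseSpace_eq, Finset.mul_sum]
    refine Finset.sum_congr rfl fun j _ => ?_
    simp only [fun a => ((h j).along a).2]
    rw [Finset.sum_add_distrib, sum_swap fun a => M j a a / 2, sum_swap fun a => d j a ^ 2,
      ← Finset.sum_div]
    have : ∑ a, M j a a = (M j).trace := rfl
    rw [this]
    ring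

theorem HasGaussianChar.energy_eq {φ : Modes ι} {d : ι ⊕ ι → ℝ} {M : Matrix (ι ⊕ ι) (ι ⊕ ι) ℝ}
    (h : HasGaussianChar φ d M) : energy φ = M.trace / 4 + (∑ s, d s ^ 2) / 2 := by
  rw [energy]
  simp only [fun s : ι ⊕ ι => (differentiableAt_orbit (h.along s.swap)).2]
  rw [Finset.sum_add_distrib, sum_swap fun a => M a a / 2, sum_swap fun a => d a ^ 2,
    ← Finset.sum_div]
  have : ∑ a, M a a = M.trace := rfl
  rw [this]
  ring

end BlockGaussian

/-! ### Product vectors and their totality. -/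

section ProductVectors

variable {ι : Type*} [Fintype ι]

theorem quasiMeasurePreserving_restrict (B : Finset ι) :
    Measure.QuasiMeasurePreserving (fun (x : ι → ℝ) (i : B) => x i) volume volume := by
  classical
  have h1 := volume_preserving_piEquivPiSubtypeProd (fun _ : ι => ℝ) (fun i => i ∈ B)
  convert Measure.quasiMeasurePreserving_fst.comp h1.quasiMeasurePreserving
  · rfl
  · rfl

variable {κ : Type*} [Fintype κ] {A : κ → Finset ι}

theorem prod_restrict_ae_eq {f g : ∀ j, (A j → ℝ) → ℂ} (h : ∀ j, f j =ᵐ[volume] g j) :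
    (fun x : ι → ℝ => ∏ j, f j (fun i => x i)) =ᵐ[volume]
      fun x => ∏ j, g j (fun i => x i) := by
  have h1 : ∀ᵐ x : ι → ℝ, ∀ j, f j (fun i => x i) = g j (fun i => x i) :=
    ae_all_iff.2 fun j => (quasiMeasurePreserving_restrict (A j)).ae (h j)
  filter_upwards [h1] with x hx
  exact Finset.prod_congr rfl fun j _ => hx j

theorem weylPhase_eq_prod (hA : IsPartition A) (ξ : ι ⊕ ι → ℝ) (x : ι → ℝ) :
    weylPhase ξ x = ∏ j, weylPhase (fun a => ξ (blockIncl (A j) a)) (fun i : A j => x i) := by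
  simp only [weylPhase]
  rw [← Complex.exp_sum, ← Finset.mul_sum, ← Complex.ofReal_sum]
  congr 3
  rw [hA.sum_eq, hA.sum_eq, Finset.sum_sub_distrib, Finset.sum_div]
  rfl

theorem IsProductVector.weyl (hA : IsPartition A) {f : ∀ j, Modes (A j)} {F : Modes ι}
    (h : IsProductVector A f F) (ξ : ι ⊕ ι → ℝ) :
    IsProductVector A (fun j => weyl (fun a => ξ (blockIncl (A j) a)) (f j)) (weyl ξ F) := by
  refine (coeFn_weyl_congr ξ h).trans ?_
  refine Filter.EventuallyEq.trans (Eventually.of_forall fun x => ?_)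
    (prod_restrict_ae_eq fun j => (coeFn_weyl _ (f j))).symm
  beta_reduce
  rw [weylPhase_eq_prod hA, ← Finset.prod_mul_distrib]
  rfl

theorem IsProductVector.ext {f : ∀ j, Modes (A j)} {F G : Modes ι} (hF : IsProductVector A f F)
    (hG : IsProductVector A f G) : F = G :=
  Lp.ext (hF.trans hG.symm)

theorem IsProductVector.smul {f : ∀ j, Modes (A j)} {F : Modes ι} (h : IsProductVector A f F)
    (c : κ → ℂ) : IsProductVector A (fun j => c j • f j) ((∏ j, c j) • F) := by
  refine (Lp.coeFn_smul _ _).trans ?_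
  refine Filter.EventuallyEq.trans ?_ (prod_restrict_ae_eq fun j => Lp.coeFn_smul (c j) (f j)).symm
  filter_upwards [h] with x hx
  simp only [Pi.smul_apply, smul_eq_mul, hx, Finset.prod_mul_distrib]

/-- The unnormalized ground state wave function. -/
def gaussFun (x : ι → ℝ) : ℂ :=
  Complex.exp (-∑ i, (1 / 2 : ℂ) * (x i : ℂ) ^ 2 + ∑ i, (0 : ℂ) * (x i : ℂ))

theorem memLp_gaussFun : MemLp (gaussFun (ι := ι)) 2 volume := by
  have hc : Continuous (gaussFun (ι := ι)) := by
    unfold gaussFun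
    fun_prop
  rw [memLp_two_iff_integrable_sq_norm hc.aestronglyMeasurable]
  have h := (GaussianFourier.integrable_cexp_neg_sum_mul_add (ι := ι) (b := fun _ => 1)
    (by simp) (fun _ => 0)).norm
  refine h.congr (Eventually.of_forall fun x => ?_)
  simp only [gaussFun]
  rw [← norm_pow, ← Complex.exp_nat_mul]
  congr 2
  simp [Finset.mul_sum]

variable (ι) in
/-- The unnormalized ground state. -/
def gaussVec : Modes ι := memLp_gaussFun.toLp _

theorem isProductVector_gaussVec (hA : IsPartition A) :
    IsProductVector A (fun j => gaussVec (A j)) (gaussVec ι) := by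
  refine memLp_gaussFun.coeFn_toLp.trans ?_
  refine Filter.EventuallyEq.trans (Eventually.of_forall fun x => ?_)
    (prod_restrict_ae_eq fun j => memLp_gaussFun.coeFn_toLp).symm
  simp only [gaussFun]
  rw [← Complex.exp_sum, hA.sum_eq, hA.sum_eq, Finset.sum_add_distrib, Finset.sum_neg_distrib]

/-- Product vectors are total. -/
theorem dense_span_productVectors (hA : IsPartition A) :
    Dense (Submodule.span ℂ {F : Modes ι | ∃ f, IsProductVector A f F} : Set (Modes ι)) := by
  rw [Submodule.dense_iff_topologicalClosure_eq_top, Submodule.topologicalClosure_eq_top_iff,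
    Submodule.eq_bot_iff]
  intro H hH
  -- The vectors `exp(i b·x)` times a Gaussian are product vectors. Orthogonality to all of them
  -- annihilates the Fourier transform of `conj H` times the Gaussian, and the Gaussian has no
  -- zeros.
  have h1 : ∀ b : ι → ℝ, inner ℂ H (ErgotropicGap.weyl (Sum.elim 0 b) (gaussVec ι)) = 0 := fun b =>
    (Submodule.mem_orthogonal' _ _).1 hH _
      (Submodule.subset_span ⟨_, (isProductVector_gaussVec hA).weyl hA _⟩)
  have h2 : (fun x => (starRingEnd ℂ) (H x) * gaussVec ι (x - 0)) =ᵐ[volume] 0 := by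
    refine ae_eq_zero_of_fourier_eq_zero (integrable_conj_mul_shift H (gaussVec ι) 0) fun b => ?_
    have h3 := h1 b
    rw [inner_weyl_eq_integral, Sum.elim_comp_inl, Sum.elim_comp_inr] at h3
    exact (mul_eq_zero.1 h3).resolve_left (Complex.exp_ne_zero _)
  refine Lp.ext (Filter.EventuallyEq.trans ?_ (Lp.coeFn_zero _ _ _).symm)
  filter_upwards [h2, memLp_gaussFun.coeFn_toLp] with x hx hg
  rw [sub_zero, gaussVec, hg] at hx
  have h4 := (mul_eq_zero.1 hx).resolve_right (Complex.exp_ne_zero _)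
  simpa using h4

end ProductVectors

/-! ### Phase space action of local Gaussian unitaries. -/

section LocalUnitaries

variable {ι : Type*} [Fintype ι] {κ : Type*} [Fintype κ] {A : κ → Finset ι}

/-- Covariance of a tensor product of unitaries, from the covariance of its factors. -/
theorem weyl_covariance_of_local (hA : IsPartition A) {U : Modes ι ≃ₗᵢ[ℂ] Modes ι}
    {V : ∀ j, Modes (A j) ≃ₗᵢ[ℂ] Modes (A j)}
    (hUV : ∀ (f : ∀ j, Modes (A j)) (F : Modes ι),
      IsProductVector A f F → IsProductVector A (fun j => V j (f j)) (U F))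
    {L : ∀ j, Matrix (A j ⊕ A j) (A j ⊕ A j) ℝ} {e : ∀ j, A j ⊕ A j → ℝ}
    (hV : ∀ j ζ f, V j (weyl (L j *ᵥ ζ) f) =
      Complex.exp (Complex.I * ((e j ⬝ᵥ ζ : ℝ) : ℂ)) • weyl ζ (V j f))
    (ζ : ι ⊕ ι → ℝ) (F : Modes ι) :
    U (weyl (hA.glue fun j => L j *ᵥ fun a => ζ (blockIncl (A j) a)) F) =
      Complex.exp (Complex.I * ((∑ j, e j ⬝ᵥ (fun a => ζ (blockIncl (A j) a)) : ℝ) : ℂ)) •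
        weyl ζ (U F) := by
  set ξ := hA.glue fun j => L j *ᵥ fun a => ζ (blockIncl (A j) a) with hξ
  set c := Complex.exp (Complex.I * ((∑ j, e j ⬝ᵥ (fun a => ζ (blockIncl (A j) a)) : ℝ) : ℂ))
    with hc
  let T₁ : Modes ι →L[ℂ] Modes ι :=
    (U : Modes ι →L[ℂ] Modes ι).comp (weylEquiv ξ : Modes ι →L[ℂ] Modes ι)
  let T₂ : Modes ι →L[ℂ] Modes ι :=
    c • (weylEquiv ζ : Modes ι →L[ℂ] Modes ι).comp (U : Modes ι →L[ℂ] Modes ι)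
  have hT : T₁ = T₂ := by
    -- The action of `U` is prescribed on product vectors only; both sides are continuous and
    -- linear, and product vectors are total.
    refine ContinuousLinearMap.ext_on (dense_span_productVectors hA) ?_
    rintro G ⟨f, hf⟩
    change U (weyl ξ G) = c • weyl ζ (U G)
    have h1 := hUV _ _ (hf.weyl hA ξ)
    have h2 := ((hUV _ _ hf).weyl hA ζ).smul
      (fun j => Complex.exp (Complex.I * ((e j ⬝ᵥ (fun a => ζ (blockIncl (A j) a)) : ℝ) : ℂ)))
    have h3 : (fun j => V j (weyl (fun a => ξ (blockIncl (A j) a)) (f j))) = fun j =>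
        Complex.exp (Complex.I * ((e j ⬝ᵥ (fun a => ζ (blockIncl (A j) a)) : ℝ) : ℂ)) •
          weyl (fun a => ζ (blockIncl (A j) a)) (V j (f j)) := by
      ext1 j
      rw [← hV]
      simp only [hξ, hA.glue_blockIncl]
    rw [h3] at h1
    have h4 : ∏ j, Complex.exp
        (Complex.I * ((e j ⬝ᵥ (fun a => ζ (blockIncl (A j) a)) : ℝ) : ℂ)) = c := by
      rw [hc, ← Complex.exp_sum, ← Finset.mul_sum, ← Complex.ofReal_sum]
    rw [h4] at h2
    exact h1.ext h2
  exact congrArg (fun T : Modes ι →L[ℂ] Modes ι => T F) hT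

/-- For displacements supported in one block the other factors contribute neither a displacement nor
a phase, which leaves the congruence of that block alone. -/
theorem blockGaussian_of_local [DecidableEq ι] (hA : IsPartition A)
    {U : Modes ι ≃ₗᵢ[ℂ] Modes ι}
    {V : ∀ j, Modes (A j) ≃ₗᵢ[ℂ] Modes (A j)}
    (hUV : ∀ (f : ∀ j, Modes (A j)) (F : Modes ι),
      IsProductVector A f F → IsProductVector A (fun j => V j (f j)) (U F))
    {L : ∀ j, Matrix (A j ⊕ A j) (A j ⊕ A j) ℝ} {e : ∀ j, A j ⊕ A j → ℝ}
    (hV : ∀ j ζ f, V j (weyl (L j *ᵥ ζ) f) =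
      Complex.exp (Complex.I * ((e j ⬝ᵥ ζ : ℝ) : ℂ)) • weyl ζ (V j f))
    {ψ : Modes ι} {d : ι ⊕ ι → ℝ} {M : Matrix (ι ⊕ ι) (ι ⊕ ι) ℝ} (h : HasGaussianChar ψ d M)
    (j : κ) :
    BlockGaussian (U ψ) (A j) ((L j)ᵀ *ᵥ (fun a => d (blockIncl (A j) a)) - e j)
      ((L j)ᵀ * M.submatrix (blockIncl (A j)) (blockIncl (A j)) * L j) := by
  intro ζ
  have h1 := weyl_covariance_of_local hA hUV hV (blockExt (A j) ζ) ψ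
  rw [hA.glue_mulVec_blockExt L j ζ] at h1
  have h2 : ∑ l, e l ⬝ᵥ (fun a => blockExt (A j) ζ (blockIncl (A l) a)) = e j ⬝ᵥ ζ := by
    rw [Finset.sum_eq_single j]
    · simp only [blockExt_blockIncl]
    · intro l _ hl
      simp only [hA.blockExt_of_ne hl]
      exact dotProduct_zero _
    · simp
  rw [h2] at h1
  rw [inner_weyl_map h1, h, ← Complex.exp_add, dotProduct_blockExt, blockExt_dotProduct_mulVec]
  congr 1
  have h3 : ((L j)ᵀ *ᵥ (fun a => d (blockIncl (A j) a)) - e j) ⬝ᵥ ζ =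
      (fun a => d (blockIncl (A j) a)) ⬝ᵥ L j *ᵥ ζ - e j ⬝ᵥ ζ := by
    rw [sub_dotProduct, mulVec_transpose, dotProduct_mulVec]
  have h4 : ζ ⬝ᵥ ((L j)ᵀ * M.submatrix (blockIncl (A j)) (blockIncl (A j)) * L j) *ᵥ ζ =
      (L j *ᵥ ζ) ⬝ᵥ M.submatrix (blockIncl (A j)) (blockIncl (A j)) *ᵥ L j *ᵥ ζ := by
    rw [← mulVec_mulVec, ← mulVec_mulVec, dotProduct_mulVec, vecMul_transpose]
  rw [h3, h4]
  push_cast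
  ring

end LocalUnitaries

end ErgotropicGap

end

noncomputable section

namespace ErgotropicGap

open MeasureTheory Matrix Filter Topology

/-- Any linear order on the index set makes the matrix block triangular. -/
theorem det_blockDiagonal' {κ R : Type*} [Fintype κ] [DecidableEq κ] [CommRing R] {n : κ → Type*}
    [∀ j, Fintype (n j)] [∀ j, DecidableEq (n j)] (B : ∀ j, Matrix (n j) (n j) R) :
    (blockDiagonal' B).det = ∏ j, (B j).det := by
  let _ : LinearOrder κ := LinearOrder.lift' _ (Fintype.equivFin κ).injective
  rw [(blockTriangular_blockDiagonal' B).det_fintype]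
  refine Finset.prod_congr rfl fun j _ => ?_
  let e : n j ≃ {p : Σ j, n j // p.1 = j} :=
    ⟨fun a => ⟨⟨j, a⟩, rfl⟩, fun p => p.2 ▸ p.1.2, fun a => rfl, by rintro ⟨⟨l, a⟩, rfl⟩; rfl⟩
  rw [← det_submatrix_equiv_self e]
  congr 1
  ext a b
  exact blockDiagonal'_apply_eq B j a b

/-! ### Chirps and dilations acting blockwise. -/

section LocalConstruction

variable {ι : Type*} [Fintype ι] {κ : Type*} [Fintype κ] {A : κ → Finset ι}

/-- The product of the chirps of the blocks. -/
def localChirp (A : κ → Finset ι) (C : ∀ j, Matrix (A j) (A j) ℝ) : Modes ι ≃ₗᵢ[ℂ] Modes ι :=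
  phaseOp (θ := fun x => ∏ j, chirpPhase (C j) fun i => x i)
    (continuous_finsetProd _ fun j _ => (continuous_chirpPhase (C j)).comp (by fun_prop))
    (fun x => by simp only [norm_prod, norm_chirpPhase, Finset.prod_const_one])

theorem IsProductVector.localChirp {f : ∀ j, Modes (A j)} {F : Modes ι}
    (h : IsProductVector A f F) (C : ∀ j, Matrix (A j) (A j) ℝ) :
    IsProductVector A (fun j => chirp (C j) (f j)) (localChirp A C F) := by
  refine (coeFn_phaseOp_congr _ _ h).trans ?_
  refine Filter.EventuallyEq.trans (Eventually.of_forall fun x => ?_)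
    (prod_restrict_ae_eq fun j => coeFn_phaseOp_congr _ _ EventuallyEq.rfl).symm
  beta_reduce
  rw [← Finset.prod_mul_distrib]

/-- The matrix acting by `B j` on the coordinates in the block `A j`. -/
def IsPartition.blockMatrix [DecidableEq κ] (hA : IsPartition A)
    (B : ∀ j, Matrix (A j) (A j) ℝ) : Matrix ι ι ℝ :=
  reindex hA.equiv hA.equiv (blockDiagonal' B)

theorem IsPartition.det_blockMatrix [DecidableEq ι] [DecidableEq κ] (hA : IsPartition A)
    (B : ∀ j, Matrix (A j) (A j) ℝ) : (hA.blockMatrix B).det = ∏ j, (B j).det := by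
  rw [blockMatrix, det_reindex_self, det_blockDiagonal']

theorem IsPartition.blockMatrix_mulVec [DecidableEq κ] (hA : IsPartition A)
    (B : ∀ j, Matrix (A j) (A j) ℝ) (x : ι → ℝ) (j : κ) :
    (fun i : A j => (hA.blockMatrix B *ᵥ x) i) = B j *ᵥ fun i => x i := by
  ext i
  rw [mulVec, dotProduct, hA.sum_eq, Finset.sum_eq_single j]
  · refine Finset.sum_congr rfl fun a _ => ?_
    rw [blockMatrix, reindex_apply, submatrix_apply, hA.equiv_symm_apply, hA.equiv_symm_apply,
      blockDiagonal'_apply_eq]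
  · intro l _ hl
    refine Finset.sum_eq_zero fun a _ => ?_
    rw [blockMatrix, reindex_apply, submatrix_apply, hA.equiv_symm_apply, hA.equiv_symm_apply,
      blockDiagonal'_apply_ne _ _ _ hl.symm, zero_mul]
  · simp

theorem IsProductVector.dilation [DecidableEq ι] [DecidableEq κ] (hA : IsPartition A) {f : ∀ j, Modes (A j)}
    {F : Modes ι} (h : IsProductVector A f F) {B : ∀ j, Matrix (A j) (A j) ℝ}
    (hB : ∀ j, (B j).det ≠ 0) (hB' : (hA.blockMatrix B).det ≠ 0) :
    IsProductVector A (fun j => dilation (B j) (hB j) (f j))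
      (dilation (hA.blockMatrix B) hB' F) := by
  refine (coeFn_dilation_congr _ hB' h).trans ?_
  refine Filter.EventuallyEq.trans (Eventually.of_forall fun x => ?_)
    (prod_restrict_ae_eq fun j => coeFn_dilation_congr _ (hB j) EventuallyEq.rfl).symm
  beta_reduce
  have h1 : √|(hA.blockMatrix B).det| = ∏ j, √|(B j).det| := by
    rw [hA.det_blockMatrix, Finset.abs_prod, Real.sqrt_prod _ fun _ _ => abs_nonneg _]
  rw [h1, Complex.ofReal_prod, ← Finset.prod_mul_distrib]
  refine Finset.prod_congr rfl fun j _ => ?_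
  rw [hA.blockMatrix_mulVec]

end LocalConstruction

/-! ### The minimal energies and the ergotropic gap. -/

section Minima

theorem posDef_block {ι : Type*} {M : Matrix (ι ⊕ ι) (ι ⊕ ι) ℝ} (hM : M.PosDef) (B : Finset ι) :
    (M.submatrix (blockIncl B) (blockIncl B)).PosDef :=
  hM.submatrix (blockIncl_injective B)

variable {ι : Type*} [Fintype ι] [DecidableEq ι]

/-- The inverse form of the covariance of a Gaussian unitary. -/
theorem IsGaussianUnitary.exists_inverse_action {U : Modes ι ≃ₗᵢ[ℂ] Modes ι}
    (hU : IsGaussianUnitary U) : ∃ L ∈ symplecticGroup ι ℝ, ∃ e : ι ⊕ ι → ℝ, ∀ ζ f,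
      U (weyl (L *ᵥ ζ) f) = Complex.exp (Complex.I * ((e ⬝ᵥ ζ : ℝ) : ℂ)) • weyl ζ (U f) := by
  obtain ⟨S, hS, d, h⟩ := hU
  have hu : IsUnit S.det := SymplecticGroup.symplectic_det hS
  refine ⟨S⁻¹, ?_, (S⁻¹)ᵀ *ᵥ d, fun ζ f => ?_⟩
  · rw [← SymplecticGroup.coe_inv' ⟨_, hS⟩]
    exact SetLike.coe_mem _
  · rw [h, mulVec_mulVec, mul_nonsing_inv _ hu, one_mulVec, mulVec_transpose, dotProduct_mulVec]

theorem posDef_symplectic_congr {L M : Matrix (ι ⊕ ι) (ι ⊕ ι) ℝ} (hL : L ∈ symplecticGroup ι ℝ)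
    (hM : M.PosDef) : (Lᵀ * M * L).PosDef := by
  have hu : IsUnit L := (isUnit_iff_isUnit_det _).2 (SymplecticGroup.symplectic_det hL)
  rw [← conjTranspose_eq_transpose_of_trivial]
  exact hM.conjTranspose_mul_mul_same (mulVec_injective_of_isUnit hu)

/-- The trace bound is applied to the congruent matrix, which has the same symplectic spectrum;
first moments only add energy. -/
theorem sum_symplecticEigenvalues_le {L M : Matrix (ι ⊕ ι) (ι ⊕ ι) ℝ}
    (hL : L ∈ symplecticGroup ι ℝ) (hM : M.PosDef) (d : ι ⊕ ι → ℝ) :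
    (symplecticEigenvalues M).sum / 2 ≤ (Lᵀ * M * L).trace / 4 + (∑ a, d a ^ 2) / 2 := by
  have h1 := two_mul_sum_symplecticEigenvalues_le_trace (posDef_symplectic_congr hL hM)
  rw [symplecticEigenvalues_congr hL] at h1
  have h2 : 0 ≤ ∑ a, d a ^ 2 := Finset.sum_nonneg fun a _ => sq_nonneg _
  linarith

/-- The minimal energy reachable by Gaussian unitaries. -/
theorem isLeast_globalEnergies {ψ : Modes ι} {d : ι ⊕ ι → ℝ} {M : Matrix (ι ⊕ ι) (ι ⊕ ι) ℝ}
    (h : HasGaussianChar ψ d M) (hM : M.PosDef) :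
    IsLeast (globalEnergies ψ) ((symplecticEigenvalues M).sum / 2) := by
  constructor
  · obtain ⟨B, C, hB, hC, htr⟩ := exists_lowerSymplectic_trace hM
    have h1 := h.center.lower hB.ne_zero hC
    refine ⟨(weylEquiv (J ι ℝ *ᵥ d)).trans ((chirp (-C)).trans (dilation B hB.ne_zero)),
      (isGaussianUnitary_weylEquiv _).trans (isGaussianUnitary_lower hB.ne_zero hC), ?_, ?_⟩
    · exact h1.finiteEnergy
    · rw [LinearIsometryEquiv.trans_apply, h1.energy_eq, htr]
      simp
      ring
  · rintro _ ⟨U, hU, -, rfl⟩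
    obtain ⟨L, hL, e, he⟩ := hU.exists_inverse_action
    rw [(h.map fun ζ => he ζ ψ).energy_eq]
    exact sum_symplecticEigenvalues_le hL hM _

variable {κ : Type*} [Fintype κ] {A : κ → Finset ι}

/-- The minimal energy reachable by local Gaussian unitaries. -/
theorem isLeast_localEnergies (hA : IsPartition A) {ψ : Modes ι} {d : ι ⊕ ι → ℝ}
    {M : Matrix (ι ⊕ ι) (ι ⊕ ι) ℝ} (h : HasGaussianChar ψ d M) (hM : M.PosDef) :
    IsLeast (localEnergies A ψ)
      (∑ j, (symplecticEigenvalues (M.submatrix (blockIncl (A j)) (blockIncl (A j)))).sum / 2) := by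
  classical
  constructor
  · choose B C hB hC htr using fun j => exists_lowerSymplectic_trace (posDef_block hM (A j))
    have hB0 : ∀ j, (B j).det ≠ 0 := fun j => (hB j).ne_zero
    have hB' : (hA.blockMatrix B).det ≠ 0 := by
      rw [hA.det_blockMatrix]
      exact Finset.prod_ne_zero_iff.2 fun j _ => hB0 j
    -- A single chirp and a single dilation of the whole system with block diagonal data act as the
    -- tensor product of the optimal block unitaries, so no tensor product of operators has to be
    -- built. The centring displacement splits by restriction to the blocks.
    let U : Modes ι ≃ₗᵢ[ℂ] Modes ι :=
      (localChirp A fun j => -C j).trans (dilation (hA.blockMatrix B) hB')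
    have hU : ∀ (f : ∀ j, Modes (A j)) (F : Modes ι), IsProductVector A f F →
        IsProductVector A (fun j => ((chirp (-C j)).trans (dilation (B j) (hB0 j))) (f j)) (U F) :=
      fun f F hf => (hf.localChirp fun j => -C j).dilation hA hB0 hB'
    have h1 := energy_of_blockGaussian hA <| blockGaussian_of_local hA hU
      (L := fun j => lowerSymplectic (B j) (C j)) (e := 0)
      (fun j ζ f => by rw [chirp_trans_dilation_weyl (hB0 j) (hC j)]; simp) h.center
    refine ⟨(weylEquiv (J ι ℝ *ᵥ d)).trans U,
      ⟨fun j => (weylEquiv fun a => (J ι ℝ *ᵥ d) (blockIncl (A j) a)).trans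
        ((chirp (-C j)).trans (dilation (B j) (hB0 j))), fun j => ?_, fun f F hf => ?_⟩,
      h1.1, ?_⟩
    · exact (isGaussianUnitary_weylEquiv _).trans (isGaussianUnitary_lower (hB0 j) (hC j))
    · exact hU _ _ (hf.weyl hA _)
    · rw [LinearIsometryEquiv.trans_apply, h1.2]
      refine Finset.sum_congr rfl fun j _ => ?_
      rw [htr]
      have h0 : (fun a => (0 : ι ⊕ ι → ℝ) (blockIncl (A j) a)) = 0 := rfl
      rw [h0, mulVec_zero]
      simp
      ring
  · rintro _ ⟨U, ⟨V, hV, hUV⟩, -, rfl⟩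
    choose L hL e he using fun j => (hV j).exists_inverse_action
    rw [(energy_of_blockGaussian hA (blockGaussian_of_local hA hUV he h)).2]
    exact Finset.sum_le_sum fun j _ => sum_symplecticEigenvalues_le (hL j) (posDef_block hM _) _

/-- The ergotropic gap of a pure Gaussian state. -/
theorem ergotropicGap_eq (hA : IsPartition A) {ψ : Modes ι} {d : ι ⊕ ι → ℝ}
    {M : Matrix (ι ⊕ ι) (ι ⊕ ι) ℝ} (h : HasGaussianChar ψ d M) (hM : M.PosDef)
    (hMJ : M * J ι ℝ * M = J ι ℝ) :
    ergotropicGap A ψ = (1 / 2) * ∑ j, ((symplecticEigenvalues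
      (M.submatrix (blockIncl (A j)) (blockIncl (A j)))).map fun ν => ν - 1).sum := by
  -- Purity makes the global minimum half the number of modes; counting modes by blocks turns it
  -- into one `-1` for each symplectic eigenvalue.
  have hcard : (Fintype.card ι : ℝ) = ∑ j, ((A j).card : ℝ) := by
    have h1 := hA.sum_eq fun _ => (1 : ℝ)
    simpa using h1
  rw [ergotropicGap, globalErgotropy, localErgotropy, (isLeast_globalEnergies h hM).csInf_eq,
    (isLeast_localEnergies hA h hM).csInf_eq, sum_symplecticEigenvalues_of_symplectic hM hMJ, hcard]
  have h2 : ∀ j, ((symplecticEigenvalues (M.submatrix (blockIncl (A j)) (blockIncl (A j)))).map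
      fun ν => ν - 1).sum =
      (symplecticEigenvalues (M.submatrix (blockIncl (A j)) (blockIncl (A j)))).sum -
        ((A j).card : ℝ) := by
    intro j
    rw [Multiset.sum_map_sub, Multiset.map_id', Multiset.map_const', Multiset.sum_replicate,
      card_symplecticEigenvalues (posDef_block hM (A j)), Fintype.card_coe, nsmul_eq_mul, mul_one]
  simp only [h2, Finset.sum_sub_distrib, ← Finset.sum_div]
  ring

theorem isPartition_compl (B : Finset ι) : IsPartition ![B, Bᶜ] where
  disjoint := by
    intro i j hij
    fin_cases i <;> fin_cases j <;> simp at hij ⊢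
    · exact disjoint_compl_right
    · exact disjoint_compl_left
  cover m := by
    by_cases hm : m ∈ B
    · exact ⟨0, hm⟩
    · exact ⟨1, Finset.mem_compl.2 hm⟩

/-- The complement contributes the same sum as `B`, which doubles it and cancels the `1/2`. -/
theorem ergotropicGap_compl_eq (B : Finset ι) {ψ : Modes ι} {d : ι ⊕ ι → ℝ}
    {M : Matrix (ι ⊕ ι) (ι ⊕ ι) ℝ} (h : HasGaussianChar ψ d M) (hM : M.PosDef)
    (hMJ : M * J ι ℝ * M = J ι ℝ) :
    ergotropicGap ![B, Bᶜ] ψ = ((symplecticEigenvalues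
      (M.submatrix (blockIncl B) (blockIncl B))).map fun ν => ν - 1).sum := by
  rw [ergotropicGap_eq (isPartition_compl B) h hM hMJ, Fin.sum_univ_two]
  have h1 := sum_sub_one_compl hM hMJ B
  change (1 / 2) * (((symplecticEigenvalues
      (M.submatrix (blockIncl B) (blockIncl B))).map fun ν => ν - 1).sum +
      ((symplecticEigenvalues
      (M.submatrix (blockIncl Bᶜ) (blockIncl Bᶜ))).map fun ν => ν - 1).sum) = _
  rw [h1]
  ring

end Minima

end ErgotropicGap

end

theorem lemma2 (N k : ℕ) (ψ : ErgotropicGap.Modes (Fin N))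
    (hψ : ErgotropicGap.IsPureGaussian ψ)
    (A : Fin k → Finset (Fin N)) (hne : ∀ j, (A j).Nonempty)
    (hdisj : Pairwise fun i j => Disjoint (A i) (A j))
    (hcover : ∀ m, ∃ j, m ∈ A j) :
    -- the energy of the state is finite and all the minima that enter the gaps are attained
    ErgotropicGap.FiniteEnergy ψ ∧
    IsLeast (ErgotropicGap.globalEnergies ψ) (sInf (ErgotropicGap.globalEnergies ψ)) ∧
    IsLeast (ErgotropicGap.localEnergies A ψ) (sInf (ErgotropicGap.localEnergies A ψ)) ∧
    (∀ j, IsLeast (ErgotropicGap.localEnergies ![A j, (A j)ᶜ] ψ)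
      (sInf (ErgotropicGap.localEnergies ![A j, (A j)ᶜ] ψ))) ∧
    -- there are `m_j = |A_j|` symplectic eigenvalues in each part
    (∀ j, (ErgotropicGap.symplecticEigenvalues
      (ErgotropicGap.reducedCov (A j) ψ)).card = (A j).card) ∧
    -- the gap in terms of the symplectic eigenvalues
    ErgotropicGap.ergotropicGap A ψ =
      (1 / 2) * ∑ j, ((ErgotropicGap.symplecticEigenvalues
        (ErgotropicGap.reducedCov (A j) ψ)).map fun ν => ν - 1).sum ∧
    -- the gap in terms of the gaps of the bipartitions
    ErgotropicGap.ergotropicGap A ψ =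
      (1 / 2) * ∑ j, ErgotropicGap.ergotropicGap ![A j, (A j)ᶜ] ψ ∧
    (∀ j, ErgotropicGap.ergotropicGap ![A j, (A j)ᶜ] ψ =
      ((ErgotropicGap.symplecticEigenvalues
        (ErgotropicGap.reducedCov (A j) ψ)).map fun ν => ν - 1).sum) := by
  obtain ⟨hnorm, d, M, hsymm, h⟩ := hψ
  replace h : ErgotropicGap.HasGaussianChar ψ d M := h
  have hM := h.posDef hsymm hnorm
  have hMJ := h.symplectic hsymm
  have hA : ErgotropicGap.IsPartition A := ⟨hdisj, hcover⟩
  have hleast : ∀ {s : Set ℝ} {a : ℝ}, IsLeast s a → IsLeast s (sInf s) := fun hs =>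
    hs.csInf_eq ▸ hs
  -- Once the spectra and the bipartite gaps are written in terms of `M`, the two formulas for the
  -- gap of `A` become the same statement.
  simp only [h.symplecticEigenvalues_reducedCov hsymm,
    fun j => ErgotropicGap.ergotropicGap_compl_eq (A j) h hM hMJ]
  refine ⟨h.finiteEnergy, hleast (ErgotropicGap.isLeast_globalEnergies h hM),
    hleast (ErgotropicGap.isLeast_localEnergies hA h hM),
    fun j => hleast
      (ErgotropicGap.isLeast_localEnergies (ErgotropicGap.isPartition_compl (A j)) h hM),
    fun j => ?_, ErgotropicGap.ergotropicGap_eq hA h hM hMJ,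
    ErgotropicGap.ergotropicGap_eq hA h hM hMJ, fun _ => trivial⟩
  rw [ErgotropicGap.card_symplecticEigenvalues (ErgotropicGap.posDef_block hM (A j)),
    Fintype.card_coe]
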